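/- **Setting.** Let $N\ge 1$. For $E\subset\mathbb R^N$ let $\operatorname{cap}(E)=\inf\int_{\mathbb R^N}(|\nabla u|^2+u^2)\,dx$ over all $u\in H^1(\mathbb R^N)$ with $u\ge 1$ almost everywhere in a neighbourhood of $E$ (with $\inf\emptyset=+\infty$). A property holds quasi-everywhere (q.e.) if it fails only on a set of capacity zero, and every $u\in H^1(\mathbb R^N)$ is identified with its quasi-continuous representative, which is unique up to sets of capacity zero. A *capacitary measure* is a nonnegative Borel measure $\mu$ on $\mathbb R^N$, possibly taking the value $+\infty$ (even on large sets), that vanishes on all sets of capacity zero. Put $$\|u\|_{1,\mu}^2=\int_{\mathbb R^N}(|\nabla u|^2+u^2)\,dx+\int_{\mathbb R^N}u^2\,d\mu,\qquad H^1_\mu=\{u\in H^1(\mathbb R^N):\|u\|_{1,\mu}<\infty\}.$$ Let $B_R$ be the open ball of radius $R$ centred at $0$. For $R>0$ let $w_R$ be the weak solution of $-\Delta w_R+w_R+\mu w_R=1$ with Dirichlet condition outside $B_R$; that is, $w_R$ belongs to $V_R=\{u\in H^1_\mu: u=0 \text{ q.e. on } \mathbb R^N\setminus B_R\}$ and $$\int_{\mathbb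 R^N}(\nabla w_R\cdot\nabla\varphi+w_R\varphi)\,dx+\int_{\mathbb R^N}w_R\,\varphi\,d\mu=\int_{\mathbb R^N}\varphi\,dx\qquad\text{for all }\varphi\in V_R.$$ Define $w_\mu=\lim_{R\to\infty}w_R$, the limit being taken almost everywhere along every sequence of radii tending to $+\infty$. **Theorem 3.1.** Let $\mu$ be a capacitary measure on $\mathbb R^N$. Then the solutions $w_R$ and the limit $w_\mu$ exist, and the embedding $H^1_\mu\hookrightarrow L^2(\mathbb R^N)$ is compact if and only if $w_\mu$ vanishes uniformly at infinity, that is, $$\|w_\mu\,1_{\mathbb R^N\setminus B_R}\|_{L^\infty(\mathbb R^N)}\to 0\qquad\text{as }R\to\infty.$$ -/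

import Mathlib

open MeasureTheory Filter Topology
open scoped ENNReal NNReal ContDiff RealInnerProductSpace

noncomputable section

namespace CapacitaryMeasure

/-- The space `ℝ^N` with its Euclidean norm and Lebesgue measure. -/
abbrev Eucl (N : ℕ) : Type := EuclideanSpace ℝ (Fin N)

/-- An element of `H¹(ℝ^N)`: a representative `toFun ∈ L²` together with a representative
`grad ∈ L²` of its weak gradient, characterized through test functions in `C_c^∞(ℝ^N)`. -/
structure H1 (N : ℕ) where
  toFun : Eucl N → ℝ
  grad : Eucl N → Eucl N
  memLp_toFun : MemLp toFun 2 volume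
  memLp_grad : MemLp grad 2 volume
  weak_grad : ∀ φ : Eucl N → ℝ, ContDiff ℝ ∞ φ → HasCompactSupport φ → ∀ v : Eucl N,
    ∫ x, toFun x * fderiv ℝ φ x v = - ∫ x, ⟪grad x, v⟫ * φ x

/-- The capacity `cap(E) = inf {∫ |∇u|² + u² dx}` over all `u ∈ H¹(ℝ^N)` with `u ≥ 1` almost
everywhere in a neighbourhood of `E` (and `+∞` if there is no such `u`). -/
def cap {N : ℕ} (E : Set (Eucl N)) : ℝ≥0∞ :=
  ⨅ (u : H1 N) (_ : ∃ U : Set (Eucl N), IsOpen U ∧ E ⊆ U ∧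
      ∀ᵐ x ∂(volume : Measure (Eucl N)), x ∈ U → 1 ≤ u.toFun x),
    ∫⁻ x, (‖u.grad x‖ₑ ^ 2 + ‖u.toFun x‖ₑ ^ 2)

/-- A property holds quasi-everywhere on `E` if it fails only on a subset of capacity zero. -/
def QuasiEverywhereOn {N : ℕ} (E : Set (Eucl N)) (P : Eucl N → Prop) : Prop :=
  cap {x | x ∈ E ∧ ¬ P x} = 0

def QuasiContinuous {N : ℕ} (f : Eucl N → ℝ) : Prop :=
  ∀ ε : ℝ≥0∞, 0 < ε → ∃ g : Eucl N → ℝ, Continuous g ∧ cap {x | f x ≠ g x} < ε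

/-- Nonnegative Borel measures, possibly `+∞` valued and with no finiteness assumption,
that vanish on all sets of capacity zero. (A Mathlib measure is automatically Borel regular:
every set is contained in a Borel set of the same measure.) -/
def IsCapacitary {N : ℕ} (μ : Measure (Eucl N)) : Prop :=
  ∀ E : Set (Eucl N), cap E = 0 → μ E = 0

/-- `‖u‖²_{1,μ} = ∫ |∇u|² + |u|² dx + ∫ |u|² dμ`, with values in `[0, ∞]`. -/
def normSq {N : ℕ} (μ : Measure (Eucl N)) (u : H1 N) : ℝ≥0∞ :=
  (∫⁻ x, (‖u.grad x‖ₑ ^ 2 + ‖u.toFun x‖ₑ ^ 2)) + ∫⁻ x, ‖u.toFun x‖ₑ ^ 2 ∂μ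

/-- The space `H¹_μ`: Sobolev functions, identified with their quasi-continuous
representatives, such that `‖u‖_{1,μ} < ∞`. -/
def H1mu {N : ℕ} (μ : Measure (Eucl N)) : Set (H1 N) :=
  {u | QuasiContinuous u.toFun ∧ normSq μ u < ⊤}

/-- The space `H¹_0(Ω) ∩ H¹_μ`, which is `H¹` for the Dirichlet restriction
`μ + ∞_{ℝ^N \ Ω}` of `μ` to `Ω`. -/
def H1muDirichlet {N : ℕ} (μ : Measure (Eucl N)) (Ω : Set (Eucl N)) : Set (H1 N) :=
  {u | u ∈ H1mu μ ∧ QuasiEverywhereOn Ωᶜ (fun x => u.toFun x = 0)}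

/-- `u` is the weak solution of `-Δu + u + μu = f`, `u ∈ H¹_0(Ω) ∩ H¹_μ`. -/
def IsWeakSolution {N : ℕ} (μ : Measure (Eucl N)) (Ω : Set (Eucl N)) (f : Eucl N → ℝ)
    (u : H1 N) : Prop :=
  u ∈ H1muDirichlet μ Ω ∧ ∀ φ ∈ H1muDirichlet μ Ω,
    (∫ x, (⟪u.grad x, φ.grad x⟫ + u.toFun x * φ.toFun x)) + ∫ x, u.toFun x * φ.toFun x ∂μ
      = ∫ x, f x * φ.toFun x

/-- `w = w_μ` is the limit, as `R → ∞`, of the solutions `u R` of `-Δu + u + μu = 1` with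
Dirichlet condition outside the ball `B_R`. The solutions are determined only almost everywhere,
so the limit over the continuous parameter `R` is taken as an almost everywhere
limit along every sequence of radii tending to infinity. -/
def IsTorsionLimit {N : ℕ} (μ : Measure (Eucl N)) (w : Eucl N → ℝ) : Prop :=
  ∃ u : ℝ → H1 N,
    (∀ R : ℝ, 0 < R → IsWeakSolution μ (Metric.ball 0 R) (fun _ => 1) (u R)) ∧
    ∀ R : ℕ → ℝ, Tendsto R atTop atTop →
      ∀ᵐ x ∂(volume : Measure (Eucl N)),
        Tendsto (fun n => (u (R n)).toFun x) atTop (𝓝 (w x))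

/-- The embedding `H¹_μ ↪ L²(ℝ^N)` is compact: the image of every bounded subset of `H¹_μ` is
relatively compact in `L²(ℝ^N)`. -/
def CompactEmbedding {N : ℕ} (μ : Measure (Eucl N)) : Prop :=
  ∀ C : ℝ≥0, IsCompact (closure
    ((fun u : H1 N => (u.memLp_toFun.toLp u.toFun : Lp ℝ 2 (volume : Measure (Eucl N)))) ''
      {u | u ∈ H1mu μ ∧ normSq μ u ≤ C}))

end CapacitaryMeasure

end

/-! Sufficiency rests on a Hardy inequality. Testing the equation of `w_R` with `u² / (w_R + δ)` and
using Picone's inequality gives `∫ u² / (w_R + δ) ≤ ‖u‖²_{1,μ}` for bounded `u` vanishing outside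
`B_R` (`IsWeakSolution.integral_div_le`). If `w_μ ≤ ε` outside `B_ρ`, then also `w_R ≤ ε` there, and
`δ = ε` bounds the tail `∫_{|x| ≥ ρ} u²` by a multiple of `ε ‖u‖²_{1,μ}` (`lintegral_tail_le`).
Uniformly small tails together with Rellich's theorem on balls (`exists_convergent_subseq`) give
compactness.

Necessity rests on a mean value inequality. Every `w_R` satisfies `0 ≤ w_R ≤ 1` and `-Δ w_R ≤ 1` in
the sense of distributions (`IsWeakSolution.subsolution`), so a value above `ε` at almost any point
`x` forces a definite amount of mass in a ball of fixed radius around `x`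
(`IsBoundedSubsolution.mean_value`). If `w_μ` does not vanish uniformly at infinity, such points
exist arbitrarily far away. Cutting off around them (`IsWeakSolution.exists_localization`) yields a
bounded sequence in `H¹_μ` that escapes to infinity with `L²` norms bounded below
(`not_compactEmbedding`).

The solutions exist by orthogonal projection onto a closed subspace of `L² × L² × L²(μ)`; comparison
makes them increasing in `R` and bounded by `1`, whence the limit.

No chain rule for weak derivatives is used. The form `∫ ∇u·∇w` is the limit of `t⁻² ∫ (u(x+te) -
u(x)) (w(x+te) - w(x))` summed over the directions `e`, so each nonlinear test function requires
only an algebraic inequality between increments (`H1.integral_grad_inner_le`). Membership in `H¹` is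
likewise obtained from bounded difference quotients (`exists_H1_of_diff_bound`). -/

noncomputable section

namespace CapacitaryMeasure

/-! ### Square-integrable functions and a criterion for strong convergence. -/

section L2

variable {α : Type*} [MeasurableSpace α] {μ : Measure α}

lemma eLpNorm_two_sq {F : Type*} [NormedAddCommGroup F] (f : α → F) :
    eLpNorm f 2 μ ^ 2 = ∫⁻ x, ‖f x‖ₑ ^ 2 ∂μ := by
  rw [eLpNorm_eq_lintegral_rpow_enorm_toReal (by norm_num) (by norm_num)]
  simp only [ENNReal.toReal_ofNat, ENNReal.rpow_ofNat]
  rw [← ENNReal.rpow_natCast, ← ENNReal.rpow_mul]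
  norm_num

lemma memLp_two_iff {F : Type*} [NormedAddCommGroup F] {f : α → F}
    (hf : AEStronglyMeasurable f μ) : MemLp f 2 μ ↔ ∫⁻ x, ‖f x‖ₑ ^ 2 ∂μ < ⊤ := by
  rw [← eLpNorm_two_sq]
  refine ⟨fun h => ENNReal.pow_lt_top h.2, fun h => ⟨hf, ?_⟩⟩
  by_contra h'
  simp [not_lt_top_iff.1 h'] at h

lemma _root_.MeasureTheory.MemLp.lintegral_sq_lt_top {F : Type*} [NormedAddCommGroup F] {f : α → F}
    (hf : MemLp f 2 μ) : ∫⁻ x, ‖f x‖ₑ ^ 2 ∂μ < ⊤ := (memLp_two_iff hf.1).1 hf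

lemma inner_toLp {f g : α → ℝ} (hf : MemLp f 2 μ) (hg : MemLp g 2 μ) :
    ⟪hf.toLp f, hg.toLp g⟫ = ∫ x, f x * g x ∂μ := by
  rw [L2.inner_def]
  refine integral_congr_ae ?_
  filter_upwards [hf.coeFn_toLp, hg.coeFn_toLp] with x h1 h2
  rw [h1, h2]; simp [mul_comm]

lemma ofReal_norm_toLp_sq {F : Type*} [NormedAddCommGroup F] {f : α → F} (hf : MemLp f 2 μ) :
    ENNReal.ofReal (‖hf.toLp f‖ ^ 2) = ∫⁻ x, ‖f x‖ₑ ^ 2 ∂μ := by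
  rw [Lp.norm_toLp, ENNReal.ofReal_pow ENNReal.toReal_nonneg, ENNReal.ofReal_toReal hf.2.ne,
    eLpNorm_two_sq]

lemma abs_integral_mul_le {f g : α → ℝ} (hf : MemLp f 2 μ) (hg : MemLp g 2 μ) :
    |∫ x, f x * g x ∂μ| ≤ ‖hf.toLp f‖ * ‖hg.toLp g‖ := by
  rw [← inner_toLp hf hg]
  exact abs_real_inner_le_norm _ _

lemma lintegral_enorm_sq_eq_ofReal {f : α → ℝ} (hf : MemLp f 2 μ) :
    ∫⁻ x, ‖f x‖ₑ ^ 2 ∂μ = ENNReal.ofReal (∫ x, f x * f x ∂μ) := by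
  rw [← ofReal_norm_toLp_sq hf, ← inner_toLp hf hf, real_inner_self_eq_norm_sq]

/-- Weak convergence becomes strong when the norms do not exceed that of the limit: `‖D - G‖² ≤ 2
(‖G‖² - ⟪D, G⟫)`, and the inner product is tested on a dense set. -/
lemma tendsto_of_tendsto_inner_dense {H ι : Type*} [NormedAddCommGroup H] [InnerProductSpace ℝ H]
    {l : Filter ι} {D : ι → H} {G : H} {S : Set H} (hS : Dense S)
    (hw : ∀ ψ ∈ S, Tendsto (fun t => ⟪D t, ψ⟫) l (𝓝 ⟪G, ψ⟫)) (hD : ∀ᶠ t in l, ‖D t‖ ≤ ‖G‖) :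
    Tendsto D l (𝓝 G) := by
  rw [Metric.tendsto_nhds]
  intro ε hε
  -- Replacing `G` by `ψ` costs at most `4 ‖G‖ δ` in the final estimate, the weak convergence at `ψ`
  -- another `ε² / 2`.
  obtain ⟨δ, hδ, hδε⟩ : ∃ δ > 0, 4 * ‖G‖ * δ < ε ^ 2 / 2 := by
    refine ⟨ε ^ 2 / (16 * (‖G‖ + 1)), by positivity, ?_⟩
    have : 0 < ‖G‖ + 1 := by positivity
    rw [mul_div_assoc', div_lt_iff₀ (by positivity)]
    nlinarith [norm_nonneg G, sq_pos_of_pos hε]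
  obtain ⟨ψ, hψ, hψS⟩ := Metric.dense_iff.1 hS G δ hδ
  have h1 := hw ψ hψS
  rw [Metric.tendsto_nhds] at h1
  filter_upwards [hD, h1 (ε ^ 2 / 4) (by positivity)] with t ht h2
  rw [Real.dist_eq] at h2
  rw [Metric.mem_ball, dist_eq_norm] at hψ
  rw [dist_eq_norm]
  have e1 : ‖D t - G‖ ^ 2 = ‖D t‖ ^ 2 - 2 * ⟪D t, G⟫ + ‖G‖ ^ 2 := norm_sub_sq_real _ _
  have e2 : ⟪D t, G⟫ = ⟪D t, ψ⟫ - ⟪D t, ψ - G⟫ := by rw [inner_sub_right]; ring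
  have e3 : ⟪G, G⟫ = ⟪G, ψ⟫ - ⟪G, ψ - G⟫ := by rw [inner_sub_right]; ring
  rw [real_inner_self_eq_norm_sq] at e3
  have e4 := abs_le.1 (abs_real_inner_le_norm (D t) (ψ - G))
  have e5 := abs_le.1 (abs_real_inner_le_norm G (ψ - G))
  have e6 : ‖D t‖ * ‖ψ - G‖ ≤ ‖G‖ * δ := by gcongr
  have e7 : ‖G‖ * ‖ψ - G‖ ≤ ‖G‖ * δ := by gcongr
  have e8 : ‖D t‖ ^ 2 ≤ ‖G‖ ^ 2 := by gcongr
  have e9 := abs_lt.1 h2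
  have : ‖D t - G‖ ^ 2 < ε ^ 2 := by nlinarith
  exact lt_of_pow_lt_pow_left₀ 2 hε.le this

end L2

/-! ### Translations and duality with test functions. -/

section Translation

variable {N : ℕ}

lemma _root_.MeasureTheory.MemLp.comp_add {F : Type*} [NormedAddCommGroup F] {f : Eucl N → F}
    (hf : MemLp f 2 volume) (h : Eucl N) : MemLp (fun x => f (x + h)) 2 volume :=
  hf.comp_measurePreserving (measurePreserving_add_right volume h)

lemma _root_.MeasureTheory.MemLp.diff {f : Eucl N → ℝ} (hf : MemLp f 2 volume) (h : Eucl N) :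
    MemLp (fun x => f (x + h) - f x) 2 volume := (hf.comp_add h).sub hf

lemma memLp_of_test {φ : Eucl N → ℝ} (hφ : ContDiff ℝ ∞ φ) (hc : HasCompactSupport φ) :
    MemLp φ 2 volume := hφ.continuous.memLp_of_hasCompactSupport hc

lemma norm_toLp_comp_add {f : Eucl N → ℝ} (hf : MemLp f 2 volume) (h : Eucl N) :
    ‖(hf.comp_add h).toLp _‖ = ‖hf.toLp f‖ := by
  rw [Lp.norm_toLp, Lp.norm_toLp]
  congr 1
  exact eLpNorm_comp_measurePreserving hf.1 (measurePreserving_add_right volume h)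

lemma contDiff_comp_sub {φ : Eucl N → ℝ} (hφ : ContDiff ℝ ∞ φ) (y : Eucl N) :
    ContDiff ℝ ∞ (fun x => φ (x - y)) := hφ.comp (contDiff_id.sub contDiff_const)

lemma hasCompactSupport_comp_sub {φ : Eucl N → ℝ} (hc : HasCompactSupport φ) (y : Eucl N) :
    HasCompactSupport (fun x => φ (x - y)) :=
  hc.comp_homeomorph (Homeomorph.subRight y)

lemma fderiv_comp_sub' {φ : Eucl N → ℝ} (x y : Eucl N) :
    fderiv ℝ (fun x => φ (x - y)) x = fderiv ℝ φ (x - y) := fderiv_comp_sub y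

/-- The integral is the convolution of `f` with the reflected test function at `t • v`, so all
derivatives fall on `φ`. -/
lemma hasDerivAt_integral_mul_comp_sub {f φ : Eucl N → ℝ} (hf : LocallyIntegrable f volume)
    (hφ : ContDiff ℝ ∞ φ) (hc : HasCompactSupport φ) (v : Eucl N) (t : ℝ) :
    HasDerivAt (fun t : ℝ => ∫ x, f x * φ (x - t • v))
      (-∫ x, f x * fderiv ℝ φ (x - t • v) v) t := by
  set ψ : Eucl N → ℝ := fun z => φ (-z) with hψ
  have hψc : HasCompactSupport ψ := hc.comp_homeomorph (Homeomorph.neg _)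
  have hψd : ContDiff ℝ 1 ψ := (hφ.comp contDiff_neg).of_le (by exact_mod_cast le_top)
  have key := hψc.hasFDerivAt_convolution_right (ContinuousLinearMap.mul ℝ ℝ) hf hψd (t • v)
  have h2 : HasDerivAt (fun t : ℝ => t • v) v t := by
    simpa using (hasDerivAt_id t).smul_const v
  have h3 := key.comp_hasDerivAt t h2
  have e1 : (convolution f ψ (ContinuousLinearMap.mul ℝ ℝ) volume) ∘ (fun t : ℝ => t • v)
      = fun t : ℝ => ∫ x, f x * φ (x - t • v) := by
    ext s
    simp [convolution, hψ]
  rw [e1] at h3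
  refine h3.congr_deriv ?_
  rw [convolution_precompR_apply _ hf (hψc.fderiv ℝ) (hψd.continuous_fderiv one_ne_zero)]
  rw [← integral_neg]
  simp only [convolution]
  refine integral_congr_ae (Eventually.of_forall fun x => ?_)
  have : fderiv ℝ ψ (t • v - x) = -fderiv ℝ φ (x - t • v) := by
    have h4 := ((hφ.differentiable (by simp)) (-(t • v - x))).hasFDerivAt.comp (t • v - x)
      (hasFDerivAt_id (𝕜 := ℝ) (t • v - x)).neg
    rw [neg_sub] at h4
    refine h4.fderiv.trans ?_
    ext; simp
  simp [this]

lemma integral_diff_mul {f φ : Eucl N → ℝ} (hf : MemLp f 2 volume)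
    (hφ : MemLp φ 2 volume) (h : Eucl N) :
    ∫ x, (f (x + h) - f x) * φ x = (∫ x, f x * φ (x - h)) - ∫ x, f x * φ x := by
  have h1 : ∫ x, f (x + h) * φ x = ∫ x, f x * φ (x - h) := by
    rw [← integral_add_right_eq_self (fun x => f x * φ (x - h)) h]
    simp
  rw [← h1, ← integral_sub]
  · simp [sub_mul]
  · exact (hf.comp_add h).integrable_mul hφ
  · exact hf.integrable_mul hφ

/-- By density the bound extends to all of `L²`, where `f` can be paired with itself. -/
lemma norm_toLp_le_of_test {f : Eucl N → ℝ} (hf : MemLp f 2 volume) {C : ℝ} (hC : 0 ≤ C)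
    (h : ∀ φ : Eucl N → ℝ, ∀ hφ : ContDiff ℝ ∞ φ, ∀ hc : HasCompactSupport φ,
      |∫ x, f x * φ x| ≤ C * ‖(memLp_of_test hφ hc).toLp φ‖) : ‖hf.toLp f‖ ≤ C := by
  have hd := Lp.dense_hasCompactSupport_contDiff (F := ℝ) (E := Eucl N) (μ := volume)
    (p := 2) (by norm_num)
  have key : ∀ ψ : Lp ℝ 2 (volume : Measure (Eucl N)), |⟪hf.toLp f, ψ⟫| ≤ C * ‖ψ‖ := by
    intro ψ
    refine hd.induction (P := fun ψ => |⟪hf.toLp f, ψ⟫| ≤ C * ‖ψ‖) ?_ ?_ ψ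
    · rintro ψ ⟨g, hg, hgc, hgd⟩
      have : ψ = (memLp_of_test hgd hgc).toLp g := by
        apply Lp.ext
        exact hg.trans (MemLp.coeFn_toLp _).symm
      rw [this, inner_toLp]
      exact h g hgd hgc
    · exact isClosed_le (by fun_prop) (by fun_prop)
  have h1 := key (hf.toLp f)
  rw [real_inner_self_eq_norm_sq, abs_of_nonneg (by positivity)] at h1
  by_contra! h2
  nlinarith [norm_nonneg (hf.toLp f)]

end Translation

/-! ### Difference quotients of Sobolev functions. -/

namespace H1

variable {N : ℕ}

lemma memLp_grad_inner (u : H1 N) (v : Eucl N) : MemLp (fun x => ⟪u.grad x, v⟫) 2 volume :=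
  u.memLp_grad.inner_const v

lemma locallyIntegrable (u : H1 N) : LocallyIntegrable u.toFun volume :=
  u.memLp_toFun.locallyIntegrable (by norm_num)

lemma hasDerivAt_integral (u : H1 N) {φ : Eucl N → ℝ}
    (hφ : ContDiff ℝ ∞ φ) (hc : HasCompactSupport φ) (v : Eucl N) (t : ℝ) :
    HasDerivAt (fun t : ℝ => ∫ x, u.toFun x * φ (x - t • v))
      (∫ x, ⟪u.grad x, v⟫ * φ (x - t • v)) t := by
  refine (hasDerivAt_integral_mul_comp_sub u.locallyIntegrable hφ hc v t).congr_deriv ?_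
  have := u.weak_grad _ (contDiff_comp_sub hφ (t • v)) (hasCompactSupport_comp_sub hc (t • v)) v
  simp only [fderiv_comp_sub'] at this
  rw [this, neg_neg]

/-- By duality it suffices to pair with a test function; the mean value inequality in `t ∈ [0, 1]`
for `∫ u φ(· - t v)` then applies, since translating `φ` leaves its norm unchanged. -/
lemma norm_diff_le (u : H1 N) (v : Eucl N) :
    ‖(u.memLp_toFun.diff v).toLp _‖ ≤ ‖(u.memLp_grad_inner v).toLp _‖ := by
  refine norm_toLp_le_of_test _ (norm_nonneg _) fun φ hφ hc => ?_
  have hφ2 := memLp_of_test hφ hc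
  rw [integral_diff_mul u.memLp_toFun hφ2]
  have hb : ∀ t : ℝ, |∫ x, ⟪u.grad x, v⟫ * φ (x - t • v)|
      ≤ ‖(u.memLp_grad_inner v).toLp _‖ * ‖hφ2.toLp φ‖ := by
    intro t
    have h1 := hφ2.comp_add (-(t • v))
    have h2 := norm_toLp_comp_add hφ2 (-(t • v))
    simp only [← sub_eq_add_neg] at h1 h2
    rw [← h2]
    exact abs_integral_mul_le (u.memLp_grad_inner v) h1
  have := norm_image_sub_le_of_norm_deriv_le_segment_01'
    (f := fun t : ℝ => ∫ x, u.toFun x * φ (x - t • v))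
    (f' := fun t : ℝ => ∫ x, ⟪u.grad x, v⟫ * φ (x - t • v))
    (C := ‖(u.memLp_grad_inner v).toLp _‖ * ‖hφ2.toLp φ‖)
    (fun t _ => (u.hasDerivAt_integral hφ hc v t).hasDerivWithinAt)
    (fun t _ => by rw [Real.norm_eq_abs]; exact hb t)
  simpa using this

lemma lintegral_diff_le (u : H1 N) (v : Eucl N) :
    ∫⁻ x, ‖u.toFun (x + v) - u.toFun x‖ₑ ^ 2 ≤ ∫⁻ x, ‖⟪u.grad x, v⟫‖ₑ ^ 2 := by
  rw [← ofReal_norm_toLp_sq (u.memLp_toFun.diff v), ← ofReal_norm_toLp_sq (u.memLp_grad_inner v)]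
  exact ENNReal.ofReal_le_ofReal (by gcongr; exact u.norm_diff_le v)

lemma lintegral_diff_smul_le (u : H1 N) (v : Eucl N) (t : ℝ) :
    ∫⁻ x, ‖u.toFun (x + t • v) - u.toFun x‖ₑ ^ 2 ≤ ‖t‖ₑ ^ 2 * ∫⁻ x, ‖⟪u.grad x, v⟫‖ₑ ^ 2 := by
  refine (u.lintegral_diff_le (t • v)).trans_eq ?_
  rw [← lintegral_const_mul' _ _ (by simp)]
  simp [inner_smul_right, enorm_mul, mul_pow]

/-- The difference quotient in direction `v`, as an element of `L²`. -/
def quot (u : H1 N) (v : Eucl N) (t : ℝ) : Lp ℝ 2 (volume : Measure (Eucl N)) :=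
  t⁻¹ • (u.memLp_toFun.diff (t • v)).toLp _

/-- Convergence against test functions is the derivative at `t = 0`; `norm_diff_le` bounds the norms
by that of the limit, so the convergence is strong. -/
lemma tendsto_quot (u : H1 N) (v : Eucl N) :
    Tendsto (u.quot v) (𝓝[≠] 0) (𝓝 ((u.memLp_grad_inner v).toLp _)) := by
  have hd := Lp.dense_hasCompactSupport_contDiff (F := ℝ) (E := Eucl N) (μ := volume)
    (p := 2) (by norm_num)
  refine tendsto_of_tendsto_inner_dense hd ?_ ?_
  · rintro ψ ⟨φ, hg, hc, hφ⟩
    have : ψ = (memLp_of_test hφ hc).toLp φ := by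
      apply Lp.ext
      exact hg.trans (MemLp.coeFn_toLp _).symm
    rw [this, inner_toLp]
    have h := (u.hasDerivAt_integral hφ hc v 0)
    rw [hasDerivAt_iff_tendsto_slope_zero] at h
    simp only [zero_add, zero_smul, sub_zero] at h
    refine h.congr fun t => ?_
    rw [quot, real_inner_smul_left, inner_toLp,
      integral_diff_mul u.memLp_toFun (memLp_of_test hφ hc), smul_eq_mul]
  · filter_upwards [self_mem_nhdsWithin] with t ht
    have ht : t ≠ 0 := ht
    have h1 := u.norm_diff_le (t • v)
    have h2 : ‖(u.memLp_grad_inner (t • v)).toLp _‖ = |t| * ‖(u.memLp_grad_inner v).toLp _‖ := by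
      rw [← Real.norm_eq_abs, ← norm_smul, ← MemLp.toLp_const_smul]
      congr 2
      ext x
      simp [inner_smul_right]
    rw [quot, norm_smul, norm_inv, Real.norm_eq_abs, inv_mul_le_iff₀ (by positivity), ← h2]
    exact h1

/-- This stands in for the chain rule: inequalities between products of increments pass to products
of gradients. -/
lemma tendsto_integral_diff_mul_diff (u w : H1 N) (v : Eucl N) :
    Tendsto (fun t : ℝ => ∫ x, (t ^ 2)⁻¹ * ((u.toFun (x + t • v) - u.toFun x) *
      (w.toFun (x + t • v) - w.toFun x))) (𝓝[≠] 0) (𝓝 (∫ x, ⟪u.grad x, v⟫ * ⟪w.grad x, v⟫)) := by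
  have := (u.tendsto_quot v).inner (𝕜 := ℝ) (w.tendsto_quot v)
  rw [inner_toLp] at this
  refine this.congr fun t => ?_
  rw [quot, quot, real_inner_smul_left, real_inner_smul_right, inner_toLp, integral_const_mul]
  ring

end H1

/-! ### Construction of Sobolev functions from increment bounds. -/

section Construction

variable {N : ℕ}

/-- The standard basis vector. -/
def stdVec (j : Fin N) : Eucl N := EuclideanSpace.basisFun (Fin N) ℝ j

lemma inner_stdVec (x : Eucl N) (j : Fin N) : ⟪x, stdVec j⟫ = x j := by
  simp [stdVec, EuclideanSpace.inner_single_right]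

lemma sum_smul_stdVec (x : Eucl N) : ∑ j, x j • stdVec j = x := by
  have := (EuclideanSpace.basisFun (Fin N) ℝ).sum_repr x
  simpa [stdVec] using this

lemma norm_stdVec (j : Fin N) : ‖(stdVec j : Eucl N)‖ = 1 := by simp [stdVec]

/-- The difference quotients stay in a ball of `L²`, which is weakly compact; any weak cluster point
as `t → 0` is the weak derivative. -/
lemma exists_weak_deriv {f : Eucl N → ℝ} (hf : MemLp f 2 volume) (v : Eucl N) {C : ℝ}
    (hC : ∀ t : ℝ, ‖(hf.diff (t • v)).toLp _‖ ≤ |t| * C) :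
    ∃ g : Eucl N → ℝ, ∃ hg : MemLp g 2 volume, ‖hg.toLp g‖ ≤ C ∧
      ∀ φ : Eucl N → ℝ, ContDiff ℝ ∞ φ → HasCompactSupport φ →
        ∫ x, f x * fderiv ℝ φ x v = - ∫ x, g x * φ x := by
  set D : ℝ → Lp ℝ 2 (volume : Measure (Eucl N)) :=
    fun t => t⁻¹ • (hf.diff (t • v)).toLp _ with hD
  have hDC : ∀ t ≠ 0, ‖D t‖ ≤ C := by
    intro t ht
    rw [hD, norm_smul, norm_inv, Real.norm_eq_abs, inv_mul_le_iff₀ (by positivity)]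
    exact hC t
  set l : ℝ → WeakDual ℝ (Lp ℝ 2 (volume : Measure (Eucl N))) := fun t =>
    StrongDual.toWeakDual (InnerProductSpace.toDual ℝ _ (D t)) with hl
  have hcomp := WeakDual.isCompact_closedBall (𝕜 := ℝ) (E := Lp ℝ 2 (volume : Measure (Eucl N)))
    0 C
  -- A limit along an ultrafilter finer than `𝓝[≠] 0` replaces the extraction of a subsequence.
  set U : Ultrafilter ℝ := Ultrafilter.of (𝓝[≠] 0)
  have hU : (U : Filter ℝ) ≤ 𝓝[≠] 0 := Ultrafilter.of_le _
  have hmem : ↑(U.map l) ≤ 𝓟 (WeakDual.toStrongDual ⁻¹'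
      Metric.closedBall (0 : StrongDual ℝ (Lp ℝ 2 (volume : Measure (Eucl N)))) C) := by
    rw [le_principal_iff]
    have : ∀ᶠ t in (U : Filter ℝ), t ≠ 0 := hU self_mem_nhdsWithin
    change ∀ᶠ t in (U : Filter ℝ), _
    filter_upwards [this] with t ht
    simp only [Set.mem_preimage, Metric.mem_closedBall, dist_zero_right, hl]
    have := hDC t ht
    rw [← (InnerProductSpace.toDual ℝ (Lp ℝ 2 (volume : Measure (Eucl N)))).norm_map] at this
    exact this
  obtain ⟨ℓ, hℓ, hlim⟩ := hcomp.ultrafilter_le_nhds _ hmem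
  set G := (InnerProductSpace.toDual ℝ (Lp ℝ 2 (volume : Measure (Eucl N)))).symm
    (WeakDual.toStrongDual ℓ) with hG
  have hGn : ‖G‖ ≤ C := by
    rw [hG, LinearIsometryEquiv.norm_map]
    simpa using hℓ
  have hlim2 : ∀ ψ, Tendsto (fun t => ⟪D t, ψ⟫) U (𝓝 ⟪G, ψ⟫) := by
    intro ψ
    have h1 : Tendsto l U (𝓝 ℓ) := hlim
    have h2 := ((WeakDual.eval_continuous (𝕜 := ℝ) ψ).tendsto ℓ).comp h1
    have h3 : ⟪G, ψ⟫ = ℓ ψ := by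
      rw [hG, InnerProductSpace.toDual_symm_apply]
      rfl
    rw [h3]
    exact h2
  have hGe : (Lp.memLp G).toLp _ = G := Lp.toLp_coeFn G _
  refine ⟨G, Lp.memLp G, by rw [hGe]; exact hGn, fun φ hφ hc => ?_⟩
  have h1 := hlim2 ((memLp_of_test hφ hc).toLp φ)
  have h := (hasDerivAt_integral_mul_comp_sub (hf.locallyIntegrable (by norm_num)) hφ hc v 0)
  rw [hasDerivAt_iff_tendsto_slope_zero] at h
  simp only [zero_add, zero_smul, sub_zero] at h
  have h2 : Tendsto (fun t => ⟪D t, (memLp_of_test hφ hc).toLp φ⟫) U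
      (𝓝 (-∫ x, f x * fderiv ℝ φ x v)) := by
    refine (h.mono_left hU).congr fun t => ?_
    rw [hD, real_inner_smul_left, inner_toLp,
      integral_diff_mul hf (memLp_of_test hφ hc), smul_eq_mul]
  have h3 := tendsto_nhds_unique h1 h2
  rw [← hGe, inner_toLp] at h3
  rw [h3, neg_neg]

/-- The converse of `H1.lintegral_diff_smul_le`: bounds along the coordinate directions suffice, and
the constants add up to a bound on the gradient energy. -/
lemma exists_H1_of_diff_bound {f : Eucl N → ℝ} (hf : MemLp f 2 volume) {C : Fin N → ℝ≥0∞}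
    (hCt : ∀ j, C j < ⊤)
    (hC : ∀ j, ∀ t : ℝ, ∫⁻ x, ‖f (x + t • stdVec j) - f x‖ₑ ^ 2 ≤ ‖t‖ₑ ^ 2 * C j) :
    ∃ u : H1 N, u.toFun = f ∧ ∫⁻ x, ‖u.grad x‖ₑ ^ 2 ≤ ∑ j, C j := by
  have key : ∀ j, ∀ t : ℝ, ‖(hf.diff (t • stdVec j)).toLp _‖ ≤ |t| * √(C j).toReal := by
    intro j t
    have h1 := hC j t
    rw [← ofReal_norm_toLp_sq (hf.diff (t • stdVec j)), Real.enorm_eq_ofReal_abs,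
      ← ENNReal.ofReal_toReal (hCt j).ne, ← ENNReal.ofReal_pow (by positivity),
      ← ENNReal.ofReal_mul (by positivity), ENNReal.ofReal_le_ofReal_iff (by positivity)] at h1
    refine le_of_sq_le_sq ?_ (by positivity)
    rw [mul_pow, Real.sq_sqrt (by positivity)]
    exact h1
  choose g hg hgn hgw using fun j => exists_weak_deriv hf (stdVec j) (key j)
  have hin : ∀ x v, ⟪∑ j, g j x • (stdVec j : Eucl N), v⟫ = ∑ j, v j * g j x := by
    intro x v
    rw [sum_inner]
    refine Finset.sum_congr rfl fun j _ => ?_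
    rw [real_inner_smul_left, real_inner_comm, inner_stdVec, mul_comm]
  have hgr : MemLp (fun x => ∑ j, g j x • (stdVec j : Eucl N)) 2 volume :=
    memLp_finsetSum _ fun j _ =>
      ((ContinuousLinearMap.id ℝ ℝ).smulRight (stdVec j : Eucl N)).comp_memLp' (hg j)
  refine ⟨⟨f, fun x => ∑ j, g j x • stdVec j, hf, hgr, fun φ hφ hc v => ?_⟩, rfl, ?_⟩
  · simp only [hin]
    have e1 : ∀ x, f x * fderiv ℝ φ x v = ∑ j, v j * (f x * fderiv ℝ φ x (stdVec j)) := by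
      intro x
      conv_lhs => rw [← sum_smul_stdVec v, map_sum, Finset.mul_sum]
      refine Finset.sum_congr rfl fun j _ => ?_
      rw [map_smul, smul_eq_mul]; ring
    simp only [e1, Finset.sum_mul]
    have hdt : ∀ j : Fin N, MemLp (fun x => fderiv ℝ φ x (stdVec j)) 2 volume := by
      intro j
      refine ((hφ.continuous_fderiv (by simp)).clm_apply
        continuous_const).memLp_of_hasCompactSupport (hc.fderiv_apply ℝ _)
    have hi : ∀ j : Fin N, Integrable (fun x => v j * (f x * fderiv ℝ φ x (stdVec j))) volume :=
      fun j => (hf.integrable_mul (hdt j)).const_mul (v j)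
    rw [integral_finsetSum _ fun j _ => hi j, integral_finsetSum, ← Finset.sum_neg_distrib]
    · refine Finset.sum_congr rfl fun j _ => ?_
      rw [integral_const_mul, hgw j φ hφ hc, mul_neg, ← integral_const_mul]
      simp only [mul_assoc]
    · intro j _
      simp only [mul_assoc]
      exact ((hg j).integrable_mul (memLp_of_test hφ hc)).const_mul (v j)
  · have e2 : ∀ x, ‖∑ j, g j x • (stdVec j : Eucl N)‖ₑ ^ 2 = ∑ j, ‖g j x‖ₑ ^ 2 := by
      intro x
      have h1 : ‖∑ j, g j x • (stdVec j : Eucl N)‖ ^ 2 = ∑ j, |g j x| ^ 2 := by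
        rw [← real_inner_self_eq_norm_sq, hin]
        refine Finset.sum_congr rfl fun j _ => ?_
        rw [← inner_stdVec, real_inner_comm, real_inner_comm, hin]
        simp [stdVec, ← sq]
      rw [← ofReal_norm, ← ENNReal.ofReal_pow (norm_nonneg _), h1,
        ENNReal.ofReal_sum_of_nonneg fun j _ => by positivity]
      refine Finset.sum_congr rfl fun j _ => ?_
      rw [ENNReal.ofReal_pow (abs_nonneg _), Real.enorm_eq_ofReal_abs]
    simp only [e2]
    rw [lintegral_finsetSum' _ fun j _ => ((hg j).1.enorm.pow_const 2)]
    refine Finset.sum_le_sum fun j _ => ?_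
    rw [← ofReal_norm_toLp_sq (hg j), ← ENNReal.ofReal_toReal (hCt j).ne]
    refine ENNReal.ofReal_le_ofReal ?_
    calc _ ≤ √(C j).toReal ^ 2 := by gcongr; exact hgn j
      _ = _ := Real.sq_sqrt (by positivity)

lemma enorm_sq_eq_sum (y : Eucl N) : ‖y‖ₑ ^ 2 = ∑ j, ‖⟪y, stdVec j⟫‖ₑ ^ 2 := by
  have h1 : ‖y‖ ^ 2 = ∑ j, |⟪y, stdVec j⟫| ^ 2 := by
    simp [EuclideanSpace.norm_sq_eq, inner_stdVec]
  rw [← ofReal_norm, ← ENNReal.ofReal_pow (norm_nonneg _), h1,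
    ENNReal.ofReal_sum_of_nonneg fun j _ => by positivity]
  refine Finset.sum_congr rfl fun j _ => ?_
  rw [ENNReal.ofReal_pow (abs_nonneg _), Real.enorm_eq_ofReal_abs]

lemma H1.lintegral_grad_eq_sum (u : H1 N) :
    ∫⁻ x, ‖u.grad x‖ₑ ^ 2 = ∑ j, ∫⁻ x, ‖⟪u.grad x, stdVec j⟫‖ₑ ^ 2 := by
  simp only [enorm_sq_eq_sum]
  exact lintegral_finsetSum' _ fun j _ => (u.memLp_grad_inner _).1.enorm.pow_const 2

lemma H1.lintegral_inner_lt_top (u : H1 N) (v : Eucl N) : ∫⁻ x, ‖⟪u.grad x, v⟫‖ₑ ^ 2 < ⊤ :=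
  (u.memLp_grad_inner v).lintegral_sq_lt_top

lemma H1.integrable_grad_inner (u w : H1 N) :
    Integrable (fun x => ⟪u.grad x, w.grad x⟫) volume := by
  have h : ∀ x, ⟪u.grad x, w.grad x⟫ = ∑ j, ⟪u.grad x, stdVec j⟫ * ⟪w.grad x, stdVec j⟫ := by
    intro x
    have := (EuclideanSpace.basisFun (Fin N) ℝ).sum_inner_mul_inner (u.grad x) (w.grad x)
    rw [← this]
    refine Finset.sum_congr rfl fun j _ => ?_
    rw [stdVec, real_inner_comm (w.grad x)]
  simp only [h]
  exact integrable_finsetSum _ fun j _ =>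
    (u.memLp_grad_inner _).integrable_mul (w.memLp_grad_inner _)

lemma H1.integral_grad_inner (u w : H1 N) :
    ∫ x, ⟪u.grad x, w.grad x⟫ = ∑ j, ∫ x, ⟪u.grad x, stdVec j⟫ * ⟪w.grad x, stdVec j⟫ := by
  have h : ∀ x, ⟪u.grad x, w.grad x⟫ = ∑ j, ⟪u.grad x, stdVec j⟫ * ⟪w.grad x, stdVec j⟫ := by
    intro x
    have := (EuclideanSpace.basisFun (Fin N) ℝ).sum_inner_mul_inner (u.grad x) (w.grad x)
    rw [← this]
    refine Finset.sum_congr rfl fun j _ => ?_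
    rw [stdVec, real_inner_comm (w.grad x)]
  simp only [h]
  exact integral_finsetSum _ fun j _ =>
    (u.memLp_grad_inner _).integrable_mul (w.memLp_grad_inner _)

/-- Comparison of Dirichlet forms through pointwise comparison of increments. -/
lemma H1.integral_grad_inner_le (u w p q : H1 N) {κ : Eucl N → ℝ} (hκ : Integrable κ volume)
    (h : ∀ j, ∀ᶠ t : ℝ in 𝓝[≠] 0, ∀ᵐ x : Eucl N,
      (p.toFun (x + t • stdVec j) - p.toFun x) * (q.toFun (x + t • stdVec j) - q.toFun x) ≤
      (u.toFun (x + t • stdVec j) - u.toFun x) * (w.toFun (x + t • stdVec j) - w.toFun x)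
        + t ^ 2 * κ x) :
    ∫ x, ⟪p.grad x, q.grad x⟫ ≤ (∫ x, ⟪u.grad x, w.grad x⟫) + N * ∫ x, κ x := by
  have : (N : ℝ) * ∫ x, κ x = ∑ _j : Fin N, ∫ x, κ x := by simp
  rw [H1.integral_grad_inner, H1.integral_grad_inner, this, ← Finset.sum_add_distrib]
  refine Finset.sum_le_sum fun j _ => ?_
  refine le_of_tendsto_of_tendsto (p.tendsto_integral_diff_mul_diff q (stdVec j))
    ((u.tendsto_integral_diff_mul_diff w (stdVec j)).add_const _) ?_
  filter_upwards [h j, self_mem_nhdsWithin] with t ht ht0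
  have ht0 : t ≠ 0 := ht0
  have hi : ∀ a b : H1 N, Integrable (fun x => (t ^ 2)⁻¹ *
      ((a.toFun (x + t • stdVec j) - a.toFun x) * (b.toFun (x + t • stdVec j) - b.toFun x)))
      volume := fun a b =>
    ((a.memLp_toFun.diff _).integrable_mul (b.memLp_toFun.diff _)).const_mul _
  rw [← integral_add (hi u w) hκ]
  refine integral_mono_ae (hi p q) ((hi u w).add hκ) ?_
  filter_upwards [ht] with x hx
  have ht2 : 0 < t ^ 2 := by positivity
  have : κ x = (t ^ 2)⁻¹ * (t ^ 2 * κ x) := by field_simp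
  rw [this, ← mul_add]
  gcongr

lemma H1.integral_grad_inner_mono (u w p q : H1 N)
    (h : ∀ s : Eucl N, ∀ᵐ x : Eucl N,
      (p.toFun (x + s) - p.toFun x) * (q.toFun (x + s) - q.toFun x) ≤
      (u.toFun (x + s) - u.toFun x) * (w.toFun (x + s) - w.toFun x)) :
    ∫ x, ⟪p.grad x, q.grad x⟫ ≤ ∫ x, ⟪u.grad x, w.grad x⟫ := by
  have := H1.integral_grad_inner_le u w p q (κ := 0) (integrable_zero _ _ _) fun j =>
    Eventually.of_forall fun t => by
      filter_upwards [h (t • stdVec j)] with x hx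
      simpa using hx
  simpa using this

lemma ae_comp_add {P : Eucl N → Prop} (h : ∀ᵐ x, P x) (s : Eucl N) : ∀ᵐ x, P (x + s) :=
  (measurePreserving_add_right volume s).quasiMeasurePreserving.ae h

/-- Composition of `H¹` functions with a function that is Lipschitz up to weights. -/
lemma H1.exists_comp (u w : H1 N) {Φ : Eucl N → ℝ → ℝ → ℝ}
    (hΦ : Continuous fun z : Eucl N × ℝ × ℝ => Φ z.1 z.2.1 z.2.2) {L : ℝ}
    (h0 : ∀ x a b, |Φ x a b| ≤ L * (|a| + |b|))
    (h1 : ∀ x y a b a' b',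
      |Φ y a' b' - Φ x a b| ≤ L * (|a' - a| + |b' - b| + ‖y - x‖ * (|a| + |b|))) :
    ∃ f : H1 N, f.toFun = fun x => Φ x (u.toFun x) (w.toFun x) := by
  have hfm : AEStronglyMeasurable (fun x => Φ x (u.toFun x) (w.toFun x)) volume :=
    hΦ.comp_aestronglyMeasurable
      (aestronglyMeasurable_id.prodMk (u.memLp_toFun.1.prodMk w.memLp_toFun.1))
  have hab : MemLp (fun x => L * (|u.toFun x| + |w.toFun x|)) 2 volume :=
    (u.memLp_toFun.abs.add w.memLp_toFun.abs).const_mul L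
  have hf : MemLp (fun x => Φ x (u.toFun x) (w.toFun x)) 2 volume :=
    hab.mono hfm (Eventually.of_forall fun x => by
      rw [Real.norm_eq_abs]; exact (h0 _ _ _).trans (le_abs_self _))
  -- The factor `3` comes from `(a + b + c)² ≤ 3 (a² + b² + c²)`; the three terms are the increments
  -- of `u` and `w` and the explicit dependence of `Φ` on the point.
  set C : Fin N → ℝ≥0∞ := fun j => 3 * ‖L‖ₑ ^ 2 * ((∫⁻ x, ‖⟪u.grad x, stdVec j⟫‖ₑ ^ 2) +
    (∫⁻ x, ‖⟪w.grad x, stdVec j⟫‖ₑ ^ 2) + ∫⁻ x, ‖|u.toFun x| + |w.toFun x|‖ₑ ^ 2) with hC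
  have hsum : MemLp (fun x => |u.toFun x| + |w.toFun x|) 2 volume :=
    u.memLp_toFun.abs.add w.memLp_toFun.abs
  suffices hs : ∀ j, ∀ t : ℝ, ∫⁻ x : Eucl N, ‖Φ (x + t • stdVec j) (u.toFun (x + t • stdVec j))
      (w.toFun (x + t • stdVec j)) - Φ x (u.toFun x) (w.toFun x)‖ₑ ^ 2 ≤ ‖t‖ₑ ^ 2 * C j by
    obtain ⟨f, hf1, -⟩ := exists_H1_of_diff_bound hf (C := C) (fun j => by
      refine ENNReal.mul_lt_top (by finiteness) ?_
      exact ENNReal.add_lt_top.2 ⟨ENNReal.add_lt_top.2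
        ⟨u.lintegral_inner_lt_top _, w.lintegral_inner_lt_top _⟩, hsum.lintegral_sq_lt_top⟩) hs
    exact ⟨f, hf1⟩
  intro j t
  have hp : ∀ x : Eucl N, ‖Φ (x + t • stdVec j) (u.toFun (x + t • stdVec j))
      (w.toFun (x + t • stdVec j)) - Φ x (u.toFun x) (w.toFun x)‖ₑ ^ 2 ≤
      3 * ‖L‖ₑ ^ 2 * (‖u.toFun (x + t • stdVec j) - u.toFun x‖ₑ ^ 2 +
        ‖w.toFun (x + t • stdVec j) - w.toFun x‖ₑ ^ 2 +
        ‖t‖ₑ ^ 2 * ‖|u.toFun x| + |w.toFun x|‖ₑ ^ 2) := by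
    intro x
    have h2 := h1 x (x + t • stdVec j) (u.toFun x) (w.toFun x) (u.toFun (x + t • stdVec j))
      (w.toFun (x + t • stdVec j))
    rw [add_sub_cancel_left, norm_smul, norm_stdVec, mul_one, Real.norm_eq_abs] at h2
    set A := u.toFun (x + t • stdVec j) - u.toFun x
    set B := w.toFun (x + t • stdVec j) - w.toFun x
    set D := |u.toFun x| + |w.toFun x|
    have hD : 0 ≤ D := by positivity
    have h3 : (Φ (x + t • stdVec j) (u.toFun (x + t • stdVec j))
      (w.toFun (x + t • stdVec j)) - Φ x (u.toFun x) (w.toFun x)) ^ 2 ≤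
      3 * L ^ 2 * (A ^ 2 + B ^ 2 + t ^ 2 * D ^ 2) := by
      rw [← sq_abs]
      calc _ ≤ (L * (|A| + |B| + |t| * D)) ^ 2 := by gcongr
        _ = L ^ 2 * (|A| + |B| + |t| * D) ^ 2 := by ring
        _ ≤ L ^ 2 * (3 * (|A| ^ 2 + |B| ^ 2 + (|t| * D) ^ 2)) := by
          gcongr
          nlinarith [sq_nonneg (|A| - |B|), sq_nonneg (|A| - |t| * D), sq_nonneg (|B| - |t| * D)]
        _ = _ := by rw [mul_pow, sq_abs, sq_abs, sq_abs]; ring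
    simp only [Real.enorm_eq_ofReal_abs, ← ENNReal.ofReal_pow (abs_nonneg _), sq_abs]
    have h33 : (3 : ℝ≥0∞) = ENNReal.ofReal 3 := by simp
    rw [h33, ← ENNReal.ofReal_mul (by positivity), ← ENNReal.ofReal_mul (by positivity),
      ← ENNReal.ofReal_add (by positivity) (by positivity),
      ← ENNReal.ofReal_add (by positivity) (by positivity), ← ENNReal.ofReal_mul (by positivity)]
    exact ENNReal.ofReal_le_ofReal h3
  refine (lintegral_mono hp).trans ?_
  rw [lintegral_const_mul' _ _ (by finiteness), lintegral_add_left', lintegral_add_left',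
    lintegral_const_mul' _ _ (by finiteness)]
  · rw [hC]
    have e1 := u.lintegral_diff_smul_le (stdVec j) t
    have e2 := w.lintegral_diff_smul_le (stdVec j) t
    calc _ ≤ 3 * ‖L‖ₑ ^ 2 * (‖t‖ₑ ^ 2 * (∫⁻ x, ‖⟪u.grad x, stdVec j⟫‖ₑ ^ 2) +
          ‖t‖ₑ ^ 2 * (∫⁻ x, ‖⟪w.grad x, stdVec j⟫‖ₑ ^ 2) +
          ‖t‖ₑ ^ 2 * ∫⁻ x, ‖|u.toFun x| + |w.toFun x|‖ₑ ^ 2) := by gcongr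
      _ = _ := by ring
  · exact (u.memLp_toFun.diff _).1.enorm.pow_const 2
  · exact ((u.memLp_toFun.diff _).1.enorm.pow_const 2).add
      ((w.memLp_toFun.diff _).1.enorm.pow_const 2)

end Construction

/-! ### Linear structure and energy. -/

namespace H1

variable {N : ℕ}

/-- The zero element of `H¹`. -/
def zero (N : ℕ) : H1 N where
  toFun := 0
  grad := 0
  memLp_toFun := MemLp.zero
  memLp_grad := MemLp.zero
  weak_grad := by intros; simp

/-- Linear combinations in `H¹`. -/
def lin (a : ℝ) (u : H1 N) (b : ℝ) (w : H1 N) : H1 N where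
  toFun x := a * u.toFun x + b * w.toFun x
  grad x := a • u.grad x + b • w.grad x
  memLp_toFun := (u.memLp_toFun.const_mul a).add (w.memLp_toFun.const_mul b)
  memLp_grad := (u.memLp_grad.const_smul a).add (w.memLp_grad.const_smul b)
  weak_grad φ hφ hc v := by
    have hd : MemLp (fun x => fderiv ℝ φ x v) 2 volume :=
      ((hφ.continuous_fderiv (by simp)).clm_apply
        continuous_const).memLp_of_hasCompactSupport (hc.fderiv_apply ℝ _)
    have hp := memLp_of_test hφ hc
    have h1 : ∫ x, (a * u.toFun x + b * w.toFun x) * fderiv ℝ φ x v =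
        a * (∫ x, u.toFun x * fderiv ℝ φ x v) + b * ∫ x, w.toFun x * fderiv ℝ φ x v := by
      rw [← integral_const_mul, ← integral_const_mul, ← integral_add]
      · simp only [add_mul, mul_assoc]
      · exact (u.memLp_toFun.integrable_mul hd).const_mul a
      · exact (w.memLp_toFun.integrable_mul hd).const_mul b
    have h2 : ∫ x, ⟪a • u.grad x + b • w.grad x, v⟫ * φ x =
        a * (∫ x, ⟪u.grad x, v⟫ * φ x) + b * ∫ x, ⟪w.grad x, v⟫ * φ x := by
      rw [← integral_const_mul, ← integral_const_mul, ← integral_add]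
      · simp only [inner_add_left, real_inner_smul_left, add_mul, mul_assoc]
      · exact ((u.memLp_grad_inner v).integrable_mul hp).const_mul a
      · exact ((w.memLp_grad_inner v).integrable_mul hp).const_mul b
    rw [h1, h2, u.weak_grad φ hφ hc, w.weak_grad φ hφ hc]
    ring

/-- The squared `H¹` norm. -/
def energy (u : H1 N) : ℝ≥0∞ := ∫⁻ x, (‖u.grad x‖ₑ ^ 2 + ‖u.toFun x‖ₑ ^ 2)

lemma energy_eq (u : H1 N) :
    u.energy = (∫⁻ x, ‖u.grad x‖ₑ ^ 2) + ∫⁻ x, ‖u.toFun x‖ₑ ^ 2 :=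
  lintegral_add_left' (u.memLp_grad.1.enorm.pow_const 2) _

lemma energy_lt_top (u : H1 N) : u.energy < ⊤ := by
  rw [energy_eq]
  exact ENNReal.add_lt_top.2 ⟨u.memLp_grad.lintegral_sq_lt_top, u.memLp_toFun.lintegral_sq_lt_top⟩

lemma energy_zero : (zero N).energy = 0 := by simp [energy, zero]

lemma lintegral_sq_le_energy (u : H1 N) : ∫⁻ x, ‖u.toFun x‖ₑ ^ 2 ≤ u.energy := by
  rw [energy_eq]; exact le_add_self

lemma energy_smul (a : ℝ) (u : H1 N) : (lin a u 0 u).energy = ‖a‖ₑ ^ 2 * u.energy := by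
  rw [energy, energy, ← lintegral_const_mul' _ _ (by finiteness)]
  simp [lin, enorm_smul, mul_pow, mul_add]

lemma energy_eq_ofReal (u : H1 N) : u.energy =
    ENNReal.ofReal ((∫ x, ⟪u.grad x, u.grad x⟫) + ∫ x, u.toFun x * u.toFun x) := by
  have h : ∫⁻ x, ‖u.grad x‖ₑ ^ 2 = ENNReal.ofReal (∫ x, ⟪u.grad x, u.grad x⟫) := by
    rw [ofReal_integral_eq_lintegral_ofReal (u.integrable_grad_inner u)
      (Eventually.of_forall fun x => real_inner_self_nonneg)]
    refine lintegral_congr fun x => ?_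
    rw [real_inner_self_eq_norm_sq, ENNReal.ofReal_pow (norm_nonneg _), ofReal_norm]
  rw [energy_eq, h, lintegral_enorm_sq_eq_ofReal u.memLp_toFun, ENNReal.ofReal_add]
  · exact integral_nonneg fun x => real_inner_self_nonneg
  · exact integral_nonneg fun x => mul_self_nonneg _

/-- The increments vanish almost everywhere, so comparison with the zero function shows that the
gradient energy vanishes too. -/
lemma energy_eq_zero {u : H1 N} (hu : u.toFun =ᵐ[volume] 0) : u.energy = 0 := by
  rw [energy_eq_ofReal, ENNReal.ofReal_eq_zero]
  have h1 := integral_grad_inner_mono (zero N) (zero N) u u fun s => by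
    filter_upwards [hu, ae_comp_add hu s] with x h1 h2
    simp [h1, h2, zero]
  have h2 : ∫ x, u.toFun x * u.toFun x = 0 := by
    rw [integral_congr_ae (g := fun _ => (0 : ℝ))]
    · simp
    · filter_upwards [hu] with x hx
      simp [hx]
  rw [h2, add_zero]
  simpa [zero] using h1

end H1

/-! ### Capacity as an outer measure, and quasi-continuous functions. -/

section Capacity

variable {N : ℕ}

lemma enorm_toReal_sub_le {a b d : ℝ≥0∞} (ha : a < ⊤) (hb : b < ⊤) (h1 : a ≤ b + d)
    (h2 : b ≤ a + d) : ‖a.toReal - b.toReal‖ₑ ≤ d := by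
  rcases eq_top_or_lt_top d with rfl | hd
  · exact le_top
  lift a to ℝ≥0 using ha.ne
  lift b to ℝ≥0 using hb.ne
  lift d to ℝ≥0 using hd.ne
  norm_cast at h1 h2
  have h1 : (a : ℝ) ≤ b + d := by exact_mod_cast h1
  have h2 : (b : ℝ) ≤ a + d := by exact_mod_cast h2
  rw [Real.enorm_eq_ofReal_abs]
  refine ENNReal.ofReal_le_of_le_toReal ?_
  simp only [ENNReal.coe_toReal]
  rw [abs_le]
  constructor <;> linarith

lemma enorm_le_rpow_tsum (a : ℕ → ℝ) (i : ℕ) :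
    ‖a i‖ₑ ≤ (∑' i, ‖a i‖ₑ ^ 2) ^ (1 / 2 : ℝ) := by
  calc ‖a i‖ₑ = (‖a i‖ₑ ^ 2) ^ (1 / 2 : ℝ) := by
        rw [← ENNReal.rpow_natCast, ← ENNReal.rpow_mul]; norm_num
    _ ≤ _ := by gcongr; exact ENNReal.le_tsum (f := fun i => ‖a i‖ₑ ^ 2) i

lemma rpow_half_sq (s : ℝ≥0∞) : (s ^ (1 / 2 : ℝ)) ^ 2 = s := by
  rw [← ENNReal.rpow_natCast, ← ENNReal.rpow_mul]; norm_num

/-- A countable supremum of absolute values of `H¹` functions is in `H¹`. -/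
lemma exists_sup_abs {v : ℕ → H1 N} (hv : ∑' i, (v i).energy < ⊤) :
    ∃ f : H1 N, (∀ᵐ x, ∀ i, |(v i).toFun x| ≤ f.toFun x) ∧ f.energy ≤ ∑' i, (v i).energy := by
  set S : Eucl N → ℝ≥0∞ := fun x => ⨆ i, ‖(v i).toFun x‖ₑ with hS
  have hm : ∀ i, AEMeasurable (fun x => ‖(v i).toFun x‖ₑ) volume :=
    fun i => (v i).memLp_toFun.1.enorm
  have hSm : AEMeasurable S volume := AEMeasurable.iSup hm
  have hSle : ∀ x, S x ^ 2 ≤ ∑' i, ‖(v i).toFun x‖ₑ ^ 2 := by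
    intro x
    rw [← rpow_half_sq (∑' i, ‖(v i).toFun x‖ₑ ^ 2)]
    gcongr
    exact iSup_le fun i => enorm_le_rpow_tsum (fun i => (v i).toFun x) i
  have hint : ∫⁻ x, S x ^ 2 ≤ ∑' i, ∫⁻ x, ‖(v i).toFun x‖ₑ ^ 2 := by
    rw [← lintegral_tsum fun i => (hm i).pow_const 2]
    exact lintegral_mono hSle
  have hint' : ∫⁻ x, S x ^ 2 < ⊤ :=
    (hint.trans (ENNReal.tsum_le_tsum fun i => (v i).lintegral_sq_le_energy)).trans_lt hv
  have hfin : ∀ᵐ x, S x < ⊤ := by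
    filter_upwards [ae_lt_top' (hSm.pow_const 2) hint'.ne] with x hx
    by_contra h
    simp [not_lt_top_iff.1 h] at hx
  have henorm : ∀ᵐ x, ‖(S x).toReal‖ₑ = S x := by
    filter_upwards [hfin] with x hx
    rw [Real.enorm_eq_ofReal ENNReal.toReal_nonneg, ENNReal.ofReal_toReal hx.ne]
  have hsq : ∫⁻ x, ‖(S x).toReal‖ₑ ^ 2 = ∫⁻ x, S x ^ 2 :=
    lintegral_congr_ae (by filter_upwards [henorm] with x hx; rw [hx])
  have hf : MemLp (fun x => (S x).toReal) 2 volume := by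
    rw [memLp_two_iff hSm.ennreal_toReal.aestronglyMeasurable, hsq]
    exact hint'
  have hC : ∑ j, ∑' i, ∫⁻ x, ‖⟪(v i).grad x, stdVec j⟫‖ₑ ^ 2
      = ∑' i, ∫⁻ x, ‖(v i).grad x‖ₑ ^ 2 := by
    rw [← Summable.tsum_finsetSum fun _ _ => ENNReal.summable]
    simp only [H1.lintegral_grad_eq_sum]
  obtain ⟨f, hf1, hf2⟩ := exists_H1_of_diff_bound hf
    (C := fun j => ∑' i, ∫⁻ x, ‖⟪(v i).grad x, stdVec j⟫‖ₑ ^ 2)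
    (fun j => by
      refine lt_of_le_of_lt ?_ hv
      refine (Finset.single_le_sum (f := fun j => ∑' i, ∫⁻ x, ‖⟪(v i).grad x, stdVec j⟫‖ₑ ^ 2)
        (fun _ _ => zero_le) (Finset.mem_univ j)).trans ?_
      rw [hC]
      exact ENNReal.tsum_le_tsum fun i => by rw [H1.energy_eq]; exact le_self_add)
    (fun j t => by
      rw [← ENNReal.tsum_mul_left]
      -- A supremum changes by at most the supremum of the changes, whose square is at most the sum
      -- of their squares.
      calc _ ≤ ∫⁻ x, ∑' i, ‖(v i).toFun (x + t • stdVec j) - (v i).toFun x‖ₑ ^ 2 := by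
            refine lintegral_mono_ae ?_
            filter_upwards [hfin, ae_comp_add hfin (t • stdVec j)] with x h1 h2
            rw [← rpow_half_sq (∑' i, ‖(v i).toFun (x + t • stdVec j) - (v i).toFun x‖ₑ ^ 2)]
            gcongr
            refine enorm_toReal_sub_le h2 h1 ?_ ?_
            · refine iSup_le fun i => ?_
              calc ‖(v i).toFun (x + t • stdVec j)‖ₑ
                  = ‖(v i).toFun x + ((v i).toFun (x + t • stdVec j) - (v i).toFun x)‖ₑ := by
                    congr 1; ring
                _ ≤ _ := enorm_add_le _ _
                _ ≤ _ := add_le_add (le_iSup (fun i => ‖(v i).toFun x‖ₑ) i)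
                    (enorm_le_rpow_tsum (fun i => (v i).toFun (x + t • stdVec j)
                      - (v i).toFun x) i)
            · refine iSup_le fun i => ?_
              calc ‖(v i).toFun x‖ₑ
                  = ‖(v i).toFun (x + t • stdVec j) -
                      ((v i).toFun (x + t • stdVec j) - (v i).toFun x)‖ₑ := by
                    congr 1; ring
                _ ≤ _ := enorm_sub_le
                _ ≤ _ := add_le_add (le_iSup (fun i => ‖(v i).toFun (x + t • stdVec j)‖ₑ) i)
                    (enorm_le_rpow_tsum (fun i => (v i).toFun (x + t • stdVec j)
                      - (v i).toFun x) i)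
        _ = ∑' i, ∫⁻ x, ‖(v i).toFun (x + t • stdVec j) - (v i).toFun x‖ₑ ^ 2 :=
            lintegral_tsum fun i => ((v i).memLp_toFun.diff _).1.enorm.pow_const 2
        _ ≤ _ := ENNReal.tsum_le_tsum fun i => (v i).lintegral_diff_smul_le _ _)
  refine ⟨f, ?_, ?_⟩
  · rw [hf1]
    filter_upwards [hfin] with x hx i
    rw [← Real.norm_eq_abs, ← toReal_enorm]
    exact ENNReal.toReal_mono hx.ne (le_iSup (fun i => ‖(v i).toFun x‖ₑ) i)
  · rw [H1.energy_eq, hf1, hsq]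
    simp only [H1.energy_eq]
    rw [ENNReal.tsum_add]
    exact add_le_add (hf2.trans_eq hC) hint

lemma exists_of_cap_lt {E : Set (Eucl N)} {a : ℝ≥0∞} (h : cap E < a) :
    ∃ u : H1 N, ∃ U : Set (Eucl N), u.energy < a ∧ IsOpen U ∧ E ⊆ U ∧
      ∀ᵐ x, x ∈ U → 1 ≤ u.toFun x := by
  simp only [cap, iInf_lt_iff] at h
  obtain ⟨u, ⟨U, hU⟩, hu⟩ := h
  exact ⟨u, U, hu, hU⟩

lemma cap_le_energy {E U : Set (Eucl N)} (u : H1 N) (hU : IsOpen U) (hE : E ⊆ U)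
    (h : ∀ᵐ x, x ∈ U → 1 ≤ u.toFun x) : cap E ≤ u.energy :=
  iInf₂_le u ⟨U, hU, hE, h⟩

lemma cap_empty : cap (∅ : Set (Eucl N)) = 0 :=
  le_antisymm ((cap_le_energy (H1.zero N) isOpen_empty subset_rfl (by simp)).trans_eq
    H1.energy_zero) zero_le

lemma cap_mono {E F : Set (Eucl N)} (h : E ⊆ F) : cap E ≤ cap F :=
  le_iInf₂ fun u ⟨_, hU, hF, hu⟩ => cap_le_energy u hU (h.trans hF) hu

/-- The supremum of the absolute values of nearly optimal competitors competes for the union, with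
energy at most the sum of theirs. -/
lemma cap_iUnion_le (E : ℕ → Set (Eucl N)) : cap (⋃ i, E i) ≤ ∑' i, cap (E i) := by
  rcases eq_top_or_lt_top (∑' i, cap (E i)) with htop | htop
  · rw [htop]; exact le_top
  refine ENNReal.le_of_forall_pos_le_add fun ε hε _ => ?_
  obtain ⟨δ, hδ, hδs⟩ := ENNReal.exists_pos_sum_of_countable (ENNReal.coe_pos.2 hε).ne' ℕ
  have hlt : ∀ i, cap (E i) < cap (E i) + δ i := fun i =>
    ENNReal.lt_add_right ((ENNReal.le_tsum i).trans_lt htop).ne (ENNReal.coe_pos.2 (hδ i)).ne'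
  choose v U hv hU hEU h1 using fun i => exists_of_cap_lt (hlt i)
  have hsum : ∑' i, (v i).energy ≤ (∑' i, cap (E i)) + ε := by
    calc _ ≤ ∑' i, (cap (E i) + δ i) := ENNReal.tsum_le_tsum fun i => (hv i).le
      _ = (∑' i, cap (E i)) + ∑' i, (δ i : ℝ≥0∞) := ENNReal.tsum_add
      _ ≤ _ := by gcongr
  obtain ⟨f, hf1, hf2⟩ := exists_sup_abs (v := v) (hsum.trans_lt
    (ENNReal.add_lt_top.2 ⟨htop, ENNReal.coe_lt_top⟩))
  refine (cap_le_energy f (isOpen_iUnion hU) (Set.iUnion_mono hEU) ?_).trans (hf2.trans hsum)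
  filter_upwards [hf1, ae_all_iff.2 h1] with x hx h1x hxU
  obtain ⟨i, hi⟩ := Set.mem_iUnion.1 hxU
  exact (h1x i hi).trans ((le_abs_self _).trans (hx i))

/-- Capacity as an outer measure; its `ae` filter describes quasi-everywhere properties. -/
def capOuter (N : ℕ) : OuterMeasure (Eucl N) where
  measureOf := cap
  empty := cap_empty
  mono := cap_mono
  iUnion_nat E _ := cap_iUnion_le E

/-- Chebyshev's inequality for a competitor; hence quasi-everywhere implies almost everywhere. -/
lemma volume_le_cap (E : Set (Eucl N)) : volume E ≤ cap E := by
  refine le_of_forall_gt fun a ha => ?_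
  obtain ⟨u, U, hu, hU, hEU, h1⟩ := exists_of_cap_lt ha
  refine lt_of_le_of_lt ?_ hu
  calc volume E ≤ volume U := measure_mono hEU
    _ = ∫⁻ x in U, 1 := by simp
    _ ≤ ∫⁻ x in U, ‖u.toFun x‖ₑ ^ 2 := by
      refine lintegral_mono_ae ((ae_restrict_iff' hU.measurableSet).2 ?_)
      filter_upwards [h1] with x hx hxU
      rw [Real.enorm_eq_ofReal_abs, ← ENNReal.ofReal_pow (abs_nonneg _), ENNReal.one_le_ofReal,
        sq_abs]
      nlinarith [hx hxU]
    _ ≤ ∫⁻ x, ‖u.toFun x‖ₑ ^ 2 := setLIntegral_le_lintegral _ _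
    _ ≤ _ := u.lintegral_sq_le_energy

lemma ae_of_qe {P : Eucl N → Prop} (h : ∀ᵐ x ∂capOuter N, P x) : ∀ᵐ x, P x :=
  le_antisymm ((volume_le_cap _).trans_eq h) zero_le

lemma IsCapacitary.ae_of_qe {μ : Measure (Eucl N)} (hμ : IsCapacitary μ) {P : Eucl N → Prop}
    (h : ∀ᵐ x ∂capOuter N, P x) : ∀ᵐ x ∂μ, P x := hμ _ h

lemma quasiEverywhereOn_iff {E : Set (Eucl N)} {P : Eucl N → Prop} :
    QuasiEverywhereOn E P ↔ ∀ᵐ x ∂capOuter N, x ∈ E → P x := by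
  rw [QuasiEverywhereOn, ae_iff]
  simp only [Classical.not_imp]
  rfl

lemma QuasiContinuous.comp₂ {f g : Eucl N → ℝ} (hf : QuasiContinuous f) (hg : QuasiContinuous g)
    {Φ : Eucl N → ℝ → ℝ → ℝ} (hΦ : Continuous fun z : Eucl N × ℝ × ℝ => Φ z.1 z.2.1 z.2.2) :
    QuasiContinuous fun x => Φ x (f x) (g x) := by
  intro ε hε
  obtain ⟨f', hf'c, hf'⟩ := hf (ε / 2) (by simpa using hε.ne')
  obtain ⟨g', hg'c, hg'⟩ := hg (ε / 2) (by simpa using hε.ne')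
  refine ⟨fun x => Φ x (f' x) (g' x), hΦ.comp (by fun_prop : Continuous fun x => (x, f' x, g' x)),
    ?_⟩
  calc capOuter N _ ≤ capOuter N ({x | f x ≠ f' x} ∪ {x | g x ≠ g' x}) := by
        refine measure_mono fun x hx => ?_
        by_contra h
        simp only [Set.mem_union, Set.mem_ofPred_eq, not_or, not_not] at h
        exact hx (by simp only [h.1, h.2])
    _ ≤ capOuter N {x | f x ≠ f' x} + capOuter N {x | g x ≠ g' x} := measure_union_le _ _
    _ < ε / 2 + ε / 2 := ENNReal.add_lt_add hf' hg'
    _ = ε := ENNReal.add_halves ε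

/-- Borel–Cantelli for the capacity outer measure: the exceptional sets have summable capacities. -/
lemma QuasiContinuous.exists_approx {f : Eucl N → ℝ} (hf : QuasiContinuous f) :
    ∃ g : ℕ → Eucl N → ℝ, (∀ n, Continuous (g n)) ∧
      ∀ᵐ x ∂capOuter N, ∀ᶠ n in atTop, f x = g n x := by
  obtain ⟨δ, hδ, hδs⟩ := ENNReal.exists_pos_sum_of_countable (one_ne_zero (α := ℝ≥0∞)) ℕ
  choose g hg hcap using fun n => hf (δ n) (ENNReal.coe_pos.2 (hδ n))
  refine ⟨g, hg, ?_⟩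
  have := ae_eventually_notMem (μ := capOuter N) (s := fun n => {x | f x ≠ g n x})
    ((ENNReal.tsum_le_tsum fun n => (hcap n).le).trans_lt (hδs.trans (by simp))).ne
  filter_upwards [this] with x hx
  simpa using hx

/-- A quasi-everywhere limit of continuous functions is a `μ`-a.e. limit, because `μ` does not
charge sets of capacity zero. -/
lemma QuasiContinuous.aestronglyMeasurable {f : Eucl N → ℝ} (hf : QuasiContinuous f)
    {μ : Measure (Eucl N)} (hμ : IsCapacitary μ) : AEStronglyMeasurable f μ := by
  obtain ⟨g, hg, hfg⟩ := hf.exists_approx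
  refine aestronglyMeasurable_of_tendsto_ae atTop (fun n => (hg n).aestronglyMeasurable) ?_
  filter_upwards [hμ.ae_of_qe hfg] with x hx
  exact tendsto_const_nhds.congr' hx

/-- Chebyshev's inequality for capacity. The superlevel set need not be open; it becomes so for a
continuous function agreeing with `u` off an open set of small capacity, and the competitor of that
open set is joined to `|u| / t`. -/
lemma cap_lt_abs_le {u : H1 N} (hu : QuasiContinuous u.toFun) {t : ℝ} (ht : 0 < t) :
    cap {x | t < |u.toFun x|} ≤ ‖t⁻¹‖ₑ ^ 2 * u.energy := by
  refine ENNReal.le_of_forall_pos_le_add fun ε hε _ => ?_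
  obtain ⟨g, hg, hcap⟩ := hu ε (ENNReal.coe_pos.2 hε)
  obtain ⟨v, G, hv, hG, hEG, h1⟩ := exists_of_cap_lt hcap
  -- Two functions padded with zeros, so that the countable supremum of `exists_sup_abs` applies.
  set w : ℕ → H1 N := fun n => if n = 0 then H1.lin t⁻¹ u 0 u else if n = 1 then v else H1.zero N
    with hw
  have hsum : ∑' i, (w i).energy = ‖t⁻¹‖ₑ ^ 2 * u.energy + v.energy := by
    rw [tsum_eq_sum (s := {0, 1})]
    · simp [hw, H1.energy_smul]
    · intro b hb
      simp only [Finset.mem_insert, Finset.mem_singleton, not_or] at hb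
      simp [hw, hb.1, hb.2, H1.energy_zero]
  obtain ⟨f, hf1, hf2⟩ := exists_sup_abs (v := w) (by
    rw [hsum]
    exact ENNReal.add_lt_top.2 ⟨ENNReal.mul_lt_top (by finiteness) u.energy_lt_top,
      v.energy_lt_top⟩)
  rw [hsum] at hf2
  refine (cap_le_energy f (U := {x | t < |g x|} ∪ G)
    ((isOpen_lt continuous_const hg.abs).union hG) ?_ ?_).trans (hf2.trans (by gcongr))
  · intro x hx
    by_cases h : u.toFun x = g x
    · left; simpa [← h] using hx
    · right; exact hEG h
  · filter_upwards [hf1, h1] with x hx h1x hxU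
    by_cases hxG : x ∈ G
    · exact (h1x hxG).trans ((le_abs_self _).trans (by simpa [hw] using hx 1))
    · have h : u.toFun x = g x := by
        by_contra h
        exact hxG (hEG h)
      have h2 : t < |u.toFun x| := by
        rcases hxU with h' | h'
        · rw [h]; exact h'
        · exact absurd h' hxG
      have h3 := hx 0
      simp only [hw, H1.lin, if_true] at h3
      rw [zero_mul, add_zero, abs_mul, abs_of_pos (by positivity : (0 : ℝ) < t⁻¹)] at h3
      refine le_trans ?_ h3
      rw [← div_eq_inv_mul, one_le_div ht]
      exact h2.le

/-- The energy vanishes, so every set `{|u| > 1/(n+1)}` has capacity zero. This is the uniqueness of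
the quasi-continuous representative. -/
lemma qe_eq_zero_of_ae {u : H1 N} (hu : QuasiContinuous u.toFun) (h : u.toFun =ᵐ[volume] 0) :
    ∀ᵐ x ∂capOuter N, u.toFun x = 0 := by
  have h1 : ∀ n : ℕ, ∀ᵐ x ∂capOuter N, |u.toFun x| ≤ 1 / (n + 1 : ℝ) := by
    intro n
    have := cap_lt_abs_le hu (t := 1 / (n + 1 : ℝ)) (by positivity)
    rw [H1.energy_eq_zero h, mul_zero] at this
    rw [ae_iff]
    simp only [not_le]
    exact le_antisymm this zero_le
  filter_upwards [ae_all_iff.2 h1] with x hx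
  have := ge_of_tendsto tendsto_one_div_add_atTop_nhds_zero_nat (Eventually.of_forall hx)
  simpa using this

end Capacity

/-! ### Completeness: limits of quasi-continuous Sobolev functions. -/

section QuasiContinuousLimits

variable {N : ℕ}

lemma exists_continuous_limit {v : ℕ → Eucl N → ℝ} (hv : ∀ n, QuasiContinuous (v n))
    {a : ℕ → ℝ≥0∞} (ha : ∑' n, a n ≠ ⊤)
    (hva : ∀ n, cap {x | (1 / 2 : ℝ) ^ n < |v (n + 1) x - v n x|} ≤ a n) {ε : ℝ≥0∞} (hε : 0 < ε) :
    ∃ g : Eucl N → ℝ, Continuous g ∧ ∃ B : Set (Eucl N), cap B < ε ∧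
      ∀ x ∉ B, Tendsto (fun n => v n x) atTop (𝓝 (g x)) := by
  have hε2 : 0 < ε / 2 := by simpa using hε.ne'
  obtain ⟨k, hk⟩ : ∃ k, ∑' n, a (n + k) < ε / 2 :=
    ((ENNReal.tendsto_sum_nat_add a ha).eventually (gt_mem_nhds hε2)).exists
  obtain ⟨δ, hδ, hδs⟩ := ENNReal.exists_pos_sum_of_countable hε2.ne' ℕ
  choose γ hγ hcap using fun n => hv (n + k) (δ n) (ENNReal.coe_pos.2 (hδ n))
  -- Clamping the increments of the continuous approximants makes their series converge uniformly
  -- everywhere, so its sum is continuous; off the exceptional set the clamping changes nothing.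
  set d : ℕ → Eucl N → ℝ := fun n x =>
    max (-(1 / 2 : ℝ) ^ (n + k)) (min (γ (n + 1) x - γ n x) ((1 / 2 : ℝ) ^ (n + k))) with hd
  have hdb : ∀ n x, ‖d n x‖ ≤ (1 / 2 : ℝ) ^ (n + k) := by
    intro n x
    have : (0 : ℝ) ≤ (1 / 2 : ℝ) ^ (n + k) := by positivity
    rw [Real.norm_eq_abs, abs_le]
    exact ⟨le_max_left _ _, max_le (by linarith) (min_le_right _ _)⟩
  have hsum : Summable fun n : ℕ => (1 / 2 : ℝ) ^ (n + k) :=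
    (summable_nat_add_iff k).2 (summable_geometric_of_lt_one (by norm_num) (by norm_num))
  refine ⟨fun x => γ 0 x + ∑' n, d n x, ?_,
    (⋃ n, {x | v (n + k) x ≠ γ n x}) ∪
      ⋃ n, {x | (1 / 2 : ℝ) ^ (n + k) < |v (n + k + 1) x - v (n + k) x|}, ?_, ?_⟩
  · refine (hγ 0).add (continuous_tsum (fun n => ?_) hsum hdb)
    exact continuous_const.max (((hγ (n + 1)).sub (hγ n)).min continuous_const)
  · calc capOuter N _ ≤ capOuter N (⋃ n, {x | v (n + k) x ≠ γ n x}) + capOuter N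
          (⋃ n, {x | (1 / 2 : ℝ) ^ (n + k) < |v (n + k + 1) x - v (n + k) x|}) :=
            measure_union_le _ _
      _ ≤ (∑' n, (δ n : ℝ≥0∞)) + ∑' n, a (n + k) := by
          refine add_le_add ((measure_iUnion_le _).trans (ENNReal.tsum_le_tsum fun n => ?_))
            ((measure_iUnion_le _).trans (ENNReal.tsum_le_tsum fun n => hva (n + k)))
          exact (hcap n).le
      _ < ε / 2 + ε / 2 := ENNReal.add_lt_add hδs hk
      _ = ε := ENNReal.add_halves ε
  · intro x hx
    simp only [Set.mem_union, Set.mem_iUnion, Set.mem_ofPred_eq, not_or, not_exists, not_not,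
      not_lt] at hx
    obtain ⟨hx1, hx2⟩ := hx
    have hdx : ∀ n, d n x = v (n + k + 1) x - v (n + k) x := by
      intro n
      have h1 := abs_le.1 (hx2 n)
      have h2 := hx1 (n + 1)
      rw [show n + 1 + k = n + k + 1 by ring] at h2
      simp only [hd]
      rw [← h2, ← hx1 n, min_eq_left h1.2, max_eq_right h1.1]
    have hs : Summable fun n => d n x := Summable.of_norm_bounded hsum fun n => hdb n x
    have h3 := (hs.hasSum.tendsto_sum_nat).const_add (γ 0 x)
    rw [← tendsto_add_atTop_iff_nat k]
    refine h3.congr fun n => ?_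
    have : ∑ i ∈ Finset.range n, d i x = v (n + k) x - v k x := by
      simp only [hdx]
      have := Finset.sum_range_sub (fun i => v (i + k) x) n
      simp only [zero_add] at this
      rw [← this]
      refine Finset.sum_congr rfl fun i _ => ?_
      rw [show i + 1 + k = i + k + 1 by ring]
    rw [this, ← hx1 0, zero_add]
    ring

lemma exists_quasiContinuous_limit {v : ℕ → Eucl N → ℝ} (hv : ∀ n, QuasiContinuous (v n))
    {a : ℕ → ℝ≥0∞} (ha : ∑' n, a n ≠ ⊤)
    (hva : ∀ n, cap {x | (1 / 2 : ℝ) ^ n < |v (n + 1) x - v n x|} ≤ a n) :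
    ∃ f, QuasiContinuous f ∧ ∀ᵐ x ∂capOuter N, Tendsto (fun n => v n x) atTop (𝓝 (f x)) := by
  -- One function serves every `ε`: it equals each continuous limit off the corresponding
  -- exceptional set.
  refine ⟨fun x => limUnder atTop fun n => v n x, fun ε hε => ?_, ?_⟩
  · obtain ⟨g, hg, B, hB, hx⟩ := exists_continuous_limit hv ha hva hε
    refine ⟨g, hg, (cap_mono fun x hxg => ?_).trans_lt hB⟩
    by_contra h
    exact hxg (hx x h).limUnder_eq
  · rw [ae_iff]
    refine le_antisymm (le_of_forall_pos_lt_add' fun ε hε => ?_) zero_le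
    obtain ⟨g, hg, B, hB, hx⟩ := exists_continuous_limit hv ha hva hε
    rw [zero_add]
    refine lt_of_le_of_lt (cap_mono fun x hxg => ?_) hB
    by_contra h
    exact hxg (tendsto_nhds_limUnder ⟨_, hx x h⟩)

/-- The class in `L²` of an `H¹` function. -/
def H1.toL2 (u : H1 N) : Lp ℝ 2 (volume : Measure (Eucl N)) := u.memLp_toFun.toLp _

/-- The class in `L²` of the gradient of an `H¹` function. -/
def H1.gradL2 (u : H1 N) : Lp (Eucl N) 2 (volume : Measure (Eucl N)) := u.memLp_grad.toLp _

lemma H1.energy_sub (u w : H1 N) : (H1.lin 1 u (-1) w).energy =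
    ENNReal.ofReal (‖u.gradL2 - w.gradL2‖ ^ 2) + ENNReal.ofReal (‖u.toL2 - w.toL2‖ ^ 2) := by
  rw [H1.energy_eq, H1.toL2, H1.toL2, H1.gradL2, H1.gradL2, ← MemLp.toLp_sub, ← MemLp.toLp_sub,
    ofReal_norm_toLp_sq, ofReal_norm_toLp_sq]
  simp [H1.lin, sub_eq_add_neg]

lemma exists_limit_of_tendsto {u : ℕ → H1 N} (hu : ∀ n, QuasiContinuous (u n).toFun)
    {F : Lp ℝ 2 (volume : Measure (Eucl N))} {G : Lp (Eucl N) 2 (volume : Measure (Eucl N))}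
    (hF : Tendsto (fun n => (u n).toL2) atTop (𝓝 F))
    (hG : Tendsto (fun n => (u n).gradL2) atTop (𝓝 G)) :
    ∃ f : H1 N, QuasiContinuous f.toFun ∧ f.toL2 = F ∧ f.gradL2 = G ∧
      ∃ ns : ℕ → ℕ, StrictMono ns ∧
        ∀ᵐ x ∂capOuter N, Tendsto (fun k => (u (ns k)).toFun x) atTop (𝓝 (f.toFun x)) := by
  -- Chebyshev's inequality at level `2⁻ᵏ` costs a factor `4ᵏ`, so energies `16⁻ᵏ` leave the
  -- summable capacities `4⁻ᵏ`.
  have hev : ∀ k : ℕ, ∀ᶠ n in atTop, ∀ m ≥ n,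
      (H1.lin 1 (u m) (-1) (u n)).energy ≤ ENNReal.ofReal ((1 / 16 : ℝ) ^ k) := by
    intro k
    have hpos : (0 : ℝ) < (1 / 4 : ℝ) ^ k / 4 := by positivity
    filter_upwards [eventually_forall_ge_atTop.2 (Metric.tendsto_nhds.1 hF _ hpos),
      eventually_forall_ge_atTop.2 (Metric.tendsto_nhds.1 hG _ hpos)] with n h1 h2 m hm
    have e1 : dist (u m).toL2 (u n).toL2 ≤ (1 / 4 : ℝ) ^ k / 2 := by
      have := dist_triangle_right (u m).toL2 (u n).toL2 F
      have := h1 m hm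
      have := h1 n le_rfl
      linarith
    have e2 : dist (u m).gradL2 (u n).gradL2 ≤ (1 / 4 : ℝ) ^ k / 2 := by
      have := dist_triangle_right (u m).gradL2 (u n).gradL2 G
      have := h2 m hm
      have := h2 n le_rfl
      linarith
    rw [dist_eq_norm] at e1 e2
    rw [H1.energy_sub, ← ENNReal.ofReal_add (by positivity) (by positivity)]
    refine ENNReal.ofReal_le_ofReal ?_
    calc _ ≤ ((1 / 4 : ℝ) ^ k / 2) ^ 2 + ((1 / 4 : ℝ) ^ k / 2) ^ 2 := by gcongr
      _ = ((1 / 4 : ℝ) ^ 2) ^ k / 2 := by rw [← pow_mul, mul_comm 2 k, pow_mul]; ring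
      _ ≤ ((1 / 4 : ℝ) ^ 2) ^ k := by
        have : (0 : ℝ) < ((1 / 4 : ℝ) ^ 2) ^ k := by positivity
        linarith
      _ = _ := by norm_num
  obtain ⟨ns, hns, hnsE⟩ := extraction_forall_of_eventually hev
  obtain ⟨f, hfq, hf⟩ := exists_quasiContinuous_limit (v := fun k => (u (ns k)).toFun)
    (fun k => hu _) (a := fun k => ENNReal.ofReal ((1 / 4 : ℝ) ^ k))
    (by
      rw [← ENNReal.ofReal_tsum_of_nonneg (fun n => by positivity)
        (summable_geometric_of_lt_one (by norm_num) (by norm_num))]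
      exact ENNReal.ofReal_ne_top)
    (fun k => by
      have hq : QuasiContinuous (H1.lin 1 (u (ns (k + 1))) (-1) (u (ns k))).toFun :=
        (hu _).comp₂ (hu _) (Φ := fun _ a b => 1 * a + -1 * b) (by fun_prop)
      have h1 := cap_lt_abs_le hq (t := (1 / 2 : ℝ) ^ k) (by positivity)
      have h2 : ∀ x, (H1.lin 1 (u (ns (k + 1))) (-1) (u (ns k))).toFun x =
          (u (ns (k + 1))).toFun x - (u (ns k)).toFun x := fun x => by simp [H1.lin]; ring
      simp only [h2] at h1
      refine h1.trans ?_
      calc _ ≤ ‖((1 / 2 : ℝ) ^ k)⁻¹‖ₑ ^ 2 * ENNReal.ofReal ((1 / 16 : ℝ) ^ k) := by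
            gcongr
            exact hnsE k _ (hns.monotone (Nat.le_succ k))
        _ = ENNReal.ofReal ((1 / 4 : ℝ) ^ k) := by
            rw [Real.enorm_eq_ofReal (by positivity), ← ENNReal.ofReal_pow (by positivity),
              ← ENNReal.ofReal_mul (by positivity)]
            congr 1
            rw [← inv_pow, ← pow_mul, mul_comm k 2, pow_mul, ← mul_pow]
            norm_num)
  have hfF : f =ᵐ[volume] F := by
    have h1 : Tendsto (fun k => (u (ns k)).toL2) atTop (𝓝 F) := hF.comp hns.tendsto_atTop
    obtain ⟨ms, hms, hae⟩ := (tendstoInMeasure_of_tendsto_Lp h1).exists_seq_tendsto_ae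
    have h2 : ∀ᵐ x, ∀ k, (u (ns k)).toL2 x = (u (ns k)).toFun x :=
      ae_all_iff.2 fun k => (u (ns k)).memLp_toFun.coeFn_toLp
    filter_upwards [hae, h2, ae_of_qe hf] with x h3 h4 h5
    simp only [h4] at h3
    exact tendsto_nhds_unique (h5.comp hms.tendsto_atTop) h3
  have hfm : MemLp f 2 volume := (memLp_congr_ae hfF).2 (Lp.memLp F)
  have hfl : hfm.toLp f = F := by
    apply Lp.ext
    exact hfm.coeFn_toLp.trans hfF
  refine ⟨⟨f, G, hfm, Lp.memLp G, fun φ hφ hc v => ?_⟩, hfq, hfl, Lp.toLp_coeFn G _,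
    ns, hns, hf⟩
  have hd : MemLp (fun x => fderiv ℝ φ x v) 2 volume :=
    ((hφ.continuous_fderiv (by simp)).clm_apply
      continuous_const).memLp_of_hasCompactSupport (hc.fderiv_apply ℝ _)
  have hp := memLp_of_test hφ hc
  have hpv : MemLp (fun x => φ x • v) 2 volume :=
    ((ContinuousLinearMap.id ℝ ℝ).smulRight v).comp_memLp' hp
  have hgr : ∀ g : Eucl N → Eucl N, ∀ hg : MemLp g 2 volume,
      ⟪hg.toLp g, hpv.toLp _⟫ = ∫ x, ⟪g x, v⟫ * φ x := by
    intro g hg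
    rw [L2.inner_def]
    refine integral_congr_ae ?_
    filter_upwards [hg.coeFn_toLp, hpv.coeFn_toLp] with x h1 h2
    rw [h1, h2, real_inner_smul_right, mul_comm]
  have t1 : Tendsto (fun n => ⟪(u n).toL2, hd.toLp _⟫) atTop
      (𝓝 (∫ x, f x * fderiv ℝ φ x v)) := by
    rw [← inner_toLp hfm hd, hfl]
    exact hF.inner tendsto_const_nhds
  have t2 : Tendsto (fun n => -⟪(u n).gradL2, hpv.toLp _⟫) atTop
      (𝓝 (-∫ x, ⟪G x, v⟫ * φ x)) := by
    rw [← hgr G (Lp.memLp G), Lp.toLp_coeFn]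
    exact (hG.inner tendsto_const_nhds).neg
  refine tendsto_nhds_unique t1 (t2.congr fun n => ?_)
  rw [H1.toL2, H1.gradL2, hgr, inner_toLp, (u n).weak_grad φ hφ hc v]

end QuasiContinuousLimits

/-! ### Existence of weak solutions by projection. -/

section WeakSolutions

variable {N : ℕ} {μ : Measure (Eucl N)} {Ω : Set (Eucl N)}

lemma mem_H1mu_iff {u : H1 N} : u ∈ H1mu μ ↔
    QuasiContinuous u.toFun ∧ ∫⁻ x, ‖u.toFun x‖ₑ ^ 2 ∂μ < ⊤ := by
  have : normSq μ u = u.energy + ∫⁻ x, ‖u.toFun x‖ₑ ^ 2 ∂μ := rfl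
  simp only [H1mu, Set.mem_ofPred_eq, this, ENNReal.add_lt_top, u.energy_lt_top, true_and]

lemma mem_H1muDirichlet_iff {u : H1 N} : u ∈ H1muDirichlet μ Ω ↔ u ∈ H1mu μ ∧
    ∀ᵐ x ∂capOuter N, x ∉ Ω → u.toFun x = 0 := by
  simp only [H1muDirichlet, Set.mem_ofPred_eq, quasiEverywhereOn_iff, Set.mem_compl_iff]

lemma memLp_of_mem_H1mu (hμ : IsCapacitary μ) {u : H1 N} (hu : u ∈ H1mu μ) :
    MemLp u.toFun 2 μ :=
  (memLp_two_iff ((mem_H1mu_iff.1 hu).1.aestronglyMeasurable hμ)).2 (mem_H1mu_iff.1 hu).2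

lemma mem_H1mu_of_abs_le (hμ : IsCapacitary μ) {u w f : H1 N} (hu : u ∈ H1mu μ) (hw : w ∈ H1mu μ)
    (hf : QuasiContinuous f.toFun) {L : ℝ}
    (h : ∀ x, |f.toFun x| ≤ L * (|u.toFun x| + |w.toFun x|)) : f ∈ H1mu μ := by
  refine mem_H1mu_iff.2 ⟨hf, MemLp.lintegral_sq_lt_top ?_⟩
  refine MemLp.mono (g := fun x => L * (|u.toFun x| + |w.toFun x|)) ?_ (hf.aestronglyMeasurable hμ)
    (Eventually.of_forall fun x => ?_)
  · exact ((memLp_of_mem_H1mu hμ hu).abs.add (memLp_of_mem_H1mu hμ hw).abs).const_mul L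
  · rw [Real.norm_eq_abs]; exact (h x).trans (le_abs_self _)

lemma exists_mem_H1mu_comp (hμ : IsCapacitary μ) {u w : H1 N} (hu : u ∈ H1mu μ) (hw : w ∈ H1mu μ)
    {Φ : Eucl N → ℝ → ℝ → ℝ}
    (hΦ : Continuous fun z : Eucl N × ℝ × ℝ => Φ z.1 z.2.1 z.2.2) {L : ℝ}
    (h0 : ∀ x a b, |Φ x a b| ≤ L * (|a| + |b|))
    (h1 : ∀ x y a b a' b',
      |Φ y a' b' - Φ x a b| ≤ L * (|a' - a| + |b' - b| + ‖y - x‖ * (|a| + |b|))) :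
    ∃ f : H1 N, f.toFun = (fun x => Φ x (u.toFun x) (w.toFun x)) ∧ f ∈ H1mu μ := by
  obtain ⟨f, hf⟩ := H1.exists_comp u w hΦ h0 h1
  refine ⟨f, hf, mem_H1mu_of_abs_le hμ hu hw (L := L) ?_ ?_⟩
  · rw [hf]
    exact (mem_H1mu_iff.1 hu).1.comp₂ (mem_H1mu_iff.1 hw).1 hΦ
  · intro x
    rw [hf]
    exact h0 _ _ _

lemma lin_mem_H1mu (hμ : IsCapacitary μ) {u w : H1 N} (hu : u ∈ H1mu μ) (hw : w ∈ H1mu μ)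
    (a b : ℝ) : H1.lin a u b w ∈ H1mu μ := by
  refine mem_H1mu_of_abs_le hμ hu hw (L := |a| + |b|)
    ((mem_H1mu_iff.1 hu).1.comp₂ (mem_H1mu_iff.1 hw).1
      (Φ := fun _ s t => a * s + b * t) (by fun_prop)) fun x => ?_
  simp only [H1.lin]
  refine (abs_add_le _ _).trans ?_
  rw [abs_mul, abs_mul]
  nlinarith [abs_nonneg a, abs_nonneg b, abs_nonneg (u.toFun x), abs_nonneg (w.toFun x),
    mul_nonneg (abs_nonneg a) (abs_nonneg (w.toFun x)),
    mul_nonneg (abs_nonneg b) (abs_nonneg (u.toFun x))]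

lemma zero_mem_H1muDirichlet : H1.zero N ∈ H1muDirichlet μ Ω := by
  refine mem_H1muDirichlet_iff.2 ⟨mem_H1mu_iff.2 ⟨fun ε hε => ⟨0, continuous_zero, ?_⟩, ?_⟩, ?_⟩
  · simpa [H1.zero, cap_empty] using hε
  · simp [H1.zero]
  · simp [H1.zero]

lemma lin_mem_H1muDirichlet (hμ : IsCapacitary μ) {u w : H1 N} (hu : u ∈ H1muDirichlet μ Ω)
    (hw : w ∈ H1muDirichlet μ Ω) (a b : ℝ) : H1.lin a u b w ∈ H1muDirichlet μ Ω := by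
  rw [mem_H1muDirichlet_iff] at hu hw ⊢
  refine ⟨lin_mem_H1mu hμ hu.1 hw.1 a b, ?_⟩
  filter_upwards [hu.2, hw.2] with x h1 h2 hx
  simp [H1.lin, h1 hx, h2 hx]

/-- The ambient Hilbert space `L²(dx) × L²(dx; ℝ^N) × L²(μ)`. -/
abbrev Ambient (μ : Measure (Eucl N)) : Type :=
  WithLp 2 (Lp ℝ 2 (volume : Measure (Eucl N)) ×
    WithLp 2 (Lp (Eucl N) 2 (volume : Measure (Eucl N)) × Lp ℝ 2 μ))

/-- The image of `H¹_0(Ω) ∩ H¹_μ` in the ambient Hilbert space. -/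
def dirichletSubmodule (hμ : IsCapacitary μ) (Ω : Set (Eucl N)) : Submodule ℝ (Ambient μ) where
  carrier := {k | ∃ u ∈ H1muDirichlet μ Ω, u.toFun =ᵐ[volume] k.fst ∧
    u.grad =ᵐ[volume] k.snd.fst ∧ u.toFun =ᵐ[μ] k.snd.snd}
  zero_mem' := by
    refine ⟨H1.zero N, zero_mem_H1muDirichlet, ?_, ?_, ?_⟩
    · exact (Lp.coeFn_zero ℝ 2 volume).symm
    · exact (Lp.coeFn_zero (Eucl N) 2 volume).symm
    · exact (Lp.coeFn_zero ℝ 2 μ).symm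
  add_mem' := by
    rintro k l ⟨u, hu, hu1, hu2, hu3⟩ ⟨w, hw, hw1, hw2, hw3⟩
    refine ⟨H1.lin 1 u 1 w, lin_mem_H1muDirichlet hμ hu hw 1 1, ?_, ?_, ?_⟩
    · filter_upwards [hu1, hw1, Lp.coeFn_add k.fst l.fst] with x h1 h2 h3
      refine Eq.trans ?_ h3.symm
      simp [H1.lin, h1, h2]
    · filter_upwards [hu2, hw2, Lp.coeFn_add k.snd.fst l.snd.fst] with x h1 h2 h3
      refine Eq.trans ?_ h3.symm
      simp [H1.lin, h1, h2]
    · filter_upwards [hu3, hw3, Lp.coeFn_add k.snd.snd l.snd.snd] with x h1 h2 h3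
      refine Eq.trans ?_ h3.symm
      simp [H1.lin, h1, h2]
  smul_mem' := by
    rintro c k ⟨u, hu, hu1, hu2, hu3⟩
    refine ⟨H1.lin c u 0 u, lin_mem_H1muDirichlet hμ hu hu c 0, ?_, ?_, ?_⟩
    · filter_upwards [hu1, Lp.coeFn_smul c k.fst] with x h1 h3
      simp [H1.lin, h1, h3]
    · filter_upwards [hu2, Lp.coeFn_smul c k.snd.fst] with x h1 h3
      simp [H1.lin, h1, h3]
    · filter_upwards [hu3, Lp.coeFn_smul c k.snd.snd] with x h1 h3
      simp [H1.lin, h1, h3]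

/-- A subsequence converges quasi-everywhere. This preserves the Dirichlet condition and, since `μ`
ignores sets of capacity zero, identifies the limit in `L²(μ)` with the quasi-continuous limit. -/
lemma isClosed_dirichletSubmodule (hμ : IsCapacitary μ) (Ω : Set (Eucl N)) :
    IsClosed (dirichletSubmodule hμ Ω : Set (Ambient μ)) := by
  refine isClosed_of_closure_subset fun k hk => ?_
  obtain ⟨s, hs, hsk⟩ := mem_closure_iff_seq_limit.1 hk
  choose u hu h1 h2 h3 using hs
  have e1 : ∀ n, (u n).toL2 = (s n).fst := fun n =>
    Lp.ext ((u n).memLp_toFun.coeFn_toLp.trans (h1 n))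
  have e2 : ∀ n, (u n).gradL2 = (s n).snd.fst := fun n =>
    Lp.ext ((u n).memLp_grad.coeFn_toLp.trans (h2 n))
  have c1 : Tendsto (fun n => (s n).fst) atTop (𝓝 k.fst) :=
    ((WithLp.prod_continuous_ofLp 2 _ _).fst.tendsto k).comp hsk
  have c2' : Tendsto (fun n => (s n).snd) atTop (𝓝 k.snd) :=
    ((WithLp.prod_continuous_ofLp 2 _ _).snd.tendsto k).comp hsk
  have c2 : Tendsto (fun n => (s n).snd.fst) atTop (𝓝 k.snd.fst) :=
    ((WithLp.prod_continuous_ofLp 2 _ _).fst.tendsto k.snd).comp c2'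
  have c3 : Tendsto (fun n => (s n).snd.snd) atTop (𝓝 k.snd.snd) :=
    ((WithLp.prod_continuous_ofLp 2 _ _).snd.tendsto k.snd).comp c2'
  simp only [← e1] at c1
  simp only [← e2] at c2
  obtain ⟨f, hfq, hfF, hfG, ns, hns, hf⟩ := exists_limit_of_tendsto
    (fun n => (mem_H1mu_iff.1 (mem_H1muDirichlet_iff.1 (hu n)).1).1) c1 c2
  have hfμ : f.toFun =ᵐ[μ] k.snd.snd := by
    obtain ⟨ms, hms, hae⟩ := (tendstoInMeasure_of_tendsto_Lp
      (c3.comp hns.tendsto_atTop)).exists_seq_tendsto_ae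
    filter_upwards [hae, ae_all_iff.2 fun n => h3 n, hμ.ae_of_qe hf] with x y1 y2 y3
    simp only [Function.comp_apply, ← y2] at y1
    exact tendsto_nhds_unique (y3.comp hms.tendsto_atTop) y1
  refine ⟨f, mem_H1muDirichlet_iff.2 ⟨mem_H1mu_iff.2 ⟨hfq, ?_⟩, ?_⟩, ?_, ?_, hfμ⟩
  · exact ((memLp_congr_ae hfμ).2 (Lp.memLp _)).lintegral_sq_lt_top
  · filter_upwards [hf, ae_all_iff.2 fun n => (mem_H1muDirichlet_iff.1 (hu n)).2] with x y1 y2 hx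
    refine tendsto_nhds_unique y1 ?_
    simp only [y2 _ hx]
    exact tendsto_const_nhds
  · rw [← hfF]; exact f.memLp_toFun.coeFn_toLp.symm
  · rw [← hfG]; exact f.memLp_grad.coeFn_toLp.symm

lemma exists_isWeakSolution (hμ : IsCapacitary μ) (hΩ : MeasurableSet Ω)
    (hΩv : volume Ω ≠ ⊤) : ∃ u : H1 N, IsWeakSolution μ Ω (fun _ => 1) u := by
  set K := dirichletSubmodule hμ Ω
  have : CompleteSpace K := (isClosed_dirichletSubmodule hμ Ω).completeSpace_coe
  -- Pairing with `(1_Ω, 0, 0)` is the functional `φ ↦ ∫ φ` on the subspace, as its elements vanish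
  -- outside `Ω`; the projection of `b` is therefore the Riesz representative.
  set b : Ambient μ := WithLp.toLp 2 (indicatorConstLp 2 hΩ hΩv (1 : ℝ), 0) with hb
  obtain ⟨u, hu, h1, h2, h3⟩ := (K.orthogonalProjectionOnto b).2
  refine ⟨u, hu, fun φ hφ => ?_⟩
  set kφ : Ambient μ := WithLp.toLp 2 (φ.toL2, WithLp.toLp 2 (φ.gradL2,
    (memLp_of_mem_H1mu hμ (mem_H1muDirichlet_iff.1 hφ).1).toLp _)) with hkφ
  have e1 : φ.toFun =ᵐ[volume] φ.toL2 := φ.memLp_toFun.coeFn_toLp.symm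
  have e2 : φ.grad =ᵐ[volume] φ.gradL2 := φ.memLp_grad.coeFn_toLp.symm
  have e3 := (memLp_of_mem_H1mu hμ (mem_H1muDirichlet_iff.1 hφ).1).coeFn_toLp.symm
  have hk : kφ ∈ K := ⟨φ, hφ, e1, e2, e3⟩
  have key : ⟪(K.orthogonalProjectionOnto b : Ambient μ), kφ⟫ = ⟪b, kφ⟫ := by
    have : ⟪b - (K.orthogonalProjectionOnto b : Ambient μ), kφ⟫ = 0 :=
      K.starProjection_inner_eq_zero b kφ hk
    rw [inner_sub_left] at this
    linarith
  rw [WithLp.prod_inner_apply, WithLp.prod_inner_apply, hb, WithLp.prod_inner_apply] at key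
  have r1 : ⟪indicatorConstLp 2 hΩ hΩv (1 : ℝ), φ.toL2⟫ = ∫ x, 1 * φ.toFun x := by
    rw [L2.inner_indicatorConstLp_one]
    simp only [one_mul]
    rw [setIntegral_congr_ae hΩ (g := φ.toFun) (by filter_upwards [e1] with x hx _ using hx.symm)]
    refine setIntegral_eq_integral_of_ae_compl_eq_zero ?_
    filter_upwards [ae_of_qe (mem_H1muDirichlet_iff.1 hφ).2] with x hx
    exact hx
  have l1 : ⟪(K.orthogonalProjectionOnto b : Ambient μ).fst, φ.toL2⟫
      = ∫ x, u.toFun x * φ.toFun x := by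
    rw [L2.inner_def]
    refine integral_congr_ae ?_
    filter_upwards [h1, e1] with x y1 y2
    rw [← y1, ← y2]; simp [mul_comm]
  have l2 : ⟪(K.orthogonalProjectionOnto b : Ambient μ).snd.fst, φ.gradL2⟫
      = ∫ x, ⟪u.grad x, φ.grad x⟫ := by
    rw [L2.inner_def]
    refine integral_congr_ae ?_
    filter_upwards [h2, e2] with x y1 y2
    rw [← y1, ← y2]
  have l3 : ⟪(K.orthogonalProjectionOnto b : Ambient μ).snd.snd,
      (memLp_of_mem_H1mu hμ (mem_H1muDirichlet_iff.1 hφ).1).toLp _⟫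
      = ∫ x, u.toFun x * φ.toFun x ∂μ := by
    rw [L2.inner_def]
    refine integral_congr_ae ?_
    filter_upwards [h3, e3] with x y1 y2
    rw [← y1, ← y2]; simp [mul_comm]
  have key2 := l1 ▸ l2 ▸ l3 ▸ r1 ▸ key
  have e0 : ⟪b.snd, kφ.snd⟫ = 0 := inner_zero_left _
  have hs : ∫ x, (⟪u.grad x, φ.grad x⟫ + u.toFun x * φ.toFun x) =
      (∫ x, ⟪u.grad x, φ.grad x⟫) + ∫ x, u.toFun x * φ.toFun x :=
    integral_add (u.integrable_grad_inner φ) (u.memLp_toFun.integrable_mul φ.memLp_toFun)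
  have key3 := key2.trans (congrArg (fun z => (∫ x, 1 * φ.toFun x) + z) e0)
  rw [hs]
  linarith [key3]

end WeakSolutions

lemma integrable_mul_of_memLp_two {α : Type*} [MeasurableSpace α] {μ : Measure α} {f g : α → ℝ}
    (hf : MemLp f 2 μ) (hg : MemLp g 2 μ) : Integrable (fun x => f x * g x) μ :=
  hf.integrable_mul hg

/-! ### Comparison principles and existence of the limit. -/

section Comparison

variable {N : ℕ} {μ : Measure (Eucl N)} {Ω Ω' : Set (Eucl N)}

lemma IsWeakSolution.eq {u φ : H1 N} (hu : IsWeakSolution μ Ω (fun _ => 1) u)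
    (hφ : φ ∈ H1muDirichlet μ Ω) :
    (∫ x, ⟪u.grad x, φ.grad x⟫) + (∫ x, u.toFun x * φ.toFun x) +
      ∫ x, u.toFun x * φ.toFun x ∂μ = ∫ x, φ.toFun x := by
  have hs : ∫ x, (⟪u.grad x, φ.grad x⟫ + u.toFun x * φ.toFun x) =
      (∫ x, ⟪u.grad x, φ.grad x⟫) + ∫ x, u.toFun x * φ.toFun x :=
    integral_add (u.integrable_grad_inner φ) (u.memLp_toFun.integrable_mul φ.memLp_toFun)
  have := hu.2 φ hφ
  simp only [one_mul] at this
  rw [← hs, this]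

lemma H1.ae_eq_zero_of_integral_sq_nonpos {f : H1 N} (h : ∫ x, f.toFun x * f.toFun x ≤ 0) :
    f.toFun =ᵐ[volume] 0 := by
  have h0 : ∫ x, f.toFun x * f.toFun x = 0 := le_antisymm h (integral_nonneg fun x =>
    mul_self_nonneg _)
  rw [integral_eq_zero_iff_of_nonneg (fun x => mul_self_nonneg _)
    (f.memLp_toFun.integrable_mul f.memLp_toFun)] at h0
  filter_upwards [h0] with x hx
  exact mul_self_eq_zero.1 hx

lemma exists_mem_H1muDirichlet_comp (hμ : IsCapacitary μ) {u w : H1 N} (hu : u ∈ H1mu μ)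
    (hw : w ∈ H1mu μ) {Ψ : ℝ → ℝ → ℝ} (hΨ : Continuous fun z : ℝ × ℝ => Ψ z.1 z.2) (L : ℝ)
    (hL : 0 ≤ L) (h0 : Ψ 0 0 = 0)
    (h1 : ∀ a b a' b', |Ψ a' b' - Ψ a b| ≤ L * (|a' - a| + |b' - b|))
    (hq : ∀ᵐ x ∂capOuter N, x ∉ Ω → Ψ (u.toFun x) (w.toFun x) = 0) :
    ∃ f : H1 N, f.toFun = (fun x => Ψ (u.toFun x) (w.toFun x)) ∧ f ∈ H1muDirichlet μ Ω := by
  obtain ⟨f, hf, hfm⟩ := exists_mem_H1mu_comp hμ hu hw (Φ := fun _ a b => Ψ a b) (L := L)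
    (hΨ.comp continuous_snd) (fun x a b => by simpa [h0] using h1 0 0 a b)
    (fun x y a b a' b' => by
      refine (h1 a b a' b').trans ?_
      have : 0 ≤ ‖y - x‖ * (|a| + |b|) := by positivity
      exact mul_le_mul_of_nonneg_left (by linarith) hL)
  refine ⟨f, hf, mem_H1muDirichlet_iff.2 ⟨hfm, ?_⟩⟩
  rw [hf]
  exact hq

lemma abs_min_sub_min_zero_le (a b : ℝ) : |min a 0 - min b 0| ≤ |a - b| := by
  simpa using abs_min_sub_min_le_max a 0 b 0

lemma abs_max_sub_max_zero_le (a b : ℝ) : |max a 0 - max b 0| ≤ |a - b| := by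
  simpa using abs_max_sub_max_le_max a 0 b 0

lemma min_zero_diff_sq_le (a b : ℝ) :
    (min b 0 - min a 0) * (min b 0 - min a 0) ≤ (b - a) * (min b 0 - min a 0) := by
  rcases le_total a 0 with h1 | h1 <;> rcases le_total b 0 with h2 | h2 <;>
    simp only [min_eq_left, min_eq_right, h1, h2] <;> nlinarith

lemma max_zero_diff_sq_le (a b : ℝ) :
    (max b 0 - max a 0) * (max b 0 - max a 0) ≤ (b - a) * (max b 0 - max a 0) := by
  rcases le_total a 0 with h1 | h1 <;> rcases le_total b 0 with h2 | h2 <;>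
    simp only [max_eq_left, max_eq_right, h1, h2] <;> nlinarith

lemma H1.integral_grad_self_nonneg (u : H1 N) : 0 ≤ ∫ x, ⟪u.grad x, u.grad x⟫ :=
  integral_nonneg fun _ => real_inner_self_nonneg

/-- Testing with `min u 0` leaves nonnegative terms on the left and a nonpositive one on the right.
The conclusion is needed quasi-everywhere, for integrals against `μ` and for the boundary values in
`IsWeakSolution.ae_mono`. -/
lemma IsWeakSolution.qe_nonneg (hμ : IsCapacitary μ) {u : H1 N}
    (hu : IsWeakSolution μ Ω (fun _ => 1) u) : ∀ᵐ x ∂capOuter N, 0 ≤ u.toFun x := by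
  obtain ⟨hum, hu0⟩ := mem_H1muDirichlet_iff.1 hu.1
  obtain ⟨m, hm, hmV⟩ := exists_mem_H1muDirichlet_comp (Ω := Ω) hμ hum hum
    (Ψ := fun a _ => min a 0) (by fun_prop) 1 zero_le_one (by simp)
    (fun a b a' b' => by
      have := abs_min_sub_min_zero_le a' a
      have := abs_nonneg (b' - b)
      linarith)
    (by filter_upwards [hu0] with x hx hxΩ; simp [hx hxΩ])
  have h1 := hu.eq hmV
  have h2 := H1.integral_grad_inner_mono u m m m fun s => Eventually.of_forall fun x => by
    simp only [hm]
    exact min_zero_diff_sq_le _ _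
  have h3 : ∀ x, u.toFun x * m.toFun x = m.toFun x * m.toFun x := by
    intro x
    simp only [hm]
    rcases le_total (u.toFun x) 0 with h | h <;> simp [h]
  have h4 : ∫ x, m.toFun x ≤ 0 := integral_nonpos fun x => by simp [hm]
  have h5 : 0 ≤ ∫ x, m.toFun x * m.toFun x ∂μ := integral_nonneg fun x => mul_self_nonneg _
  simp only [h3] at h1
  have h6 := m.integral_grad_self_nonneg
  have h7 := qe_eq_zero_of_ae (mem_H1mu_iff.1 (mem_H1muDirichlet_iff.1 hmV).1).1
    (H1.ae_eq_zero_of_integral_sq_nonpos (f := m) (by linarith))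
  filter_upwards [h7] with x hx
  simpa [hm] using hx

/-- The constant `1` is a supersolution: test with `(u - 1)₊`. Finite volume makes this function
integrable, so that its integral cancels from both sides. -/
lemma IsWeakSolution.ae_le_one (hμ : IsCapacitary μ) (hΩ : volume Ω ≠ ⊤) {u : H1 N}
    (hu : IsWeakSolution μ Ω (fun _ => 1) u) : ∀ᵐ x, u.toFun x ≤ 1 := by
  obtain ⟨hum, hu0⟩ := mem_H1muDirichlet_iff.1 hu.1
  obtain ⟨m, hm, hmV⟩ := exists_mem_H1muDirichlet_comp (Ω := Ω) hμ hum hum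
    (Ψ := fun a _ => max (a - 1) 0) (by fun_prop) 1 zero_le_one (by simp)
    (fun a b a' b' => by
      have := abs_max_sub_max_zero_le (a' - 1) (a - 1)
      have := abs_nonneg (b' - b)
      rw [show a' - 1 - (a - 1) = a' - a by ring] at *
      linarith)
    (by filter_upwards [hu0] with x hx hxΩ; simp [hx hxΩ])
  have h1 := hu.eq hmV
  have h2 := H1.integral_grad_inner_mono u m m m fun s => Eventually.of_forall fun x => by
    simp only [hm]
    convert max_zero_diff_sq_le (u.toFun x - 1) (u.toFun (x + s) - 1) using 2
    ring
  have h3 : ∀ x, u.toFun x * m.toFun x = m.toFun x + m.toFun x * m.toFun x := by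
    intro x
    simp only [hm]
    rcases le_total (u.toFun x - 1) 0 with h | h
    · simp [h]
    · simp only [max_eq_left h]; ring
  have hm0 : ∀ x, 0 ≤ m.toFun x := fun x => by simp [hm]
  have h5 : 0 ≤ ∫ x, u.toFun x * m.toFun x ∂μ := integral_nonneg fun x => by
    simp only [h3]; exact add_nonneg (hm0 x) (mul_self_nonneg _)
  have hmi : Integrable m.toFun volume := by
    refine IntegrableOn.integrable_of_ae_notMem_eq_zero (s := Ω) ?_
      (ae_of_qe (mem_H1muDirichlet_iff.1 hmV).2)
    have : IsFiniteMeasure (volume.restrict Ω) := ⟨by simpa using hΩ.lt_top⟩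
    exact (m.memLp_toFun.restrict Ω).integrable (by norm_num)
  have h6 : ∫ x, u.toFun x * m.toFun x =
      (∫ x, m.toFun x) + ∫ x, m.toFun x * m.toFun x := by
    simp only [h3]
    exact integral_add hmi (m.memLp_toFun.integrable_mul m.memLp_toFun)
  have h7 := m.integral_grad_self_nonneg
  filter_upwards [H1.ae_eq_zero_of_integral_sq_nonpos (f := m) (by linarith)] with x hx
  simpa [hm] using hx

/-- Both equations may be tested with `(u - v)₊`, which vanishes outside `Ω` because `u = 0 ≤ v`
there; subtracting them forces it to be zero. -/
lemma IsWeakSolution.ae_mono (hμ : IsCapacitary μ) (hΩ : Ω ⊆ Ω') {u v : H1 N}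
    (hu : IsWeakSolution μ Ω (fun _ => 1) u) (hv : IsWeakSolution μ Ω' (fun _ => 1) v) :
    ∀ᵐ x, u.toFun x ≤ v.toFun x := by
  obtain ⟨hum, hu0⟩ := mem_H1muDirichlet_iff.1 hu.1
  obtain ⟨hvm, hv0⟩ := mem_H1muDirichlet_iff.1 hv.1
  obtain ⟨m, hm, hmV⟩ := exists_mem_H1muDirichlet_comp (Ω := Ω) hμ hum hvm
    (Ψ := fun a b => max (a - b) 0) (by fun_prop) 1 zero_le_one (by simp)
    (fun a b a' b' => by
      have h1 := abs_max_sub_max_zero_le (a' - b') (a - b)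
      have h2 := abs_sub (a' - a) (b' - b)
      rw [show a' - b' - (a - b) = a' - a - (b' - b) by ring] at h1
      linarith)
    (by filter_upwards [hu0, hv.qe_nonneg hμ] with x hx h hxΩ; simp [hx hxΩ, h])
  have hmV' : m ∈ H1muDirichlet μ Ω' := by
    rw [mem_H1muDirichlet_iff] at hmV ⊢
    refine ⟨hmV.1, ?_⟩
    filter_upwards [hmV.2] with x hx h using hx fun h' => h (hΩ h')
  have h1 := hu.eq hmV
  have h1' := hv.eq hmV'
  set d := H1.lin 1 u (-1) v with hd
  have hdx : ∀ x, d.toFun x = u.toFun x - v.toFun x := fun x => by simp [hd, H1.lin]; ring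
  have h2 := H1.integral_grad_inner_mono d m m m fun s => Eventually.of_forall fun x => by
    simp only [hm, hdx]
    exact max_zero_diff_sq_le _ _
  have h3 : ∀ x, u.toFun x * m.toFun x - v.toFun x * m.toFun x = m.toFun x * m.toFun x := by
    intro x
    simp only [hm]
    rcases le_total (u.toFun x - v.toFun x) 0 with h | h
    · simp [h]
    · simp only [max_eq_left h]; ring
  have g1 : ∫ x, ⟪d.grad x, m.grad x⟫ =
      (∫ x, ⟪u.grad x, m.grad x⟫) - ∫ x, ⟪v.grad x, m.grad x⟫ := by
    rw [← integral_sub (u.integrable_grad_inner m) (v.integrable_grad_inner m)]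
    simp [hd, H1.lin, inner_add_left, sub_eq_add_neg]
  have g2 : ∫ x, m.toFun x * m.toFun x =
      (∫ x, u.toFun x * m.toFun x) - ∫ x, v.toFun x * m.toFun x := by
    rw [← integral_sub (integrable_mul_of_memLp_two u.memLp_toFun m.memLp_toFun)
      (integrable_mul_of_memLp_two v.memLp_toFun m.memLp_toFun)]
    exact integral_congr_ae (Eventually.of_forall fun x => (h3 x).symm)
  have g3 : ∫ x, m.toFun x * m.toFun x ∂μ =
      (∫ x, u.toFun x * m.toFun x ∂μ) - ∫ x, v.toFun x * m.toFun x ∂μ := by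
    have hm2 := memLp_of_mem_H1mu hμ (mem_H1muDirichlet_iff.1 hmV).1
    rw [← integral_sub (integrable_mul_of_memLp_two (memLp_of_mem_H1mu hμ hum) hm2)
      (integrable_mul_of_memLp_two (memLp_of_mem_H1mu hμ hvm) hm2)]
    exact integral_congr_ae (Eventually.of_forall fun x => (h3 x).symm)
  have g4 : 0 ≤ ∫ x, m.toFun x * m.toFun x ∂μ := integral_nonneg fun x => mul_self_nonneg _
  have g5 := m.integral_grad_self_nonneg
  filter_upwards [H1.ae_eq_zero_of_integral_sq_nonpos (f := m) (by linarith)] with x hx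
  simpa [hm] using hx

lemma exists_isTorsionLimit (hμ : IsCapacitary μ) : ∃ w : Eucl N → ℝ, IsTorsionLimit μ w := by
  choose u hu using fun R : ℝ => exists_isWeakSolution (Ω := Metric.ball (0 : Eucl N) R) hμ
    Metric.isOpen_ball.measurableSet measure_ball_lt_top.ne
  have hmono : ∀ {R S : ℝ}, R ≤ S → ∀ᵐ x, (u R).toFun x ≤ (u S).toFun x := fun h =>
    (hu _).ae_mono hμ (Metric.ball_subset_ball h) (hu _)
  refine ⟨fun x => ⨆ k : ℕ, (u k).toFun x, u, fun R _ => hu R, fun R hR => ?_⟩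
  have h1 : ∀ᵐ x, ∀ k : ℕ, (u k).toFun x ≤ (u (k + 1 : ℕ)).toFun x :=
    ae_all_iff.2 fun k => hmono (by simp)
  have h2 : ∀ᵐ x, ∀ k : ℕ, (u k).toFun x ≤ 1 :=
    ae_all_iff.2 fun k => (hu k).ae_le_one hμ measure_ball_lt_top.ne
  -- The radii are sandwiched between consecutive integers, so only countably many almost everywhere
  -- comparisons are involved.
  have h3 : ∀ᵐ x, ∀ n, 0 ≤ R n → (u ⌊R n⌋₊).toFun x ≤ (u (R n)).toFun x := by
    refine ae_all_iff.2 fun n => ?_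
    by_cases hn : 0 ≤ R n
    · filter_upwards [hmono (Nat.floor_le hn)] with x hx _ using hx
    · exact Eventually.of_forall fun x h => absurd h hn
  have h4 : ∀ᵐ x, ∀ n, (u (R n)).toFun x ≤ (u ⌈R n⌉₊).toFun x :=
    ae_all_iff.2 fun n => hmono (Nat.le_ceil _)
  filter_upwards [h1, h2, h3, h4] with x y1 y2 y3 y4
  have hlim : Tendsto (fun k : ℕ => (u k).toFun x) atTop (𝓝 (⨆ k : ℕ, (u k).toFun x)) :=
    tendsto_atTop_ciSup (monotone_nat_of_le_succ y1) ⟨1, by rintro _ ⟨k, rfl⟩; exact y2 k⟩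
  refine tendsto_of_tendsto_of_tendsto_of_le_of_le'
    (hlim.comp (tendsto_nat_floor_atTop.comp hR)) (hlim.comp (tendsto_nat_ceil_atTop.comp hR)) ?_ ?_
  · filter_upwards [hR.eventually_ge_atTop 0] with n hn
    exact y3 n hn
  · exact Eventually.of_forall y4

end Comparison

/-! ### The Hardy inequality with weight `1 / w` and the tail estimate. -/

section Hardy

variable {N : ℕ} {μ : Measure (Eucl N)} {Ω : Set (Eucl N)}

/-- The quadratic form `∫ |∇u|² + u² dx + ∫ u² dμ`. -/
def H1.form (μ : Measure (Eucl N)) (u : H1 N) : ℝ :=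
  (∫ x, ⟪u.grad x, u.grad x⟫) + (∫ x, u.toFun x * u.toFun x) + ∫ x, u.toFun x * u.toFun x ∂μ

lemma normSq_eq_ofReal (hμ : IsCapacitary μ) {u : H1 N} (hu : u ∈ H1mu μ) :
    normSq μ u = ENNReal.ofReal (u.form μ) := by
  have : normSq μ u = u.energy + ∫⁻ x, ‖u.toFun x‖ₑ ^ 2 ∂μ := rfl
  rw [this, H1.energy_eq_ofReal, lintegral_enorm_sq_eq_ofReal (memLp_of_mem_H1mu hμ hu),
    ← ENNReal.ofReal_add, H1.form]
  · exact add_nonneg u.integral_grad_self_nonneg (integral_nonneg fun x => mul_self_nonneg _)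
  · exact integral_nonneg fun x => mul_self_nonneg _

/-- Truncation of a real number to `[-k, k]`. -/
def clamp (k a : ℝ) : ℝ := max (-k) (min a k)

@[fun_prop]
lemma continuous_clamp (k : ℝ) : Continuous (clamp k) := by unfold clamp; fun_prop

lemma abs_clamp_sub_le (k a b : ℝ) : |clamp k a - clamp k b| ≤ |a - b| := by
  unfold clamp
  refine (abs_max_sub_max_le_max _ _ _ _).trans ?_
  rw [sub_self, abs_zero, max_eq_right (abs_nonneg _)]
  simpa using abs_min_sub_min_le_max a k b k

lemma abs_clamp_le {k : ℝ} (hk : 0 ≤ k) (a : ℝ) : |clamp k a| ≤ k := by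
  rw [abs_le]
  exact ⟨le_max_left _ _, max_le (by linarith) (min_le_right _ _)⟩

lemma clamp_of_abs_le {k a : ℝ} (h : |a| ≤ k) : clamp k a = a := by
  rw [abs_le] at h
  rw [clamp, min_eq_left h.2, max_eq_right h.1]

lemma clamp_zero {k : ℝ} (hk : 0 ≤ k) : clamp k 0 = 0 := clamp_of_abs_le (by simpa using hk)

lemma abs_clamp_le_abs {k : ℝ} (hk : 0 ≤ k) (a : ℝ) : |clamp k a| ≤ |a| := by
  simpa [clamp_zero hk] using abs_clamp_sub_le k a 0

/-- The discrete Picone inequality. -/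
lemma picone {a b : ℝ} (ha : 0 < a) (hb : 0 < b) (s t : ℝ) :
    (a - b) * (s ^ 2 / a - t ^ 2 / b) ≤ (s - t) * (s - t) := by
  have h : (s - t) * (s - t) - (a - b) * (s ^ 2 / a - t ^ 2 / b) = (s * b - t * a) ^ 2 / (a * b) := by
    field_simp
    ring
  have : 0 ≤ (s * b - t * a) ^ 2 / (a * b) := by positivity
  linarith

lemma abs_sq_div_sub_le {c c' p p' k δ : ℝ} (hδ : 0 < δ) (hp : δ ≤ p) (hp' : δ ≤ p')
    (hc : |c| ≤ k) (hc' : |c'| ≤ k) :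
    |c' ^ 2 / p' - c ^ 2 / p| ≤ (2 * k / δ + k ^ 2 / δ ^ 2) * (|c' - c| + |p' - p|) := by
  have hk : 0 ≤ k := (abs_nonneg c).trans hc
  have h0 : 0 < p := hδ.trans_le hp
  have h0' : 0 < p' := hδ.trans_le hp'
  have e : c' ^ 2 / p' - c ^ 2 / p = (c' + c) * (c' - c) / p' - c ^ 2 * (p' - p) / (p * p') := by
    field_simp
    ring
  rw [e]
  refine (abs_sub _ _).trans ?_
  rw [abs_div, abs_div, abs_mul, abs_mul, abs_of_pos h0', abs_of_pos (mul_pos h0 h0'),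
    abs_of_nonneg (sq_nonneg c)]
  have h1 : |c' + c| * |c' - c| / p' ≤ 2 * k / δ * |c' - c| := by
    rw [div_mul_eq_mul_div]
    have : |c' + c| ≤ 2 * k := (abs_add_le _ _).trans (by linarith)
    gcongr
  have h2 : c ^ 2 * |p' - p| / (p * p') ≤ k ^ 2 / δ ^ 2 * |p' - p| := by
    rw [div_mul_eq_mul_div, sq δ]
    have : c ^ 2 ≤ k ^ 2 := by rw [← sq_abs]; gcongr
    gcongr
  have h3 : 0 ≤ 2 * k / δ := by positivity
  have h4 : 0 ≤ k ^ 2 / δ ^ 2 := by positivity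
  nlinarith [abs_nonneg (c' - c), abs_nonneg (p' - p), mul_nonneg h3 (abs_nonneg (p' - p)),
    mul_nonneg h4 (abs_nonneg (c' - c))]

/-- The equation is tested with `φ = u² / (w + δ)`: Picone's inequality gives `∫ ∇w·∇φ ≤ ∫ |∇u|²`,
and `w φ ≤ u²` handles the other two terms. -/
lemma IsWeakSolution.integral_div_le (hμ : IsCapacitary μ) {w : H1 N}
    (hw : IsWeakSolution μ Ω (fun _ => 1) w) (hΩ : volume Ω ≠ ⊤) {u : H1 N}
    (hu : u ∈ H1muDirichlet μ Ω) {k : ℝ} (hk : 0 ≤ k)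
    (huk : ∀ x, |u.toFun x| ≤ k) {δ : ℝ} (hδ : 0 < δ) :
    Integrable (fun x => u.toFun x ^ 2 / (max (w.toFun x) 0 + δ)) volume ∧
    ∫ x, u.toFun x ^ 2 / (max (w.toFun x) 0 + δ) ≤ u.form μ := by
  obtain ⟨hum, hu0⟩ := mem_H1muDirichlet_iff.1 hu
  obtain ⟨hwm, hw0⟩ := mem_H1muDirichlet_iff.1 hw.1
  have hp : ∀ b : ℝ, δ ≤ max b 0 + δ := fun b => by simp
  have hp0 : ∀ b : ℝ, 0 < max b 0 + δ := fun b => hδ.trans_le (hp b)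
  -- `clamp k` and `max b 0` make the composition globally Lipschitz; they are inert because `|u| ≤
  -- k` and `w ≥ 0` quasi-everywhere.
  obtain ⟨φ, hφ, hφV⟩ := exists_mem_H1muDirichlet_comp (Ω := Ω) hμ hum hwm
    (Ψ := fun a b => clamp k a ^ 2 / (max b 0 + δ))
    (((continuous_clamp k).comp continuous_fst).pow 2 |>.div (by fun_prop)
      fun z => (hp0 z.2).ne') (2 * k / δ + k ^ 2 / δ ^ 2) (by positivity) (by simp [clamp_zero hk])
    (fun a b a' b' => by
      refine (abs_sq_div_sub_le hδ (hp b) (hp b') (abs_clamp_le hk a) (abs_clamp_le hk a')).trans ?_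
      have h1 := abs_clamp_sub_le k a' a
      have h2 := abs_max_sub_max_zero_le b' b
      rw [add_sub_add_right_eq_sub]
      gcongr)
    (by filter_upwards [hu0] with x hx hxΩ; simp [hx hxΩ, clamp_zero hk])
  have hφ' : φ.toFun = fun x => u.toFun x ^ 2 / (max (w.toFun x) 0 + δ) := by
    rw [hφ]; funext x; rw [clamp_of_abs_le (huk x)]
  have h1 := hw.eq hφV
  have hnn := hw.qe_nonneg hμ
  have h2 := H1.integral_grad_inner_mono u u w φ fun s => by
    filter_upwards [ae_of_qe hnn, ae_comp_add (ae_of_qe hnn) s] with x y1 y2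
    simp only [hφ', max_eq_left y1, max_eq_left y2]
    have := picone (a := w.toFun (x + s) + δ) (b := w.toFun x + δ) (by linarith) (by linarith)
      (u.toFun (x + s)) (u.toFun x)
    rwa [add_sub_add_right_eq_sub] at this
  have h3 : ∀ x, 0 ≤ w.toFun x → w.toFun x * φ.toFun x ≤ u.toFun x * u.toFun x := by
    intro x hx
    simp only [hφ', max_eq_left hx]
    rw [mul_div_assoc', div_le_iff₀ (by linarith)]
    nlinarith [sq_nonneg (u.toFun x), mul_nonneg hδ.le (sq_nonneg (u.toFun x))]
  have h4 : ∫ x, w.toFun x * φ.toFun x ≤ ∫ x, u.toFun x * u.toFun x :=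
    integral_mono_ae (integrable_mul_of_memLp_two w.memLp_toFun φ.memLp_toFun)
      (integrable_mul_of_memLp_two u.memLp_toFun u.memLp_toFun)
      (by filter_upwards [ae_of_qe hnn] with x hx using h3 x hx)
  have h5 : ∫ x, w.toFun x * φ.toFun x ∂μ ≤ ∫ x, u.toFun x * u.toFun x ∂μ :=
    integral_mono_ae (integrable_mul_of_memLp_two (memLp_of_mem_H1mu hμ hwm)
      (memLp_of_mem_H1mu hμ (mem_H1muDirichlet_iff.1 hφV).1))
      (integrable_mul_of_memLp_two (memLp_of_mem_H1mu hμ hum) (memLp_of_mem_H1mu hμ hum))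
      (by filter_upwards [hμ.ae_of_qe hnn] with x hx using h3 x hx)
  have hφi : Integrable φ.toFun volume := by
    refine IntegrableOn.integrable_of_ae_notMem_eq_zero (s := Ω) ?_
      (ae_of_qe (mem_H1muDirichlet_iff.1 hφV).2)
    have : IsFiniteMeasure (volume.restrict Ω) := ⟨by simpa using hΩ.lt_top⟩
    exact (φ.memLp_toFun.restrict Ω).integrable (by norm_num)
  rw [← hφ']
  refine ⟨hφi, ?_⟩
  rw [H1.form, ← h1]
  linarith

/-- The Lipschitz cutoff `(1 - |x| / R)₊`. -/
def tent (R : ℝ) (x : Eucl N) : ℝ := max (1 - ‖x‖ / R) 0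

lemma tent_nonneg (R : ℝ) (x : Eucl N) : 0 ≤ tent R x := le_max_right _ _

lemma tent_le_one {R : ℝ} (hR : 0 < R) (x : Eucl N) : tent R x ≤ 1 :=
  max_le (by have : 0 ≤ ‖x‖ / R := by positivity
             linarith) zero_le_one

lemma abs_tent_sub_le {R : ℝ} (hR : 1 ≤ R) (x y : Eucl N) : |tent R y - tent R x| ≤ ‖y - x‖ := by
  refine (abs_max_sub_max_zero_le _ _).trans ?_
  have h0 : 0 < R := by linarith
  rw [show 1 - ‖y‖ / R - (1 - ‖x‖ / R) = -((‖y‖ - ‖x‖) / R) by ring, abs_neg, abs_div,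
    abs_of_pos h0, div_le_iff₀ h0]
  have h1 := abs_norm_sub_norm_le y x
  nlinarith [norm_nonneg (y - x)]

lemma abs_mul_clamp_sub_le {k e e' s a a' : ℝ} (hk : 0 ≤ k) (he' : 0 ≤ e') (he1' : e' ≤ 1)
    (hs : |e' - e| ≤ s) :
    |e' * clamp k a' - e * clamp k a| ≤ |a' - a| + s * |a| := by
  have h : e' * clamp k a' - e * clamp k a =
    e' * (clamp k a' - clamp k a) + (e' - e) * clamp k a := by ring
  rw [h]
  refine (abs_add_le _ _).trans ?_
  rw [abs_mul, abs_mul, abs_of_nonneg he']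
  have h1 := abs_clamp_sub_le k a' a
  have h2 := abs_clamp_le_abs hk a
  have h3 : e' * |clamp k a' - clamp k a| ≤ 1 * |a' - a| := by gcongr
  have h4 : |e' - e| * |clamp k a| ≤ s * |a| := by
    gcongr
    exact (abs_nonneg _).trans hs
  linarith

/-- Reduces general `u` to bounded functions vanishing outside a ball. The tent has Lipschitz
constant at most `1`, so each of the `N` directions contributes an error `2 u²` to the gradient term
`2 |∇u|²`. -/
lemma exists_cutoff (hμ : IsCapacitary μ) {u : H1 N} (hu : u ∈ H1mu μ) {k R : ℝ} (hk : 0 ≤ k)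
    (hR : 1 ≤ R) : ∃ f : H1 N, f.toFun = (fun x => tent R x * clamp k (u.toFun x)) ∧
      f ∈ H1muDirichlet μ (Metric.ball 0 R) ∧ f.form μ ≤ (2 + 2 * N) * u.form μ := by
  have hR0 : 0 < R := by linarith
  have hle : ∀ (x : Eucl N) (a : ℝ), |tent R x * clamp k a| ≤ |a| := by
    intro x a
    rw [abs_mul, abs_of_nonneg (tent_nonneg R x)]
    nlinarith [abs_clamp_le_abs hk a, tent_le_one hR0 x, tent_nonneg R x, abs_nonneg (clamp k a)]
  have hct : Continuous (tent R : Eucl N → ℝ) := by unfold tent; fun_prop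
  obtain ⟨f, hf, hfm⟩ := exists_mem_H1mu_comp hμ hu hu
    (Φ := fun x a _ => tent R x * clamp k a) (L := 1)
    ((hct.comp continuous_fst).mul ((continuous_clamp k).comp (continuous_snd.fst)))
    (fun x a b => (hle x a).trans (by linarith [abs_nonneg b]))
    (fun x y a b a' b' => by
      refine (abs_mul_clamp_sub_le hk (tent_nonneg R y) (tent_le_one hR0 y)
        (abs_tent_sub_le hR x y)).trans ?_
      have := mul_nonneg (norm_nonneg (y - x)) (abs_nonneg b)
      linarith [abs_nonneg (b' - b)])
  refine ⟨f, hf, mem_H1muDirichlet_iff.2 ⟨hfm, Eventually.of_forall fun x hx => ?_⟩, ?_⟩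
  · have : tent R x = 0 := by
      rw [tent, max_eq_right]
      rw [Metric.mem_ball, dist_zero_right, not_lt] at hx
      rw [sub_nonpos, one_le_div hR0]
      exact hx
    simp [hf, this]
  -- Pairing `u` with `2u` encodes the factor in `(a + b)² ≤ 2 a² + 2 b²`.
  · have h1 := H1.integral_grad_inner_le u (H1.lin 2 u 0 u) f f
      (κ := fun x => 2 * (u.toFun x * u.toFun x))
      ((integrable_mul_of_memLp_two u.memLp_toFun u.memLp_toFun).const_mul 2) fun j =>
        Eventually.of_forall fun t => Eventually.of_forall fun x => by
          have h2 := abs_mul_clamp_sub_le hk (a := u.toFun x) (a' := u.toFun (x + t • stdVec j))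
            (tent_nonneg R (x + t • stdVec j)) (tent_le_one hR0 _)
            (abs_tent_sub_le hR x (x + t • stdVec j))
          rw [add_sub_cancel_left, norm_smul, norm_stdVec, mul_one, Real.norm_eq_abs] at h2
          simp only [hf, H1.lin]
          rw [← sq, ← sq_abs]
          calc _ ≤ (|u.toFun (x + t • stdVec j) - u.toFun x| + |t| * |u.toFun x|) ^ 2 := by gcongr
            _ ≤ 2 * |u.toFun (x + t • stdVec j) - u.toFun x| ^ 2 + 2 * (|t| * |u.toFun x|) ^ 2 := by
              nlinarith [sq_nonneg (|u.toFun (x + t • stdVec j) - u.toFun x| - |t| * |u.toFun x|)]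
            _ = _ := by rw [mul_pow, sq_abs, sq_abs, sq_abs]; ring
    have e1 : ∫ x, ⟪u.grad x, (H1.lin 2 u 0 u).grad x⟫ = 2 * ∫ x, ⟪u.grad x, u.grad x⟫ := by
      rw [← integral_const_mul]
      simp [H1.lin, real_inner_smul_right]
    have hsq : ∀ x, f.toFun x * f.toFun x ≤ u.toFun x * u.toFun x := by
      intro x
      rw [← abs_le_iff_mul_self_le]
      simp only [hf]
      exact hle _ _
    have h3 : ∫ x, f.toFun x * f.toFun x ≤ ∫ x, u.toFun x * u.toFun x :=
      integral_mono (integrable_mul_of_memLp_two f.memLp_toFun f.memLp_toFun)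
        (integrable_mul_of_memLp_two u.memLp_toFun u.memLp_toFun) hsq
    have h4 : ∫ x, f.toFun x * f.toFun x ∂μ ≤ ∫ x, u.toFun x * u.toFun x ∂μ :=
      integral_mono (integrable_mul_of_memLp_two (memLp_of_mem_H1mu hμ hfm)
        (memLp_of_mem_H1mu hμ hfm))
        (integrable_mul_of_memLp_two (memLp_of_mem_H1mu hμ hu) (memLp_of_mem_H1mu hμ hu)) hsq
    rw [e1, integral_const_mul] at h1
    have g1 := u.integral_grad_self_nonneg
    have g2 : 0 ≤ ∫ x, u.toFun x * u.toFun x := integral_nonneg fun x => mul_self_nonneg _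
    have g3 : 0 ≤ ∫ x, u.toFun x * u.toFun x ∂μ := integral_nonneg fun x => mul_self_nonneg _
    have hN : (0 : ℝ) ≤ N := Nat.cast_nonneg N
    rw [H1.form, H1.form]
    nlinarith [mul_nonneg hN g1, mul_nonneg hN g2, mul_nonneg hN g3]

/-- Where `w ≤ ε` one has `f² ≤ 2 ε f² / (w + ε)`, so the Hardy inequality with `δ = ε` bounds the
tail of each cutoff `f` of `u`; Fatou's lemma removes the cutoff. -/
lemma lintegral_tail_le (hμ : IsCapacitary μ) {ε ρ : ℝ} (hε : 0 < ε)
    (hw : ∀ n : ℕ, ∃ w : H1 N, IsWeakSolution μ (Metric.ball 0 (n + 1 : ℝ)) (fun _ => 1) w ∧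
      ∀ᵐ x, x ∉ Metric.ball (0 : Eucl N) ρ → w.toFun x ≤ ε)
    {u : H1 N} (hu : u ∈ H1mu μ) :
    ∫⁻ x in (Metric.ball (0 : Eucl N) ρ)ᶜ, ‖u.toFun x‖ₑ ^ 2 ≤
      ENNReal.ofReal (2 * ε * (2 + 2 * N)) * normSq μ u := by
  have hb : ∀ n : ℕ, ∫⁻ x in (Metric.ball (0 : Eucl N) ρ)ᶜ,
      ‖tent (n + 1 : ℝ) x * clamp n (u.toFun x)‖ₑ ^ 2 ≤
        ENNReal.ofReal (2 * ε * (2 + 2 * N)) * normSq μ u := by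
    intro n
    obtain ⟨f, hf, hfV, hfQ⟩ := exists_cutoff hμ hu (k := n) (R := n + 1) (by positivity) (by simp)
    obtain ⟨w, hws, hwε⟩ := hw n
    have hfn : ∀ x, |f.toFun x| ≤ n := by
      intro x
      rw [hf, abs_mul, abs_of_nonneg (tent_nonneg _ _)]
      have h1 := abs_clamp_le (k := n) (by positivity) (u.toFun x)
      have h2 := tent_le_one (R := (n + 1 : ℝ)) (by positivity) x
      nlinarith [tent_nonneg (n + 1 : ℝ) x, abs_nonneg (clamp n (u.toFun x))]
    obtain ⟨hi, hle⟩ := hws.integral_div_le hμ measure_ball_lt_top.ne hfV (k := n)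
      (by positivity) hfn hε
    rw [normSq_eq_ofReal hμ hu, ← ENNReal.ofReal_mul (by positivity)]
    calc _ ≤ ∫⁻ x in (Metric.ball (0 : Eucl N) ρ)ᶜ,
          ENNReal.ofReal (2 * ε * (f.toFun x ^ 2 / (max (w.toFun x) 0 + ε))) := by
          refine lintegral_mono_ae ((ae_restrict_iff' Metric.isOpen_ball.measurableSet.compl).2 ?_)
          filter_upwards [hwε] with x hx hxρ
          rw [Real.enorm_eq_ofReal_abs, ← ENNReal.ofReal_pow (abs_nonneg _), sq_abs,
            show tent (n + 1 : ℝ) x * clamp n (u.toFun x) = f.toFun x by rw [hf]]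
          refine ENNReal.ofReal_le_ofReal ?_
          have h1 : max (w.toFun x) 0 ≤ ε := max_le (hx hxρ) hε.le
          have h2 : 0 ≤ max (w.toFun x) 0 := le_max_right _ _
          rw [mul_div_assoc', le_div_iff₀ (by positivity)]
          nlinarith [sq_nonneg (f.toFun x)]
      _ ≤ ∫⁻ x, ENNReal.ofReal (2 * ε * (f.toFun x ^ 2 / (max (w.toFun x) 0 + ε))) :=
          setLIntegral_le_lintegral _ _
      _ = ENNReal.ofReal (∫ x, 2 * ε * (f.toFun x ^ 2 / (max (w.toFun x) 0 + ε))) := by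
          rw [ofReal_integral_eq_lintegral_ofReal (hi.const_mul _)]
          refine Eventually.of_forall fun x => ?_
          have h2 : 0 ≤ max (w.toFun x) 0 := le_max_right _ _
          exact mul_nonneg (by positivity) (div_nonneg (sq_nonneg _) (by positivity))
      _ ≤ _ := by
          refine ENNReal.ofReal_le_ofReal ?_
          rw [integral_const_mul, mul_assoc (2 * ε)]
          exact mul_le_mul_of_nonneg_left (hle.trans hfQ) (by positivity)
  have hlim : ∀ x, Tendsto (fun n : ℕ => ‖tent (n + 1 : ℝ) x * clamp n (u.toFun x)‖ₑ ^ 2) atTop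
      (𝓝 (‖u.toFun x‖ₑ ^ 2)) := by
    intro x
    refine ((ENNReal.continuous_pow 2).tendsto _).comp ((continuous_enorm.tendsto _).comp ?_)
    have h1 : Tendsto (fun n : ℕ => clamp n (u.toFun x)) atTop (𝓝 (u.toFun x)) := by
      refine tendsto_const_nhds.congr' ?_
      filter_upwards [eventually_ge_atTop ⌈|u.toFun x|⌉₊] with n hn
      exact (clamp_of_abs_le (Nat.ceil_le.1 hn)).symm
    have h2 : Tendsto (fun n : ℕ => tent (n + 1 : ℝ) x) atTop (𝓝 1) := by
      have h3 : Tendsto (fun n : ℕ => ‖x‖ / (n + 1 : ℝ)) atTop (𝓝 0) :=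
        tendsto_const_nhds.div_atTop
          (tendsto_atTop_add_const_right _ _ tendsto_natCast_atTop_atTop)
      have := (h3.const_sub 1).max (tendsto_const_nhds (x := (0 : ℝ)))
      simpa [tent] using this
    simpa using h2.mul h1
  calc _ = ∫⁻ x in (Metric.ball (0 : Eucl N) ρ)ᶜ,
        liminf (fun n : ℕ => ‖tent (n + 1 : ℝ) x * clamp n (u.toFun x)‖ₑ ^ 2) atTop :=
        lintegral_congr fun x => (hlim x).liminf_eq.symm
    _ ≤ liminf (fun n : ℕ => ∫⁻ x in (Metric.ball (0 : Eucl N) ρ)ᶜ,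
          ‖tent (n + 1 : ℝ) x * clamp n (u.toFun x)‖ₑ ^ 2) atTop := by
        refine lintegral_liminf_le' fun n => ?_
        obtain ⟨f, hf, -, -⟩ := exists_cutoff hμ hu (k := n) (R := n + 1) (by positivity) (by simp)
        have := (f.memLp_toFun.1.enorm.pow_const 2).restrict (s := (Metric.ball (0 : Eucl N) ρ)ᶜ)
        rwa [hf] at this
    _ ≤ _ := by
        refine (liminf_le_liminf (Eventually.of_forall hb)).trans ?_
        simp

end Hardy

/-! ### Rellich–Kolmogorov compactness through local averages. -/

section Rellich

variable {N : ℕ}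

/-- The uniform probability measure on the ball of radius `r`. -/
def ballMeasure (N : ℕ) (r : ℝ) : Measure (Eucl N) :=
  ProbabilityTheory.cond volume (Metric.ball 0 r)

lemma isProbabilityMeasure_ballMeasure {r : ℝ} (hr : 0 < r) :
    IsProbabilityMeasure (ballMeasure N r) :=
  ProbabilityTheory.cond_isProbabilityMeasure_of_finite (Metric.measure_ball_pos _ _ hr).ne'
    measure_ball_lt_top.ne

lemma ballMeasure_ac (r : ℝ) : ballMeasure N r ≪ volume :=
  ProbabilityTheory.cond_absolutelyContinuous

lemma ae_ballMeasure_mem (r : ℝ) : ∀ᵐ h ∂ballMeasure N r, h ∈ Metric.ball (0 : Eucl N) r :=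
  ProbabilityTheory.ae_cond_mem Metric.isOpen_ball.measurableSet

/-- The average of `f` over the ball of radius `r` around a point. -/
def avg (r : ℝ) (f : Eucl N → ℝ) (x : Eucl N) : ℝ := ∫ h, f (x + h) ∂ballMeasure N r

/-- As a pairing with an `L²` function, the average at each point passes to weak limits. -/
lemma avg_eq_inner {r : ℝ} {f : Eucl N → ℝ} (hf : MemLp f 2 volume) (x : Eucl N) :
    avg r f x = (volume (Metric.ball (0 : Eucl N) r)).toReal⁻¹ *
      ⟪indicatorConstLp 2 Metric.isOpen_ball.measurableSet
        (measure_ball_lt_top (x := x) (r := r) (μ := volume)).ne (1 : ℝ), hf.toLp f⟫ := by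
  rw [L2.inner_indicatorConstLp_one, avg, ballMeasure, ProbabilityTheory.cond,
    integral_smul_measure, ENNReal.toReal_inv, smul_eq_mul]
  congr 1
  have h1 := (measurePreserving_add_left volume x).setIntegral_preimage_emb
    (MeasurableEquiv.addLeft x).measurableEmbedding f (Metric.ball x r)
  have h2 : (fun h => x + h) ⁻¹' Metric.ball x r = Metric.ball (0 : Eucl N) r := by
    ext h; simp
  rw [h2] at h1
  rw [h1]
  exact (setIntegral_congr_ae Metric.isOpen_ball.measurableSet
    (by filter_upwards [hf.coeFn_toLp] with y hy _ using hy)).symm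

lemma abs_avg_le (r : ℝ) {f : Eucl N → ℝ} (hf : MemLp f 2 volume) (x : Eucl N) :
    |avg r f x| ≤ (volume (Metric.ball (0 : Eucl N) r)).toReal⁻¹ *
      ((volume (Metric.ball (0 : Eucl N) r)).toReal ^ (1 / 2 : ℝ) * ‖hf.toLp f‖) := by
  rw [avg_eq_inner hf, abs_mul, abs_of_nonneg (by positivity)]
  gcongr
  refine (abs_real_inner_le_norm _ _).trans ?_
  gcongr
  rw [norm_indicatorConstLp (by norm_num) (by norm_num), norm_one, one_mul, measureReal_def,
    Measure.addHaar_ball_center]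
  simp

lemma aestronglyMeasurable_comp_add_prod {f : Eucl N → ℝ} (hf : AEStronglyMeasurable f volume)
    (r : ℝ) (hr : 0 < r) : AEStronglyMeasurable (fun z : Eucl N × Eucl N => f (z.1 + z.2))
      (volume.prod (ballMeasure N r)) := by
  have := isProbabilityMeasure_ballMeasure (N := N) hr
  exact (hf.comp_quasiMeasurePreserving (quasiMeasurePreserving_add volume volume)).mono_ac
    (Measure.AbsolutelyContinuous.rfl.prod (ballMeasure_ac r))

lemma aestronglyMeasurable_avg {f : Eucl N → ℝ} (hf : AEStronglyMeasurable f volume)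
    {r : ℝ} (hr : 0 < r) : AEStronglyMeasurable (avg r f) volume := by
  have := isProbabilityMeasure_ballMeasure (N := N) hr
  exact (aestronglyMeasurable_comp_add_prod hf r hr).integral_prod_right'

lemma H1.lintegral_diff_le_norm (u : H1 N) (h : Eucl N) :
    ∫⁻ x, ‖u.toFun (x + h) - u.toFun x‖ₑ ^ 2 ≤ ‖h‖ₑ ^ 2 * ∫⁻ x, ‖u.grad x‖ₑ ^ 2 := by
  refine (u.lintegral_diff_le h).trans ?_
  rw [← lintegral_const_mul' _ _ (by finiteness)]
  refine lintegral_mono fun x => ?_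
  rw [← mul_pow, mul_comm]
  gcongr
  rw [enorm_eq_nnnorm, enorm_eq_nnnorm, enorm_eq_nnnorm]
  exact_mod_cast nnnorm_inner_le_nnnorm (𝕜 := ℝ) (u.grad x) h

lemma integrable_comp_add_ballMeasure {f : Eucl N → ℝ} (hf : MemLp f 2 volume) {r : ℝ}
    (hr : 0 < r) (x : Eucl N) : Integrable (fun h => f (x + h)) (ballMeasure N r) := by
  have := isProbabilityMeasure_ballMeasure (N := N) hr
  have h1 : MemLp (fun h => f (x + h)) 2 (ballMeasure N r) := by
    have h2 : MemLp (fun h => f (x + h)) 2 volume :=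
      hf.comp_measurePreserving (measurePreserving_add_left volume x)
    exact (h2.restrict _).smul_measure (ENNReal.inv_ne_top.2
      (Metric.measure_ball_pos _ _ hr).ne')
  exact h1.integrable (by norm_num)

/-- Jensen's inequality for the averaging measure, Tonelli, and the translation estimate for shifts
of length at most `r`. -/
lemma H1.lintegral_sub_avg_le (u : H1 N) {r : ℝ} (hr : 0 < r) :
    ∫⁻ x, ‖u.toFun x - avg r u.toFun x‖ₑ ^ 2 ≤
      ENNReal.ofReal (r ^ 2) * ∫⁻ x, ‖u.grad x‖ₑ ^ 2 := by
  have := isProbabilityMeasure_ballMeasure (N := N) hr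
  have hp : ∀ x, ‖u.toFun x - avg r u.toFun x‖ₑ ^ 2 ≤
      ∫⁻ h, ‖u.toFun (x + h) - u.toFun x‖ₑ ^ 2 ∂ballMeasure N r := by
    intro x
    have hi := integrable_comp_add_ballMeasure u.memLp_toFun hr x
    have e : avg r u.toFun x - u.toFun x =
        ∫ h, (u.toFun (x + h) - u.toFun x) ∂ballMeasure N r := by
      rw [integral_sub hi (integrable_const _), avg]
      simp
    rw [enorm_sub_rev, e, ← eLpNorm_two_sq]
    gcongr
    refine (enorm_integral_le_lintegral_enorm _).trans ?_
    rw [← eLpNorm_one_eq_lintegral_enorm]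
    exact eLpNorm_le_eLpNorm_of_exponent_le (by norm_num) (hi.sub (integrable_const _)).1
  refine (lintegral_mono hp).trans ?_
  rw [lintegral_lintegral_swap]
  · calc _ ≤ ∫⁻ _h, ENNReal.ofReal (r ^ 2) * (∫⁻ x, ‖u.grad x‖ₑ ^ 2) ∂ballMeasure N r := by
          refine lintegral_mono_ae ?_
          filter_upwards [ae_ballMeasure_mem r] with h hh
          refine (u.lintegral_diff_le_norm h).trans ?_
          gcongr
          rw [← ofReal_norm, ← ENNReal.ofReal_pow (norm_nonneg _)]
          refine ENNReal.ofReal_le_ofReal ?_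
          gcongr
          exact (mem_ball_zero_iff.1 hh).le
      _ = _ := by simp
  · exact ((aestronglyMeasurable_comp_add_prod u.memLp_toFun.1 r hr).sub
      u.memLp_toFun.1.comp_fst).enorm.pow_const 2

lemma exists_weak_subseq {H : Type*} [NormedAddCommGroup H] [InnerProductSpace ℝ H]
    [CompleteSpace H] [TopologicalSpace.SeparableSpace H] (s : ℕ → H) {C : ℝ}
    (hs : ∀ n, ‖s n‖ ≤ C) : ∃ F : H, ‖F‖ ≤ C ∧ ∃ φ : ℕ → ℕ, StrictMono φ ∧
      ∀ ψ, Tendsto (fun n => ⟪s (φ n), ψ⟫) atTop (𝓝 ⟪F, ψ⟫) := by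
  obtain ⟨ℓ, hℓ, φ, hφ, hlim⟩ := WeakDual.isSeqCompact_closedBall ℝ H 0 C
    (x := fun n => StrongDual.toWeakDual (InnerProductSpace.toDual ℝ H (s n))) (fun n => by
      simp only [Set.mem_preimage, Metric.mem_closedBall, dist_zero_right]
      have := hs n
      rw [← (InnerProductSpace.toDual ℝ H).norm_map] at this
      exact this)
  refine ⟨(InnerProductSpace.toDual ℝ H).symm (WeakDual.toStrongDual ℓ), ?_, φ, hφ, fun ψ => ?_⟩
  · rw [LinearIsometryEquiv.norm_map]
    simpa using hℓ
  · rw [InnerProductSpace.toDual_symm_apply]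
    exact ((WeakDual.eval_continuous (𝕜 := ℝ) ψ).tendsto ℓ).comp hlim

lemma enorm_add_sq_le {E : Type*} [NormedAddCommGroup E] (a b : E) :
    ‖a + b‖ₑ ^ 2 ≤ 2 * ‖a‖ₑ ^ 2 + 2 * ‖b‖ₑ ^ 2 := by
  have h : ‖a + b‖ ^ 2 ≤ 2 * ‖a‖ ^ 2 + 2 * ‖b‖ ^ 2 := by
    have := norm_add_le a b
    calc _ ≤ (‖a‖ + ‖b‖) ^ 2 := by gcongr
      _ ≤ _ := by nlinarith [sq_nonneg (‖a‖ - ‖b‖)]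
  simp only [← ofReal_norm]
  rw [← ENNReal.ofReal_pow (norm_nonneg _), ← ENNReal.ofReal_pow (norm_nonneg _),
    ← ENNReal.ofReal_pow (norm_nonneg _), show (2 : ℝ≥0∞) = ENNReal.ofReal 2 by simp,
    ← ENNReal.ofReal_mul (by norm_num), ← ENNReal.ofReal_mul (by norm_num),
    ← ENNReal.ofReal_add (by positivity) (by positivity)]
  exact ENNReal.ofReal_le_ofReal h

lemma enorm_sub_sq_le_four (a b c p q : ℝ) :
    ‖a - b‖ₑ ^ 2 ≤ 4 * (‖a - p‖ₑ ^ 2 + ‖p - c‖ₑ ^ 2) + 4 * (‖q - c‖ₑ ^ 2 + ‖b - q‖ₑ ^ 2) := by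
  have h1 := enorm_add_sq_le (a - c) (c - b)
  have h2 := enorm_add_sq_le (a - p) (p - c)
  have h3 := enorm_add_sq_le (c - q) (q - b)
  rw [sub_add_sub_cancel] at h1 h2 h3
  rw [enorm_sub_rev c q, enorm_sub_rev q b] at h3
  calc _ ≤ _ := h1
    _ ≤ 2 * (2 * ‖a - p‖ₑ ^ 2 + 2 * ‖p - c‖ₑ ^ 2) +
        2 * (2 * ‖q - c‖ₑ ^ 2 + 2 * ‖b - q‖ₑ ^ 2) := by gcongr
    _ = _ := by ring

/-- Local averages of a weakly convergent sequence converge strongly on bounded sets. -/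
lemma tendsto_lintegral_avg_sub {f : ℕ → Eucl N → ℝ} (hf : ∀ n, MemLp (f n) 2 volume)
    {F : Eucl N → ℝ} (hF : MemLp F 2 volume) {C : ℝ} (hfC : ∀ n, ‖(hf n).toLp _‖ ≤ C)
    (hFC : ‖hF.toLp F‖ ≤ C)
    (hlim : ∀ ψ, Tendsto (fun n => ⟪(hf n).toLp _, ψ⟫) atTop (𝓝 ⟪hF.toLp F, ψ⟫))
    {r : ℝ} (hr : 0 < r) (ρ : ℝ) :
    Tendsto (fun n => ∫⁻ x in Metric.ball (0 : Eucl N) ρ, ‖avg r (f n) x - avg r F x‖ₑ ^ 2)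
      atTop (𝓝 0) := by
  set c := (volume (Metric.ball (0 : Eucl N) r)).toReal⁻¹
  set M := c * ((volume (Metric.ball (0 : Eucl N) r)).toReal ^ (1 / 2 : ℝ) * C)
  have hb : ∀ {g : Eucl N → ℝ} (hg : MemLp g 2 volume), ‖hg.toLp g‖ ≤ C → ∀ x,
      |avg r g x| ≤ M := fun hg hgC x => (abs_avg_le r hg x).trans
    (mul_le_mul_of_nonneg_left (mul_le_mul_of_nonneg_left hgC (by positivity))
      (inv_nonneg.2 ENNReal.toReal_nonneg))
  have h0 : (0 : ℝ≥0∞) = ∫⁻ _x in Metric.ball (0 : Eucl N) ρ, 0 := by simp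
  rw [h0]
  refine tendsto_lintegral_of_dominated_convergence' (fun _ => ENNReal.ofReal (M + M) ^ 2)
    (fun n => ?_) (fun n => Eventually.of_forall fun x => ?_) ?_ (Eventually.of_forall fun x => ?_)
  · exact (((aestronglyMeasurable_avg (hf n).1 hr).sub
      (aestronglyMeasurable_avg hF.1 hr)).enorm.pow_const 2).restrict
  · beta_reduce
    gcongr
    rw [Real.enorm_eq_ofReal_abs]
    refine ENNReal.ofReal_le_ofReal ((abs_sub _ _).trans ?_)
    exact add_le_add (hb _ (hfC n) x) (hb _ hFC x)
  · rw [setLIntegral_const]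
    exact ENNReal.mul_ne_top (by finiteness) measure_ball_lt_top.ne
  · have h1 : Tendsto (fun n => avg r (f n) x - avg r F x) atTop (𝓝 0) := by
      rw [← sub_self (avg r F x)]
      refine Tendsto.sub_const ?_ _
      simp only [avg_eq_inner (hf _), avg_eq_inner hF]
      refine Tendsto.const_mul _ ?_
      simp only [real_inner_comm]
      exact hlim _
    have := ((ENNReal.continuous_pow 2).tendsto _).comp ((continuous_enorm.tendsto _).comp h1)
    simpa [Function.comp_def] using this

lemma lintegral_four_mul_add {α : Type*} [MeasurableSpace α] {μ : Measure α}
    {f g h k : α → ℝ≥0∞} (hf : AEMeasurable f μ) (hg : AEMeasurable g μ) (hh : AEMeasurable h μ) :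
    ∫⁻ x, (4 * (f x + g x) + 4 * (h x + k x)) ∂μ =
      4 * ((∫⁻ x, f x ∂μ) + ∫⁻ x, g x ∂μ) + 4 * ((∫⁻ x, h x ∂μ) + ∫⁻ x, k x ∂μ) := by
  have h1 : AEMeasurable (fun x => 4 * (f x + g x)) μ := (hf.add hg).const_mul 4
  rw [lintegral_add_left' h1, lintegral_const_mul' _ _ (by finiteness),
    lintegral_const_mul' _ _ (by finiteness), lintegral_add_left' hf, lintegral_add_left' hh]

/-- A weakly convergent subsequence is Cauchy: on a ball it is uniformly close to its averages,
which converge strongly, and the tails are small. -/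
lemma exists_convergent_subseq {u : ℕ → H1 N} {C : ℝ≥0} (hC : ∀ n, (u n).energy ≤ C)
    (htail : ∀ ε : ℝ≥0, 0 < ε → ∃ ρ : ℝ, ∀ n,
      ∫⁻ x in (Metric.ball (0 : Eucl N) ρ)ᶜ, ‖(u n).toFun x‖ₑ ^ 2 ≤ ε) :
    ∃ F : Lp ℝ 2 (volume : Measure (Eucl N)), ∃ φ : ℕ → ℕ, StrictMono φ ∧
      Tendsto (fun n => (u (φ n)).toL2) atTop (𝓝 F) := by
  have hn : ∀ n, ‖(u n).toL2‖ ≤ √C := by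
    intro n
    refine Real.le_sqrt_of_sq_le ?_
    have h1 := ((u n).lintegral_sq_le_energy).trans (hC n)
    rw [← ofReal_norm_toLp_sq (u n).memLp_toFun] at h1
    exact (ENNReal.ofReal_le_iff_le_toReal ENNReal.coe_ne_top).1 h1
  -- Provides the separability of `L²` required by `exists_weak_subseq`.
  have : Fact ((2 : ℝ≥0∞) ≠ ⊤) := ⟨by norm_num⟩
  obtain ⟨F, hFC, φ, hφ, hlim⟩ := exists_weak_subseq (fun n => (u n).toL2) hn
  suffices h : CauchySeq fun n => (u (φ n)).toL2 by
    obtain ⟨G, hG⟩ := cauchySeq_tendsto_of_complete h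
    exact ⟨G, φ, hφ, hG⟩
  have hFe : (Lp.memLp F).toLp _ = F := Lp.toLp_coeFn F _
  rw [← hFe] at hFC hlim
  refine Metric.cauchySeq_iff.2 fun ε hε => ?_
  -- The ball contributes `16 η` (four pieces of size `η`, each with factor `4`) and the tail `4 η`.
  obtain ⟨η, hη, hηε⟩ : ∃ η : ℝ≥0, 0 < η ∧ 20 * (η : ℝ) < ε ^ 2 :=
    ⟨(ε ^ 2 / 40).toNNReal, Real.toNNReal_pos.2 (by positivity), by
      rw [Real.coe_toNNReal _ (by positivity)]; nlinarith [sq_pos_of_pos hε]⟩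
  obtain ⟨r, hr, hrη⟩ : ∃ r : ℝ, 0 < r ∧ r ^ 2 * C ≤ η := by
    have hp : (0 : ℝ) < η / (C + 1) := div_pos (NNReal.coe_pos.2 hη) (by positivity)
    refine ⟨√(η / (C + 1)), Real.sqrt_pos.2 hp, ?_⟩
    rw [Real.sq_sqrt hp.le, div_mul_eq_mul_div, div_le_iff₀ (by positivity)]
    nlinarith [η.2, C.2]
  obtain ⟨ρ, hρ⟩ := htail η hη
  have hA := tendsto_lintegral_avg_sub (fun n => (u (φ n)).memLp_toFun) (Lp.memLp F)
    (fun n => hn (φ n)) hFC hlim hr ρ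
  obtain ⟨n₀, hn₀⟩ := eventually_atTop.1 (hA.eventually (gt_mem_nhds (ENNReal.coe_pos.2 hη)))
  have hS : ∀ n, ∫⁻ x in Metric.ball (0 : Eucl N) ρ,
      ‖(u n).toFun x - avg r (u n).toFun x‖ₑ ^ 2 ≤ η := by
    intro n
    refine (setLIntegral_le_lintegral _ _).trans (((u n).lintegral_sub_avg_le hr).trans ?_)
    have h1 : ∫⁻ x, ‖(u n).grad x‖ₑ ^ 2 ≤ C :=
      le_trans (by rw [H1.energy_eq]; exact le_self_add) (hC n)
    calc _ ≤ ENNReal.ofReal (r ^ 2) * C := by gcongr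
      _ = ENNReal.ofReal (r ^ 2 * C) := by
        rw [ENNReal.ofReal_mul (by positivity), ENNReal.ofReal_coe_nnreal]
      _ ≤ ENNReal.ofReal η := ENNReal.ofReal_le_ofReal hrη
      _ = _ := ENNReal.ofReal_coe_nnreal
  refine ⟨n₀, fun m hm n hn' => ?_⟩
  have hu := fun n => (u n).memLp_toFun
  have hav : ∀ n, AEStronglyMeasurable (avg r (u n).toFun) volume :=
    fun n => aestronglyMeasurable_avg (hu n).1 hr
  have haF := aestronglyMeasurable_avg (Lp.memLp F).1 hr
  have m1 : ∀ n, AEMeasurable (fun x => ‖(u n).toFun x - avg r (u n).toFun x‖ₑ ^ 2)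
      (volume.restrict (Metric.ball (0 : Eucl N) ρ)) :=
    fun n => (((hu n).1.sub (hav n)).enorm.pow_const 2).restrict
  have m2 : ∀ n, AEMeasurable (fun x => ‖avg r (u n).toFun x - avg r F x‖ₑ ^ 2)
      (volume.restrict (Metric.ball (0 : Eucl N) ρ)) :=
    fun n => (((hav n).sub haF).enorm.pow_const 2).restrict
  have hball : ∫⁻ x in Metric.ball (0 : Eucl N) ρ,
      ‖(u (φ m)).toFun x - (u (φ n)).toFun x‖ₑ ^ 2 ≤ 16 * η := by
    calc _ ≤ ∫⁻ x in Metric.ball (0 : Eucl N) ρ,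
          (4 * (‖(u (φ m)).toFun x - avg r (u (φ m)).toFun x‖ₑ ^ 2 +
            ‖avg r (u (φ m)).toFun x - avg r F x‖ₑ ^ 2) +
          4 * (‖avg r (u (φ n)).toFun x - avg r F x‖ₑ ^ 2 +
            ‖(u (φ n)).toFun x - avg r (u (φ n)).toFun x‖ₑ ^ 2)) :=
          lintegral_mono fun x => enorm_sub_sq_le_four _ _ _ _ _
      _ = 4 * ((∫⁻ x in Metric.ball (0 : Eucl N) ρ,
            ‖(u (φ m)).toFun x - avg r (u (φ m)).toFun x‖ₑ ^ 2) +
            ∫⁻ x in Metric.ball (0 : Eucl N) ρ, ‖avg r (u (φ m)).toFun x - avg r F x‖ₑ ^ 2) +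
          4 * ((∫⁻ x in Metric.ball (0 : Eucl N) ρ,
            ‖avg r (u (φ n)).toFun x - avg r F x‖ₑ ^ 2) +
            ∫⁻ x in Metric.ball (0 : Eucl N) ρ,
              ‖(u (φ n)).toFun x - avg r (u (φ n)).toFun x‖ₑ ^ 2) := by
          exact lintegral_four_mul_add (m1 _) (m2 _) (m2 _)
      _ ≤ 4 * (η + η) + 4 * (η + η) := by
          gcongr
          · exact hS _
          · exact (hn₀ m hm).le
          · exact (hn₀ n hn').le
          · exact hS _
      _ = _ := by ring
  have htl : ∫⁻ x in (Metric.ball (0 : Eucl N) ρ)ᶜ,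
      ‖(u (φ m)).toFun x - (u (φ n)).toFun x‖ₑ ^ 2 ≤ 4 * η := by
    calc _ ≤ ∫⁻ x in (Metric.ball (0 : Eucl N) ρ)ᶜ,
          (2 * ‖(u (φ m)).toFun x‖ₑ ^ 2 + 2 * ‖(u (φ n)).toFun x‖ₑ ^ 2) := by
          refine lintegral_mono fun x => ?_
          have := enorm_add_sq_le ((u (φ m)).toFun x) (-(u (φ n)).toFun x)
          rwa [enorm_neg, ← sub_eq_add_neg] at this
      _ = 2 * (∫⁻ x in (Metric.ball (0 : Eucl N) ρ)ᶜ, ‖(u (φ m)).toFun x‖ₑ ^ 2) +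
          2 * ∫⁻ x in (Metric.ball (0 : Eucl N) ρ)ᶜ, ‖(u (φ n)).toFun x‖ₑ ^ 2 := by
          rw [lintegral_add_left' ((((hu _).1.enorm.pow_const 2).const_mul 2).restrict),
            lintegral_const_mul' _ _ (by finiteness), lintegral_const_mul' _ _ (by finiteness)]
      _ ≤ 2 * η + 2 * η := by
          gcongr
          · exact hρ _
          · exact hρ _
      _ = _ := by ring
  have htot : ENNReal.ofReal (‖(u (φ m)).toL2 - (u (φ n)).toL2‖ ^ 2) ≤
      ENNReal.ofReal (20 * η) := by
    rw [H1.toL2, H1.toL2, ← MemLp.toLp_sub, ofReal_norm_toLp_sq,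
      ← lintegral_add_compl _ (Metric.isOpen_ball (x := (0 : Eucl N)) (ε := ρ)).measurableSet]
    refine (add_le_add hball htl).trans_eq ?_
    rw [ENNReal.ofReal_mul (by norm_num), ENNReal.ofReal_coe_nnreal, ← add_mul]
    norm_num
  rw [ENNReal.ofReal_le_ofReal_iff (by positivity)] at htot
  rw [dist_eq_norm]
  exact lt_of_pow_lt_pow_left₀ 2 hε.le (htot.trans_lt hηε)

lemma isCompact_closure_of_seq {X : Type*} [PseudoMetricSpace X] {S : Set X}
    (h : ∀ s : ℕ → X, (∀ n, s n ∈ S) → ∃ a, ∃ φ : ℕ → ℕ, StrictMono φ ∧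
      Tendsto (s ∘ φ) atTop (𝓝 a)) : IsCompact (closure S) := by
  refine IsSeqCompact.isCompact fun x hx => ?_
  choose s hs hd using fun n : ℕ => Metric.mem_closure_iff.1 (hx n) (1 / (n + 1 : ℝ)) (by positivity)
  obtain ⟨a, φ, hφ, hlim⟩ := h s hs
  refine ⟨a, mem_closure_of_tendsto hlim (Eventually.of_forall fun n => hs _), φ, hφ, ?_⟩
  refine tendsto_of_tendsto_of_dist hlim ?_
  refine squeeze_zero (fun _ => dist_nonneg) (fun n => ?_)
    (tendsto_one_div_add_atTop_nhds_zero_nat.comp hφ.tendsto_atTop)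
  rw [dist_comm]
  exact (hd (φ n)).le

/-- Escape of mass to infinity is the only obstruction to compactness. -/
lemma compactEmbedding_of_tail {μ : Measure (Eucl N)} (h : ∀ C ε : ℝ≥0, 0 < ε →
    ∃ ρ : ℝ, ∀ u ∈ H1mu μ, normSq μ u ≤ C →
      ∫⁻ x in (Metric.ball (0 : Eucl N) ρ)ᶜ, ‖u.toFun x‖ₑ ^ 2 ≤ ε) : CompactEmbedding μ := by
  intro C
  refine isCompact_closure_of_seq fun s hs => ?_
  choose u hu hus using hs
  obtain ⟨F, φ, hφ, hlim⟩ := exists_convergent_subseq (u := u) (C := C)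
    (fun n => le_trans le_self_add (hu n).2)
    (fun ε hε => by
      obtain ⟨ρ, hρ⟩ := h C ε hε
      exact ⟨ρ, fun n => hρ _ (hu n).1 (hu n).2⟩)
  refine ⟨F, φ, hφ, hlim.congr fun n => ?_⟩
  exact hus (φ n)

end Rellich

/-! ### The inequality `-Δw ≤ 1` in the sense of distributions. -/

section Subsolution

variable {N : ℕ} {μ : Measure (Eucl N)} {Ω : Set (Eucl N)}

/-- A test function, as an element of `H¹`. -/
def H1.ofTest {φ : Eucl N → ℝ} (hφ : ContDiff ℝ ∞ φ) (hc : HasCompactSupport φ) : H1 N where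
  toFun := φ
  grad := gradient φ
  memLp_toFun := memLp_of_test hφ hc
  memLp_grad := by
    have h : gradient φ = fun x => (InnerProductSpace.toDual ℝ (Eucl N)).symm (fderiv ℝ φ x) := rfl
    have h1 : Continuous (gradient φ) := by
      rw [h]
      exact (LinearIsometryEquiv.continuous _).comp (hφ.continuous_fderiv (by simp))
    refine h1.memLp_of_hasCompactSupport ?_
    rw [h]
    exact (hc.fderiv ℝ).comp_left (g := (InnerProductSpace.toDual ℝ (Eucl N)).symm) (map_zero _)
  weak_grad ψ hψ hψc v := by
    have hi : ∀ x, ⟪gradient φ x, v⟫ = fderiv ℝ φ x v := fun x => by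
      rw [gradient, InnerProductSpace.toDual_symm_apply]
    simp only [hi]
    have hd : ∀ {f : Eucl N → ℝ}, ContDiff ℝ ∞ f → HasCompactSupport f →
        MemLp (fun x => fderiv ℝ f x v) 2 volume := fun hf hfc =>
      ((hf.continuous_fderiv (by simp)).clm_apply
        continuous_const).memLp_of_hasCompactSupport (hfc.fderiv_apply ℝ _)
    exact integral_mul_fderiv_eq_neg_fderiv_mul_of_integrable
      (integrable_mul_of_memLp_two (hd hφ hc) (memLp_of_test hψ hψc))
      (integrable_mul_of_memLp_two (memLp_of_test hφ hc) (hd hψ hψc))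
      (integrable_mul_of_memLp_two (memLp_of_test hφ hc) (memLp_of_test hψ hψc))
      (fun x _ => hφ.differentiable (by simp) x) (fun x _ => hψ.differentiable (by simp) x)

/-- The Laplacian, as the sum of pure second derivatives. -/
def lap (φ : Eucl N → ℝ) (x : Eucl N) : ℝ :=
  ∑ j, fderiv ℝ (fun y => fderiv ℝ φ y (stdVec j)) x (stdVec j)

lemma contDiff_fderiv_apply {φ : Eucl N → ℝ} (hφ : ContDiff ℝ ∞ φ) (v : Eucl N) :
    ContDiff ℝ ∞ (fun y => fderiv ℝ φ y v) :=
  (hφ.fderiv_right (m := ∞) (by simp)).clm_apply contDiff_const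

lemma continuous_lap {φ : Eucl N → ℝ} (hφ : ContDiff ℝ ∞ φ) : Continuous (lap φ) :=
  continuous_finsetSum _ fun j _ => (contDiff_fderiv_apply
    (contDiff_fderiv_apply hφ (stdVec j)) (stdVec j)).continuous

lemma hasCompactSupport_lap {φ : Eucl N → ℝ} (hc : HasCompactSupport φ) :
    HasCompactSupport (lap φ) := by
  refine hc.mono' fun x hx => ?_
  by_contra h
  refine hx (Finset.sum_eq_zero fun j _ => ?_)
  have h1 : x ∉ tsupport (fun y => fderiv ℝ φ y (stdVec j)) :=
    fun h' => h (tsupport_fderiv_apply_subset ℝ _ h')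
  have h2 : x ∉ tsupport (fun y => fderiv ℝ (fun y => fderiv ℝ φ y (stdVec j)) y (stdVec j)) :=
    fun h' => h1 (tsupport_fderiv_apply_subset ℝ _ h')
  exact image_eq_zero_of_notMem_tsupport (f := fun y =>
    fderiv ℝ (fun y => fderiv ℝ φ y (stdVec j)) y (stdVec j)) h2

lemma H1.integral_grad_ofTest (u : H1 N) {φ : Eucl N → ℝ} (hφ : ContDiff ℝ ∞ φ)
    (hc : HasCompactSupport φ) :
    ∫ x, ⟪u.grad x, (H1.ofTest hφ hc).grad x⟫ = -∫ x, u.toFun x * lap φ x := by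
  have h2 : ∀ j, MemLp (fun x => fderiv ℝ (fun y => fderiv ℝ φ y (stdVec j)) x (stdVec j)) 2
      volume := fun j =>
    memLp_of_test (contDiff_fderiv_apply (contDiff_fderiv_apply hφ _) _)
      ((hc.fderiv_apply ℝ _).fderiv_apply ℝ _)
  simp only [lap, Finset.mul_sum]
  rw [H1.integral_grad_inner, integral_finsetSum _ fun j _ =>
    integrable_mul_of_memLp_two u.memLp_toFun (h2 j), ← Finset.sum_neg_distrib]
  refine Finset.sum_congr rfl fun j _ => ?_
  rw [u.weak_grad _ (contDiff_fderiv_apply hφ _) (hc.fderiv_apply ℝ _) (stdVec j), neg_neg]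
  refine integral_congr_ae (Eventually.of_forall fun x => ?_)
  beta_reduce
  congr 1
  change ⟪gradient φ x, _⟫ = _
  rw [gradient, InnerProductSpace.toDual_symm_apply]

/-- The truncated slope `min (s₊ / δ) 1`. -/
def slope01 (δ s : ℝ) : ℝ := max 0 (min 1 (s / δ))

/-- The primitive of `slope01`. -/
def slopePrim (δ s : ℝ) : ℝ := s * slope01 δ s - δ * slope01 δ s ^ 2 / 2

lemma slope01_nonneg (δ s : ℝ) : 0 ≤ slope01 δ s := le_max_left _ _

lemma slope01_le_one (δ s : ℝ) : slope01 δ s ≤ 1 := max_le zero_le_one (min_le_left _ _)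

lemma abs_slope01_sub_le {δ : ℝ} (hδ : 0 < δ) (s t : ℝ) :
    |slope01 δ s - slope01 δ t| ≤ |s - t| / δ := by
  unfold slope01
  refine (abs_max_sub_max_le_max _ _ _ _).trans ?_
  rw [sub_self, abs_zero, max_eq_right (abs_nonneg _)]
  refine (abs_min_sub_min_le_max _ _ _ _).trans ?_
  rw [sub_self, abs_zero, max_eq_right (abs_nonneg _), ← sub_div, abs_div, abs_of_pos hδ]

/-- `slopePrim δ s` is the maximum over `τ ∈ [0, 1]` of `s τ - δ τ² / 2`, attained at `slope01 δ s`;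
its convexity and tangent inequality follow from this. -/
lemma slopePrim_ge {δ : ℝ} (hδ : 0 < δ) (s : ℝ) {τ : ℝ} (h0 : 0 ≤ τ) (h1 : τ ≤ 1) :
    s * τ - δ * τ ^ 2 / 2 ≤ slopePrim δ s := by
  unfold slopePrim slope01
  rcases le_total 1 (s / δ) with h | h
  · rw [min_eq_left h, max_eq_right zero_le_one]
    rw [one_le_div hδ] at h
    nlinarith [mul_nonneg (sub_nonneg.2 h1) (sub_nonneg.2 h), mul_nonneg hδ.le (sub_nonneg.2 h1),
      mul_nonneg (mul_nonneg hδ.le (sub_nonneg.2 h1)) (sub_nonneg.2 h1)]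
  · rw [min_eq_right h]
    rcases le_total 0 (s / δ) with h2 | h2
    · rw [max_eq_right h2]
      set σ := s / δ with hσ
      have : s = δ * σ := by rw [hσ]; field_simp
      rw [this]
      nlinarith [mul_nonneg hδ.le (sq_nonneg (σ - τ))]
    · rw [max_eq_left h2]
      have hs : s ≤ 0 := by
        by_contra! h3
        exact absurd (div_pos h3 hδ) (not_lt.2 h2)
      nlinarith [mul_nonneg hδ.le (sq_nonneg τ), mul_nonneg h0 (neg_nonneg.2 hs)]

lemma slopePrim_tangent {δ : ℝ} (hδ : 0 < δ) (s t : ℝ) :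
    slopePrim δ s + slope01 δ s * (t - s) ≤ slopePrim δ t := by
  have := slopePrim_ge hδ t (slope01_nonneg δ s) (slope01_le_one δ s)
  unfold slopePrim at *
  linarith

lemma abs_slopePrim_sub_le {δ : ℝ} (hδ : 0 < δ) (s t : ℝ) :
    |slopePrim δ s - slopePrim δ t| ≤ |s - t| := by
  have key : ∀ a b, slopePrim δ a - slopePrim δ b ≤ |a - b| := by
    intro a b
    have h1 := slopePrim_tangent hδ a b
    have h2 := slope01_nonneg δ a
    have h3 := slope01_le_one δ a
    nlinarith [le_abs_self (a - b), abs_nonneg (a - b)]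
  rw [abs_le]
  have := key t s
  rw [abs_sub_comm] at this
  exact ⟨by linarith, key s t⟩

lemma slope01_zero (δ : ℝ) : slope01 δ 0 = 0 := by simp [slope01]

lemma slopePrim_zero (δ : ℝ) : slopePrim δ 0 = 0 := by simp [slopePrim, slope01_zero]

lemma abs_slopePrim_sub_self_le {δ s : ℝ} (hδ : 0 < δ) (hs : 0 ≤ s) :
    |slopePrim δ s - s| ≤ δ / 2 := by
  have h1 := slopePrim_ge hδ s zero_le_one le_rfl
  have h2 : slopePrim δ s ≤ s := by
    unfold slopePrim
    nlinarith [slope01_nonneg δ s, slope01_le_one δ s, mul_nonneg hδ.le (sq_nonneg (slope01 δ s))]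
  rw [abs_le]
  constructor <;> linarith

/-- Discrete form of `∇J(w)·∇φ ≤ ∇w·∇(φ J'(w))` for convex `J` and `φ ≥ 0`: the tangent inequalities
at `a` and `b`, weighted by `p` and `q`. -/
lemma slopePrim_diff_mul_le {δ : ℝ} (hδ : 0 < δ) (a b : ℝ) {p q : ℝ} (hp : 0 ≤ p) (hq : 0 ≤ q) :
    (slopePrim δ b - slopePrim δ a) * (q - p) ≤
      (b - a) * (q * slope01 δ b - p * slope01 δ a) := by
  have h1 := slopePrim_tangent hδ a b
  have h2 := slopePrim_tangent hδ b a
  nlinarith [mul_nonneg hp (sub_nonneg.2 h1), mul_nonneg hq (sub_nonneg.2 h2)]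

@[fun_prop]
lemma continuous_slope01 (δ : ℝ) : Continuous (slope01 δ) := by unfold slope01; fun_prop

@[fun_prop]
lemma continuous_slopePrim (δ : ℝ) : Continuous (slopePrim δ) := by unfold slopePrim; fun_prop

/-- Kato's argument. The function `φ` need not vanish outside `Ω`, but `φ · slope01 δ w` does and is
admissible; the terms with `w` and with `μ` are nonnegative and are dropped. -/
lemma IsWeakSolution.slopePrim_lap_le (hμ : IsCapacitary μ) {w : H1 N}
    (hw : IsWeakSolution μ Ω (fun _ => 1) w) {φ : Eucl N → ℝ} (hφ : ContDiff ℝ ∞ φ)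
    (hc : HasCompactSupport φ) (hφ0 : ∀ x, 0 ≤ φ x) {δ : ℝ} (hδ : 0 < δ) :
    -∫ x, slopePrim δ (w.toFun x) * lap φ x ≤ ∫ x, φ x := by
  obtain ⟨hwm, hw0⟩ := mem_H1muDirichlet_iff.1 hw.1
  obtain ⟨M, hM⟩ := hφ.continuous.bounded_above_of_compact_support hc
  obtain ⟨K, hK⟩ := (hφ.of_le (m := 1) (by exact_mod_cast le_top)).lipschitzWith_of_hasCompactSupport
    hc one_ne_zero
  have hM0 : 0 ≤ M := (norm_nonneg _).trans (hM 0)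
  have hK0 : (0 : ℝ) ≤ K := K.coe_nonneg
  have hT : ∀ s, slope01 δ s ≤ |s| / δ := fun s => by
    have := abs_slope01_sub_le hδ s 0
    rw [slope01_zero, sub_zero, sub_zero, abs_of_nonneg (slope01_nonneg δ s)] at this
    exact this
  obtain ⟨f, hf, hfm⟩ := exists_mem_H1mu_comp hμ hwm hwm
    (Φ := fun x a _ => φ x * slope01 δ a) (L := (M + K) / δ)
    ((hφ.continuous.comp continuous_fst).mul ((continuous_slope01 δ).comp (continuous_snd.fst)))
    (fun x a b => by
      rw [abs_mul, abs_of_nonneg (slope01_nonneg δ a)]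
      have h1 : |φ x| * slope01 δ a ≤ M * (|a| / δ) :=
        mul_le_mul (hM x) (hT a) (slope01_nonneg δ a) hM0
      refine h1.trans ?_
      rw [mul_div_assoc', div_mul_eq_mul_div]
      gcongr
      · exact le_add_of_nonneg_right hK0
      · linarith [abs_nonneg b])
    (fun x y a b a' b' => by
      have e : φ y * slope01 δ a' - φ x * slope01 δ a =
        φ y * (slope01 δ a' - slope01 δ a) + (φ y - φ x) * slope01 δ a := by ring
      rw [e]
      refine (abs_add_le _ _).trans ?_
      rw [abs_mul, abs_mul, abs_of_nonneg (slope01_nonneg δ a)]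
      have h1 : |φ y| * |slope01 δ a' - slope01 δ a| ≤ M * (|a' - a| / δ) :=
        mul_le_mul (hM y) (abs_slope01_sub_le hδ _ _) (abs_nonneg _) hM0
      have h2 : |φ y - φ x| * slope01 δ a ≤ (K * ‖y - x‖) * (|a| / δ) :=
        mul_le_mul (hK.norm_sub_le y x) (hT a) (slope01_nonneg δ a)
          (mul_nonneg hK0 (norm_nonneg _))
      refine (add_le_add h1 h2).trans ?_
      have e2 : M * (|a' - a| / δ) + K * ‖y - x‖ * (|a| / δ) =
        (M * |a' - a| + K * (‖y - x‖ * |a|)) / δ := by ring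
      rw [e2, div_mul_eq_mul_div]
      gcongr
      have g1 := mul_nonneg hM0 (abs_nonneg (b' - b))
      have g2 := mul_nonneg hK0 (abs_nonneg (b' - b))
      have g3 := mul_nonneg hK0 (abs_nonneg (a' - a))
      have g4 := mul_nonneg (norm_nonneg (y - x)) (abs_nonneg b)
      have g5 := mul_nonneg (norm_nonneg (y - x)) (abs_nonneg a)
      nlinarith [mul_nonneg hM0 g4, mul_nonneg hK0 g4, mul_nonneg hM0 g5])
  have hfV : f ∈ H1muDirichlet μ Ω := by
    refine mem_H1muDirichlet_iff.2 ⟨hfm, ?_⟩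
    filter_upwards [hw0] with x hx hxΩ
    simp [hf, hx hxΩ, slope01_zero]
  obtain ⟨g, hg⟩ := H1.exists_comp w w (Φ := fun _ a _ => slopePrim δ a) (L := 1) (by fun_prop)
    (fun x a b => by
      have := abs_slopePrim_sub_le hδ a 0
      rw [slopePrim_zero, sub_zero, sub_zero] at this
      linarith [abs_nonneg b])
    (fun x y a b a' b' => by
      have := abs_slopePrim_sub_le hδ a' a
      have := mul_nonneg (norm_nonneg (y - x)) (add_nonneg (abs_nonneg a) (abs_nonneg b))
      linarith [abs_nonneg (b' - b)])
  have h1 := hw.eq hfV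
  have h2 := H1.integral_grad_inner_mono w f g (H1.ofTest hφ hc) fun s =>
    Eventually.of_forall fun x => by
      simp only [hg, hf]
      exact slopePrim_diff_mul_le hδ _ _ (hφ0 x) (hφ0 (x + s))
  rw [H1.integral_grad_ofTest, hg] at h2
  have hnn := hw.qe_nonneg hμ
  have hf0 : ∀ x, 0 ≤ f.toFun x := fun x => by
    rw [hf]; exact mul_nonneg (hφ0 x) (slope01_nonneg _ _)
  have h3 : 0 ≤ ∫ x, w.toFun x * f.toFun x := integral_nonneg_of_ae (by
    filter_upwards [ae_of_qe hnn] with x hx using mul_nonneg hx (hf0 x))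
  have h4 : 0 ≤ ∫ x, w.toFun x * f.toFun x ∂μ := integral_nonneg_of_ae (by
    filter_upwards [hμ.ae_of_qe hnn] with x hx using mul_nonneg hx (hf0 x))
  have h5 : ∫ x, f.toFun x ≤ ∫ x, φ x := by
    refine integral_mono_of_nonneg (Eventually.of_forall hf0)
      (hφ.continuous.integrable_of_hasCompactSupport hc) (Eventually.of_forall fun x => ?_)
    rw [hf]
    exact mul_le_of_le_one_right (hφ0 x) (slope01_le_one _ _)
  linarith

/-- Let `δ → 0`: since `w ≥ 0`, `slopePrim δ w` differs from `w` by at most `δ / 2`. -/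
lemma IsWeakSolution.subsolution (hμ : IsCapacitary μ) {w : H1 N}
    (hw : IsWeakSolution μ Ω (fun _ => 1) w) {φ : Eucl N → ℝ} (hφ : ContDiff ℝ ∞ φ)
    (hc : HasCompactSupport φ) (hφ0 : ∀ x, 0 ≤ φ x) :
    -∫ x, w.toFun x * lap φ x ≤ ∫ x, φ x := by
  have hl : Integrable (lap φ) volume :=
    (continuous_lap hφ).integrable_of_hasCompactSupport (hasCompactSupport_lap hc)
  have hl2 : MemLp (lap φ) 2 volume :=
    (continuous_lap hφ).memLp_of_hasCompactSupport (hasCompactSupport_lap hc)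
  have hnn := ae_of_qe (hw.qe_nonneg hμ)
  have key : ∀ δ : ℝ, 0 < δ → -∫ x, w.toFun x * lap φ x ≤
      (∫ x, φ x) + δ * ((∫ x, |lap φ x|) / 2) := by
    intro δ hδ
    have h1 := hw.slopePrim_lap_le hμ hφ hc hφ0 hδ
    have hS : MemLp (fun x => slopePrim δ (w.toFun x)) 2 volume := by
      refine w.memLp_toFun.mono ((continuous_slopePrim δ).comp_aestronglyMeasurable
        w.memLp_toFun.1) (Eventually.of_forall fun x => ?_)
      simpa [slopePrim_zero] using abs_slopePrim_sub_le hδ (w.toFun x) 0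
    have h2 : ∫ x, (slopePrim δ (w.toFun x) - w.toFun x) * lap φ x ≤
        ∫ x, δ / 2 * |lap φ x| := by
      refine integral_mono_ae ((hS.sub w.memLp_toFun).integrable_mul hl2) (hl.abs.const_mul _) ?_
      filter_upwards [hnn] with x hx
      refine (le_abs_self _).trans ?_
      rw [abs_mul]
      gcongr
      exact abs_slopePrim_sub_self_le hδ hx
    have h3 : ∫ x, (slopePrim δ (w.toFun x) - w.toFun x) * lap φ x =
        (∫ x, slopePrim δ (w.toFun x) * lap φ x) - ∫ x, w.toFun x * lap φ x := by
      rw [← integral_sub (integrable_mul_of_memLp_two hS hl2)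
        (integrable_mul_of_memLp_two w.memLp_toFun hl2)]
      simp only [sub_mul]
    rw [integral_const_mul] at h2
    linarith
  refine le_of_tendsto_of_tendsto (f := fun _ => -∫ x, w.toFun x * lap φ x)
    (b := 𝓝[>] (0 : ℝ)) (g := fun δ => (∫ x, φ x) + δ * ((∫ x, |lap φ x|) / 2))
    tendsto_const_nhds ?_ ?_
  · refine Tendsto.mono_left ?_ nhdsWithin_le_nhds
    have : Continuous fun δ : ℝ => (∫ x, φ x) + δ * ((∫ x, |lap φ x|) / 2) := by fun_prop
    simpa using this.tendsto 0
  · filter_upwards [self_mem_nhdsWithin] with δ hδ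
    exact key δ hδ

end Subsolution

/-! ### Mean value inequality for bounded subsolutions. -/

section MeanValue

variable {N : ℕ}

/-- A smooth antitone profile that vanishes on `[1, ∞)`. -/
def profile (q : ℝ) : ℝ := expNegInvGlue (1 - q)

lemma contDiff_profile : ContDiff ℝ ∞ profile :=
  (expNegInvGlue.contDiff (n := ⊤)).comp (contDiff_const.sub contDiff_id)

lemma profile_nonneg (q : ℝ) : 0 ≤ profile q := expNegInvGlue.nonneg _

lemma profile_le_one (q : ℝ) : profile q ≤ 1 := by
  unfold profile expNegInvGlue
  split_ifs with h
  · exact zero_le_one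
  · rw [Real.exp_le_one_iff, neg_nonpos, inv_nonneg]
    linarith

lemma profile_eq_zero {q : ℝ} (h : 1 ≤ q) : profile q = 0 :=
  expNegInvGlue.zero_of_nonpos (by linarith)

lemma antitone_profile : Antitone profile := fun _ _ h =>
  expNegInvGlue.monotone (by linarith)

lemma contDiff_deriv_profile : ContDiff ℝ ∞ (deriv profile) :=
  ((contDiff_infty_iff_deriv).1 contDiff_profile).2

lemma contDiff_deriv_deriv_profile : ContDiff ℝ ∞ (deriv (deriv profile)) :=
  ((contDiff_infty_iff_deriv).1 contDiff_deriv_profile).2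

lemma deriv_profile_nonpos (q : ℝ) : deriv profile q ≤ 0 := antitone_profile.deriv_nonpos

/-- Such `q`, including the endpoint `1`, are global minima of the nonnegative profile. -/
lemma deriv_profile_eq_zero {q : ℝ} (h : 1 ≤ q) : deriv profile q = 0 :=
  IsLocalMin.deriv_eq_zero (Eventually.of_forall fun y => by
    rw [profile_eq_zero h]; exact profile_nonneg y)

lemma deriv_deriv_profile_eq_zero {q : ℝ} (h : 1 ≤ q) : deriv (deriv profile) q = 0 :=
  IsLocalMax.deriv_eq_zero (Eventually.of_forall fun y => by
    rw [deriv_profile_eq_zero h]; exact deriv_profile_nonpos y)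

/-- The profile of the Laplacian of `profile (|x|²)`. -/
def lapProfile (N : ℕ) (q : ℝ) : ℝ := 4 * q * deriv (deriv profile) q + 2 * N * deriv profile q

lemma continuous_lapProfile : Continuous (lapProfile N) := by
  have h1 := contDiff_deriv_deriv_profile.continuous
  have h2 := contDiff_deriv_profile.continuous
  unfold lapProfile
  fun_prop

lemma lapProfile_eq_zero {q : ℝ} (h : 1 ≤ q) : lapProfile N q = 0 := by
  simp [lapProfile, deriv_profile_eq_zero h, deriv_deriv_profile_eq_zero h]

lemma exists_bound_of_eq_zero {f : ℝ → ℝ} (hf : Continuous f) (h : ∀ q, 1 ≤ q → f q = 0) :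
    ∃ C, 0 ≤ C ∧ ∀ q, 0 ≤ q → |f q| ≤ C := by
  obtain ⟨C, hC⟩ := (isCompact_Icc (a := (0 : ℝ)) (b := 1)).exists_bound_of_continuousOn
    hf.continuousOn
  have hC0 : 0 ≤ C := (norm_nonneg _).trans (hC 0 (by simp))
  refine ⟨C, hC0, fun q hq => ?_⟩
  rcases le_total q 1 with h1 | h1
  · exact hC q ⟨hq, h1⟩
  · rw [h q h1, abs_zero]; exact hC0

/-- A radial bump supported in the ball of radius `s` around `x`. -/
def radialBump (x : Eucl N) (s : ℝ) (y : Eucl N) : ℝ := profile (‖y - x‖ ^ 2 / s ^ 2)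

lemma hasFDerivAt_norm_sub_sq (x : Eucl N) (s : ℝ) (y : Eucl N) :
    HasFDerivAt (fun y => ‖y - x‖ ^ 2 / s ^ 2) ((2 / s ^ 2) • innerSL ℝ (y - x)) y := by
  have h := ((hasFDerivAt_id (𝕜 := ℝ) y).sub_const x).norm_sq.mul_const (s ^ 2)⁻¹
  simp only [id, ← div_eq_mul_inv] at h
  refine h.congr_fderiv ?_
  ext v
  simp
  ring

lemma contDiff_radialBump (x : Eucl N) (s : ℝ) : ContDiff ℝ ∞ (radialBump x s) :=
  contDiff_profile.comp (((contDiff_id.sub contDiff_const).norm_sq ℝ).div_const _)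

lemma one_le_ratio {x y : Eucl N} {s : ℝ} (hs : 0 < s) (h : s ≤ ‖y - x‖) :
    1 ≤ ‖y - x‖ ^ 2 / s ^ 2 := by
  rw [one_le_div (by positivity)]
  gcongr

lemma hasCompactSupport_radialBump (x : Eucl N) {s : ℝ} (hs : 0 < s) :
    HasCompactSupport (radialBump x s) := by
  refine HasCompactSupport.intro (isCompact_closedBall x s) fun y hy => ?_
  rw [Metric.mem_closedBall, dist_eq_norm, not_le] at hy
  exact profile_eq_zero (one_le_ratio hs hy.le)

lemma lap_radialBump (x : Eucl N) (s : ℝ) (y : Eucl N) :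
    lap (radialBump x s) y = (s ^ 2)⁻¹ * lapProfile N (‖y - x‖ ^ 2 / s ^ 2) := by
  have h1 : ∀ v y, fderiv ℝ (radialBump x s) y v =
      deriv profile (‖y - x‖ ^ 2 / s ^ 2) * (2 / s ^ 2 * ⟪y - x, v⟫) := by
    intro v y
    have hd := (contDiff_profile.differentiable (by simp) (‖y - x‖ ^ 2 / s ^ 2)).hasDerivAt
    have := hd.comp_hasFDerivAt y (hasFDerivAt_norm_sub_sq x s y)
    have h2 : fderiv ℝ (radialBump x s) y = _ := this.fderiv
    rw [h2]
    simp [inner_sub_left]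
  have h3 : ∀ v y, fderiv ℝ (fun y => fderiv ℝ (radialBump x s) y v) y v =
      deriv (deriv profile) (‖y - x‖ ^ 2 / s ^ 2) * (2 / s ^ 2 * ⟪y - x, v⟫) ^ 2 +
      deriv profile (‖y - x‖ ^ 2 / s ^ 2) * (2 / s ^ 2 * ⟪v, v⟫) := by
    intro v y
    simp only [h1]
    have hd := (contDiff_deriv_profile.differentiable (by simp) (‖y - x‖ ^ 2 / s ^ 2)).hasDerivAt
    have g1 := hd.comp_hasFDerivAt y (hasFDerivAt_norm_sub_sq x s y)
    have g2 : HasFDerivAt (fun y => 2 / s ^ 2 * ⟪y - x, v⟫) ((2 / s ^ 2) • innerSL ℝ v) y := by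
      have := (((innerSL ℝ v).hasFDerivAt (x := y - x)).comp y
        ((hasFDerivAt_id (𝕜 := ℝ) y).sub_const x)).const_mul (2 / s ^ 2)
      refine (this.congr_fderiv ?_).congr_of_eventuallyEq (Eventually.of_forall fun y => ?_)
      · ext; simp
      · simp [real_inner_comm]
    have g3 := (g1.mul g2).fderiv
    refine (congrArg (fun L => L v) g3).trans ?_
    simp [inner_sub_left]
    ring
  simp only [lap, h3, Finset.sum_add_distrib, ← Finset.mul_sum, mul_pow]
  have e1 : ∑ j, ⟪y - x, stdVec j⟫ ^ 2 = ‖y - x‖ ^ 2 := by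
    simp [EuclideanSpace.norm_sq_eq, inner_stdVec]
  have e2 : ∑ j : Fin N, ⟪(stdVec j : Eucl N), stdVec j⟫ = N := by
    simp [norm_stdVec]
  rw [e1, e2, lapProfile]
  by_cases hs : s = 0
  · simp [hs]
  · field_simp
    ring

/-- The mean value kernel of radius `s` around `x`. -/
def meanKernel (x : Eucl N) (s : ℝ) (y : Eucl N) : ℝ :=
  (s ^ N)⁻¹ * (-2 * deriv profile (‖y - x‖ ^ 2 / s ^ 2))

lemma meanKernel_nonneg (x : Eucl N) {s : ℝ} (hs : 0 < s) (y : Eucl N) :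
    0 ≤ meanKernel x s y := by
  have := deriv_profile_nonpos (‖y - x‖ ^ 2 / s ^ 2)
  exact mul_nonneg (by positivity) (by linarith)

lemma continuous_meanKernel (x : Eucl N) (s : ℝ) : Continuous (meanKernel x s) := by
  have := contDiff_deriv_profile.continuous
  unfold meanKernel
  fun_prop

lemma meanKernel_eq_zero {x y : Eucl N} {s : ℝ} (hs : 0 < s) (h : s ≤ ‖y - x‖) :
    meanKernel x s y = 0 := by
  rw [meanKernel, deriv_profile_eq_zero (one_le_ratio hs h)]
  simp

lemma hasCompactSupport_meanKernel (x : Eucl N) {s : ℝ} (hs : 0 < s) :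
    HasCompactSupport (meanKernel x s) := by
  refine HasCompactSupport.intro (isCompact_closedBall x s) fun y hy => ?_
  rw [Metric.mem_closedBall, dist_eq_norm, not_le] at hy
  exact meanKernel_eq_zero hs hy.le

lemma hasDerivAt_inv_pow (n : ℕ) {s : ℝ} (hs : s ≠ 0) :
    HasDerivAt (fun s : ℝ => (s ^ n)⁻¹) (-n * (s ^ (n + 1))⁻¹) s := by
  have h := (hasDerivAt_pow n s).inv (pow_ne_zero n hs)
  refine h.congr_deriv ?_
  rcases n with _ | n
  · simp
  · simp only [Nat.add_sub_cancel]
    field_simp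
    ring

/-- The kernel is designed for this: by `lap_radialBump` its `s`-derivative is `s^(1-N) Δ(radialBump
x s)`, the Laplacian of a nonnegative test function, to which `-Δw ≤ 1` applies. -/
lemma hasDerivAt_meanKernel (x y : Eucl N) {s : ℝ} (hs : s ≠ 0) :
    HasDerivAt (fun s => meanKernel x s y)
      ((s ^ (N + 1))⁻¹ * lapProfile N (‖y - x‖ ^ 2 / s ^ 2)) s := by
  have h1 := hasDerivAt_inv_pow N hs
  have h2 : HasDerivAt (fun s : ℝ => ‖y - x‖ ^ 2 / s ^ 2)
      (‖y - x‖ ^ 2 * (-(2 : ℕ) * (s ^ (2 + 1))⁻¹)) s := (hasDerivAt_inv_pow 2 hs).const_mul _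
  have hd := (contDiff_deriv_profile.differentiable (by simp) (‖y - x‖ ^ 2 / s ^ 2)).hasDerivAt
  have h3 := (hd.comp s h2).const_mul (-2 : ℝ)
  refine (h1.mul h3).congr_deriv ?_
  simp only [lapProfile, Function.comp_apply]
  push_cast
  field_simp
  ring

lemma volume_closedBall_toReal (x : Eucl N) {s : ℝ} (hs : 0 ≤ s) :
    (volume (Metric.closedBall x s)).toReal =
      s ^ N * (volume (Metric.ball (0 : Eucl N) 1)).toReal := by
  rw [Measure.addHaar_closedBall _ _ hs, ENNReal.toReal_mul, ENNReal.toReal_ofReal (by positivity)]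
  simp

lemma integral_radialBump_le (x : Eucl N) {s : ℝ} (hs : 0 < s) :
    ∫ y, radialBump x s y ≤ s ^ N * (volume (Metric.ball (0 : Eucl N) 1)).toReal := by
  rw [← volume_closedBall_toReal x hs.le, ← measureReal_def,
    ← integral_indicator_one Metric.isClosed_closedBall.measurableSet]
  refine integral_mono ((contDiff_radialBump x s).continuous.integrable_of_hasCompactSupport
    (hasCompactSupport_radialBump x hs)) ?_ fun y => ?_
  · exact (integrable_indicator_iff Metric.isClosed_closedBall.measurableSet).2
      (integrableOn_const measure_closedBall_lt_top.ne)
  · by_cases hy : y ∈ Metric.closedBall x s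
    · rw [Set.indicator_of_mem hy]; exact profile_le_one _
    · rw [Set.indicator_of_notMem hy]
      rw [Metric.mem_closedBall, dist_eq_norm, not_le] at hy
      exact (profile_eq_zero (one_le_ratio hs hy.le)).le

/-- A function between `0` and `1` with `-Δw ≤ 1` in the sense of distributions. -/
structure IsBoundedSubsolution (w : Eucl N → ℝ) : Prop where
  meas : AEStronglyMeasurable w volume
  nonneg : ∀ᵐ x, 0 ≤ w x
  le_one : ∀ᵐ x, w x ≤ 1
  sub : ∀ φ : Eucl N → ℝ, ContDiff ℝ ∞ φ → HasCompactSupport φ → (∀ x, 0 ≤ φ x) →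
    -∫ x, w x * lap φ x ≤ ∫ x, φ x

namespace IsBoundedSubsolution

variable {w : Eucl N → ℝ}

lemma norm_le (hw : IsBoundedSubsolution w) : ∀ᵐ x, ‖w x‖ ≤ 1 := by
  filter_upwards [hw.nonneg, hw.le_one] with x h1 h2
  rwa [Real.norm_eq_abs, abs_of_nonneg h1]

lemma integrable_mul (hw : IsBoundedSubsolution w) {g : Eucl N → ℝ} (hg : Integrable g volume) :
    Integrable (fun y => w y * g y) volume :=
  hg.bdd_mul hw.meas hw.norm_le

lemma integrable_meanKernel (x : Eucl N) {s : ℝ} (hs : 0 < s) :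
    Integrable (meanKernel x s) volume :=
  (continuous_meanKernel x s).integrable_of_hasCompactSupport (hasCompactSupport_meanKernel x hs)

lemma hasDerivAt_mean (hw : IsBoundedSubsolution w) (x : Eucl N) {s : ℝ} (hs : 0 < s) :
    HasDerivAt (fun s => ∫ y, w y * meanKernel x s y)
      (∫ y, w y * ((s ^ (N + 1))⁻¹ * lapProfile N (‖y - x‖ ^ 2 / s ^ 2))) s := by
  obtain ⟨C, hC0, hC⟩ := exists_bound_of_eq_zero (continuous_lapProfile (N := N))
    fun q hq => lapProfile_eq_zero hq
  -- Keeping the radius between `s / 2` and `2 s` gives one dominating function for all nearby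
  -- derivatives.
  have hball : ∀ t ∈ Metric.ball s (s / 2), s / 2 < t ∧ t < 2 * s := by
    intro t ht
    rw [Metric.mem_ball, Real.dist_eq, abs_lt] at ht
    constructor <;> linarith
  refine (hasDerivAt_integral_of_dominated_loc_of_deriv_le
    (F := fun s y => w y * meanKernel x s y)
    (F' := fun s y => w y * ((s ^ (N + 1))⁻¹ * lapProfile N (‖y - x‖ ^ 2 / s ^ 2)))
    (bound := (Metric.closedBall x (2 * s)).indicator fun _ => ((s / 2) ^ (N + 1))⁻¹ * C)
    (Metric.ball_mem_nhds s (half_pos hs)) ?_ (hw.integrable_mul (integrable_meanKernel x hs))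
    ?_ ?_ ?_ ?_).2
  · exact Eventually.of_forall fun t => hw.meas.mul (continuous_meanKernel x t).aestronglyMeasurable
  · refine hw.meas.mul (Continuous.aestronglyMeasurable ?_)
    have := continuous_lapProfile (N := N)
    fun_prop
  · filter_upwards [hw.norm_le] with y hy t ht
    obtain ⟨h1, h2⟩ := hball t ht
    have ht0 : 0 < t := by linarith
    rw [norm_mul, norm_mul, norm_inv, norm_pow, Real.norm_of_nonneg ht0.le]
    by_cases hyb : y ∈ Metric.closedBall x (2 * s)
    · rw [Set.indicator_of_mem hyb]
      calc _ ≤ 1 * ((t ^ (N + 1))⁻¹ * C) := by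
            gcongr
            exact hC _ (by positivity)
        _ ≤ _ := by
            rw [one_mul]
            gcongr
    · rw [Set.indicator_of_notMem hyb]
      rw [Metric.mem_closedBall, dist_eq_norm, not_le] at hyb
      rw [lapProfile_eq_zero (one_le_ratio ht0 (by linarith))]
      simp
  · exact (integrable_indicator_iff Metric.isClosed_closedBall.measurableSet).2
      (integrableOn_const measure_closedBall_lt_top.ne)
  · refine Eventually.of_forall fun y t ht => ?_
    exact (hasDerivAt_meanKernel x y (by linarith [(hball t ht).1] : (0 : ℝ) < t).ne').const_mul _

lemma deriv_mean_ge (hw : IsBoundedSubsolution w) (x : Eucl N) {s : ℝ} (hs : 0 < s) :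
    -(s * (volume (Metric.ball (0 : Eucl N) 1)).toReal) ≤
      ∫ y, w y * ((s ^ (N + 1))⁻¹ * lapProfile N (‖y - x‖ ^ 2 / s ^ 2)) := by
  have h1 := hw.sub _ (contDiff_radialBump x s) (hasCompactSupport_radialBump x hs)
    (fun y => profile_nonneg _)
  have h2 := h1.trans (integral_radialBump_le x hs)
  have e : ∫ y, w y * ((s ^ (N + 1))⁻¹ * lapProfile N (‖y - x‖ ^ 2 / s ^ 2)) =
      (s * (s ^ N)⁻¹) * ∫ y, w y * lap (radialBump x s) y := by
    rw [← integral_const_mul]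
    refine integral_congr_ae (Eventually.of_forall fun y => ?_)
    simp only [lap_radialBump]
    field_simp
    ring
  rw [e]
  have h3 : -(s ^ N * (volume (Metric.ball (0 : Eucl N) 1)).toReal) ≤
      ∫ y, w y * lap (radialBump x s) y := by linarith
  calc _ = (s * (s ^ N)⁻¹) * -(s ^ N * (volume (Metric.ball (0 : Eucl N) 1)).toReal) := by
        field_simp
    _ ≤ _ := by gcongr

/-- With `V` the volume of the unit ball, the mean has derivative at least `-s V`, so adding `V s²`
makes it nondecreasing. -/
lemma mean_le (hw : IsBoundedSubsolution w) (x : Eucl N) {ε r : ℝ} (hε : 0 < ε) (hr : ε ≤ r) :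
    ∫ y, w y * meanKernel x ε y ≤ (∫ y, w y * meanKernel x r y) +
      (volume (Metric.ball (0 : Eucl N) 1)).toReal * r ^ 2 := by
  set V := (volume (Metric.ball (0 : Eucl N) 1)).toReal with hV
  have hV0 : 0 ≤ V := ENNReal.toReal_nonneg
  have hd : ∀ s, 0 < s → HasDerivAt (fun s => (∫ y, w y * meanKernel x s y) + V * s ^ 2)
      ((∫ y, w y * ((s ^ (N + 1))⁻¹ * lapProfile N (‖y - x‖ ^ 2 / s ^ 2))) +
        V * ((2 : ℕ) * s ^ (2 - 1))) s := fun s hs =>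
    (hw.hasDerivAt_mean x hs).add ((hasDerivAt_pow 2 s).const_mul V)
  have hm : MonotoneOn (fun s => (∫ y, w y * meanKernel x s y) + V * s ^ 2) (Set.Icc ε r) := by
    refine monotoneOn_of_deriv_nonneg (convex_Icc ε r) (fun s hs =>
      (hd s (hε.trans_le hs.1)).continuousAt.continuousWithinAt) (fun s hs => ?_) fun s hs => ?_
    · rw [interior_Icc] at hs
      exact (hd s (hε.trans hs.1)).differentiableAt.differentiableWithinAt
    · rw [interior_Icc] at hs
      have hs0 := hε.trans hs.1
      rw [(hd s hs0).deriv]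
      have := hw.deriv_mean_ge x hs0
      rw [← hV] at this
      norm_num
      nlinarith [mul_nonneg hs0.le hV0]
  have := hm (Set.left_mem_Icc.2 hr) (Set.right_mem_Icc.2 hr) hr
  simp only at this
  nlinarith [mul_nonneg hV0 (sq_nonneg ε)]

end IsBoundedSubsolution

/-- The mass of the mean value kernels. -/
def meanMass (N : ℕ) : ℝ := ∫ z : Eucl N, -2 * deriv profile (‖z‖ ^ 2)

lemma integral_meanKernel (x : Eucl N) {s : ℝ} (hs : 0 < s) :
    ∫ y, meanKernel x s y = meanMass N := by
  have h1 : ∀ y, meanKernel x s y = (fun z => (s ^ N)⁻¹ *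
      ((fun z : Eucl N => -2 * deriv profile (‖z‖ ^ 2)) (s⁻¹ • z))) (y - x) := by
    intro y
    simp only [meanKernel, norm_smul, norm_inv, Real.norm_of_nonneg hs.le, mul_pow, inv_pow]
    rw [div_eq_inv_mul]
  simp only [h1]
  rw [integral_sub_right_eq_self (fun z => (s ^ N)⁻¹ *
      ((fun z : Eucl N => -2 * deriv profile (‖z‖ ^ 2)) (s⁻¹ • z))) x, integral_const_mul,
    Measure.integral_comp_smul volume (fun z : Eucl N => -2 * deriv profile (‖z‖ ^ 2)) s⁻¹,
    meanMass]
  simp only [finrank_euclideanSpace, Fintype.card_fin, smul_eq_mul, inv_pow, inv_inv]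
  rw [abs_of_pos (by positivity), inv_mul_cancel_left₀ (by positivity)]

/-- The profile falls from a positive value to `0` on `[0, 1]`, so its derivative is negative at
some `q`; `N ≥ 1` supplies a vector of length `√q`. -/
lemma meanMass_pos (hN : 1 ≤ N) : 0 < meanMass N := by
  obtain ⟨q, hq, hq'⟩ := exists_deriv_eq_slope profile (zero_lt_one (α := ℝ))
    contDiff_profile.continuous.continuousOn
    (contDiff_profile.differentiable (by simp)).differentiableOn
  have h0 : 0 < profile 0 := expNegInvGlue.pos_of_pos (by norm_num)
  rw [profile_eq_zero le_rfl] at hq'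
  have e : ∀ z : Eucl N, -2 * deriv profile (‖z‖ ^ 2) = meanKernel 0 1 z := by
    intro z; simp [meanKernel]
  simp only [meanMass, e]
  refine (continuous_meanKernel 0 1).integral_pos_of_hasCompactSupport_nonneg_nonzero
    (x := √q • stdVec (⟨0, hN⟩ : Fin N)) (hasCompactSupport_meanKernel 0 one_pos)
    (fun z => meanKernel_nonneg 0 one_pos z) ?_
  rw [← e, norm_smul, norm_stdVec, mul_one, Real.norm_of_nonneg (Real.sqrt_nonneg q),
    Real.sq_sqrt hq.1.le, hq']
  have : -2 * ((0 - profile 0) / (1 - 0)) = 2 * profile 0 := by ring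
  rw [this]
  positivity

lemma meanKernel_le {C : ℝ} (hC : ∀ q, 0 ≤ q → |deriv profile q| ≤ C) (x : Eucl N)
    {s : ℝ} (hs : 0 < s) (y : Eucl N) : meanKernel x s y ≤
      (Metric.closedBall x s).indicator (fun _ => 2 * C * (s ^ N)⁻¹) y := by
  by_cases hy : y ∈ Metric.closedBall x s
  · rw [Set.indicator_of_mem hy, meanKernel, mul_comm (2 * C)]
    have := (abs_le.1 (hC (‖y - x‖ ^ 2 / s ^ 2) (by positivity))).1
    exact mul_le_mul_of_nonneg_left (by linarith) (by positivity)
  · rw [Set.indicator_of_notMem hy]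
    rw [Metric.mem_closedBall, dist_eq_norm, not_le] at hy
    exact (meanKernel_eq_zero hs hy.le).le

lemma integral_mul_meanKernel_le {C : ℝ}
    (hC : ∀ q, 0 ≤ q → |deriv profile q| ≤ C) (x : Eucl N) {s : ℝ} (hs : 0 < s) {f : Eucl N → ℝ}
    (hf : LocallyIntegrable f volume) (hf0 : ∀ᵐ y, 0 ≤ f y) :
    ∫ y, f y * meanKernel x s y ≤ 2 * C * (s ^ N)⁻¹ * ∫ y in Metric.closedBall x s, f y := by
  rw [← integral_const_mul, ← integral_indicator Metric.isClosed_closedBall.measurableSet]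
  refine integral_mono_of_nonneg ?_ ?_ ?_
  · filter_upwards [hf0] with y hy using mul_nonneg hy (meanKernel_nonneg x hs y)
  · exact (integrable_indicator_iff Metric.isClosed_closedBall.measurableSet).2
      ((hf.integrableOn_isCompact (isCompact_closedBall x s)).const_mul _)
  · filter_upwards [hf0] with y hy
    have h1 := mul_le_mul_of_nonneg_left (meanKernel_le hC x hs y) hy
    refine h1.trans_eq ?_
    by_cases hyb : y ∈ Metric.closedBall x s
    · simp only [Set.indicator_of_mem hyb]; ring
    · simp only [Set.indicator_of_notMem hyb]; ring

/-- Lebesgue differentiation: the kernels have constant mass and are dominated by multiples of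
normalized indicators of balls. -/
lemma ae_tendsto_mean {w : Eucl N → ℝ} (hw : LocallyIntegrable w volume) :
    ∀ᵐ x, Tendsto (fun s => ∫ y, w y * meanKernel x s y) (𝓝[>] 0) (𝓝 (meanMass N * w x)) := by
  obtain ⟨C, -, hC⟩ := exists_bound_of_eq_zero contDiff_deriv_profile.continuous
    fun q hq => deriv_profile_eq_zero hq
  set V := (volume (Metric.ball (0 : Eucl N) 1)).toReal with hV
  filter_upwards [IsUnifLocDoublingMeasure.ae_tendsto_average_norm_sub volume hw 1] with x hx
  have h1 := hx (fun _ : ℝ => x) (fun s => s) tendsto_id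
    (by filter_upwards [self_mem_nhdsWithin] with s hs
        simpa using (le_of_lt hs : (0 : ℝ) ≤ s))
  rw [tendsto_iff_norm_sub_tendsto_zero]
  refine squeeze_zero' (Eventually.of_forall fun _ => norm_nonneg _) ?_
    (by simpa using h1.const_mul (2 * C * V))
  filter_upwards [self_mem_nhdsWithin] with s hs
  have hs : 0 < s := hs
  have hki := IsBoundedSubsolution.integrable_meanKernel x hs
  have hwi : Integrable (fun y => w y * meanKernel x s y) volume := by
    have := hw.integrable_smul_right_of_hasCompactSupport (continuous_meanKernel x s)
      (hasCompactSupport_meanKernel x hs)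
    simpa only [smul_eq_mul] using this
  have e : (∫ y, w y * meanKernel x s y) - meanMass N * w x =
      ∫ y, (w y - w x) * meanKernel x s y := by
    rw [← integral_meanKernel x hs, mul_comm, ← integral_const_mul,
      ← integral_sub hwi (hki.const_mul _)]
    simp only [sub_mul]
  rw [e]
  refine (norm_integral_le_integral_norm _).trans ?_
  have hfl : LocallyIntegrable (fun y => ‖w y - w x‖) volume :=
    fun y => ((hw.sub (locallyIntegrable_const (w x))) y).norm
  have h2 := integral_mul_meanKernel_le hC x hs hfl (Eventually.of_forall fun y => norm_nonneg _)
  simp only [norm_mul, Real.norm_of_nonneg (meanKernel_nonneg x hs _)]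
  refine h2.trans_eq ?_
  rw [setAverage_eq, measureReal_def, volume_closedBall_toReal x hs.le, smul_eq_mul, ← hV]
  have hV0 : V ≠ 0 := (ENNReal.toReal_pos (Metric.measure_ball_pos _ _ one_pos).ne'
    measure_ball_lt_top.ne).ne'
  field_simp
  simp only [Real.norm_eq_abs]

/-- The mean at radius `ε` is compared with the mean at radius `r`, and then `ε → 0` at a Lebesgue
point. The constant depends neither on `w` nor on `r`. -/
lemma IsBoundedSubsolution.mean_value (N : ℕ) : ∃ K : ℝ, 0 < K ∧
    ∀ w : Eucl N → ℝ, IsBoundedSubsolution w → ∀ r : ℝ, 0 < r → ∀ᵐ x,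
      meanMass N * w x ≤ K * (r ^ N)⁻¹ * (∫ y in Metric.closedBall x r, w y) + K * r ^ 2 := by
  obtain ⟨C, hC0, hC⟩ := exists_bound_of_eq_zero contDiff_deriv_profile.continuous
    fun q hq => deriv_profile_eq_zero hq
  set V := (volume (Metric.ball (0 : Eucl N) 1)).toReal with hV
  have hV0 : 0 ≤ V := ENNReal.toReal_nonneg
  refine ⟨2 * C + V + 1, by positivity, fun w hw r hr => ?_⟩
  have hwl : LocallyIntegrable w volume := by
    refine (locallyIntegrable_const (1 : ℝ)).mono hw.meas ?_
    filter_upwards [hw.norm_le] with x hx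
    simpa using hx
  filter_upwards [ae_tendsto_mean hwl] with x hx
  have h1 : meanMass N * w x ≤ (∫ y, w y * meanKernel x r y) + V * r ^ 2 := by
    refine le_of_tendsto hx ?_
    filter_upwards [Ioo_mem_nhdsGT hr] with ε hε
    exact hw.mean_le x hε.1 hε.2.le
  have h2 := integral_mul_meanKernel_le hC x hr hwl hw.nonneg
  have h3 : 0 ≤ (r ^ N)⁻¹ * ∫ y in Metric.closedBall x r, w y :=
    mul_nonneg (by positivity) (integral_nonneg_of_ae (ae_restrict_of_ae hw.nonneg))
  nlinarith [mul_nonneg hV0 h3, mul_nonneg hC0 (sq_nonneg r), sq_nonneg r]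

end MeanValue

/-! ### The two implications. -/

section Main

variable {N : ℕ} {μ : Measure (Eucl N)} {Ω : Set (Eucl N)}

lemma IsTorsionLimit.exists_seq (hμ : IsCapacitary μ) {w : Eucl N → ℝ}
    (hw : IsTorsionLimit μ w) : ∃ u : ℕ → H1 N,
      (∀ n : ℕ, IsWeakSolution μ (Metric.ball 0 (n + 1 : ℝ)) (fun _ => 1) (u n)) ∧
      (∀ᵐ x, ∀ n, 0 ≤ (u n).toFun x ∧ (u n).toFun x ≤ w x) ∧
      ∀ᵐ x, Tendsto (fun n => (u n).toFun x) atTop (𝓝 (w x)) := by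
  obtain ⟨u, hu, hlim⟩ := hw
  -- The shift by one keeps every radius positive, as the definition of the limit requires.
  have hs : ∀ n : ℕ, IsWeakSolution μ (Metric.ball 0 (n + 1 : ℝ)) (fun _ => 1) (u (n + 1 : ℝ)) :=
    fun n => hu _ (by positivity)
  have hl := hlim (fun n : ℕ => (n + 1 : ℝ))
    (tendsto_atTop_add_const_right _ _ tendsto_natCast_atTop_atTop)
  refine ⟨fun n => u (n + 1 : ℝ), hs, ?_, hl⟩
  have h0 : ∀ᵐ x, ∀ n : ℕ, 0 ≤ (u (n + 1 : ℝ)).toFun x :=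
    ae_all_iff.2 fun n => ae_of_qe ((hs n).qe_nonneg hμ)
  have hm : ∀ᵐ x, ∀ n : ℕ, (u (n + 1 : ℝ)).toFun x ≤ (u ((n + 1 : ℕ) + 1 : ℝ)).toFun x :=
    ae_all_iff.2 fun n => (hs n).ae_mono hμ (Metric.ball_subset_ball (by push_cast; linarith))
      (hs (n + 1))
  filter_upwards [h0, hm, hl] with x y0 ym yl n
  exact ⟨y0 n, (monotone_nat_of_le_succ ym).ge_of_tendsto yl n⟩

lemma IsTorsionLimit.compactEmbedding (hμ : IsCapacitary μ) {w : Eucl N → ℝ}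
    (hw : IsTorsionLimit μ w)
    (h : Tendsto (fun R : ℝ => eLpNorm ((Metric.ball (0 : Eucl N) R)ᶜ.indicator w) ⊤ volume)
      atTop (𝓝 0)) : CompactEmbedding μ := by
  obtain ⟨u, hu, hle, -⟩ := hw.exists_seq hμ
  refine compactEmbedding_of_tail fun C ε hε => ?_
  -- Chosen so that the tail bound `2 δ (2 + 2N) (C + 1)` equals `ε`; `C + 1` avoids division by
  -- zero.
  set δ : ℝ := ε / ((2 * (2 + 2 * N)) * (C + 1)) with hδ
  have hδ0 : 0 < δ := by positivity
  obtain ⟨ρ, hρ⟩ := ((tendsto_order.1 h).2 (ENNReal.ofReal δ) (by simpa using hδ0)).exists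
  refine ⟨ρ, fun v hv hvC => ?_⟩
  have hwρ : ∀ᵐ x, x ∉ Metric.ball (0 : Eucl N) ρ → w x ≤ δ := by
    rw [eLpNorm_exponent_top] at hρ
    filter_upwards [enorm_ae_le_eLpNormEssSup
      ((Metric.ball (0 : Eucl N) ρ)ᶜ.indicator w) volume] with x hx hxρ
    have h1 := hx.trans hρ.le
    rw [Set.indicator_of_mem hxρ, Real.enorm_eq_ofReal_abs,
      ENNReal.ofReal_le_ofReal_iff hδ0.le] at h1
    exact (le_abs_self _).trans h1
  refine (lintegral_tail_le hμ hδ0 (fun n => ⟨u n, hu n, ?_⟩) hv).trans ?_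
  · filter_upwards [hwρ, hle] with x h1 h2 hx using (h2 n).2.trans (h1 hx)
  · calc _ ≤ ENNReal.ofReal (2 * δ * (2 + 2 * N)) * C := by gcongr
      _ ≤ ENNReal.ofReal (2 * δ * (2 + 2 * N)) * ENNReal.ofReal (C + 1) := by
          gcongr
          rw [← ENNReal.ofReal_coe_nnreal]
          exact ENNReal.ofReal_le_ofReal (by linarith)
      _ = ENNReal.ofReal ε := by
          rw [← ENNReal.ofReal_mul (by positivity), hδ]
          congr 1
          field_simp
      _ = ε := ENNReal.ofReal_coe_nnreal

lemma IsWeakSolution.isBoundedSubsolution (hμ : IsCapacitary μ) (hΩ : volume Ω ≠ ⊤) {u : H1 N}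
    (hu : IsWeakSolution μ Ω (fun _ => 1) u) : IsBoundedSubsolution u.toFun where
  meas := u.memLp_toFun.1
  nonneg := ae_of_qe (hu.qe_nonneg hμ)
  le_one := hu.ae_le_one hμ hΩ
  sub _ hφ hc h0 := hu.subsolution hμ hφ hc h0

/-- A Lipschitz cutoff, equal to `1` on the ball of radius `r` around `x` and vanishing outside
the ball of radius `2 r`. -/
def plateau (r : ℝ) (x y : Eucl N) : ℝ := max 0 (min 1 (2 - ‖y - x‖ / r))

lemma plateau_nonneg (r : ℝ) (x y : Eucl N) : 0 ≤ plateau r x y := le_max_left _ _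

lemma plateau_le_one (r : ℝ) (x y : Eucl N) : plateau r x y ≤ 1 :=
  max_le zero_le_one (min_le_left _ _)

lemma plateau_eq_one {r : ℝ} (hr : 0 < r) {x y : Eucl N} (h : y ∈ Metric.closedBall x r) :
    plateau r x y = 1 := by
  rw [Metric.mem_closedBall, dist_eq_norm] at h
  have : ‖y - x‖ / r ≤ 1 := (div_le_one hr).2 h
  rw [plateau, min_eq_left (by linarith), max_eq_right zero_le_one]

lemma plateau_eq_zero {r : ℝ} (hr : 0 < r) {x y : Eucl N} (h : 2 * r ≤ ‖y - x‖) :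
    plateau r x y = 0 := by
  have : 2 ≤ ‖y - x‖ / r := (le_div_iff₀ hr).2 h
  rw [plateau, min_eq_right (by linarith), max_eq_left (by linarith)]

lemma abs_plateau_sub_le {r : ℝ} (hr : 0 < r) (x y z : Eucl N) :
    |plateau r x y - plateau r x z| ≤ ‖y - z‖ / r := by
  unfold plateau
  refine (abs_max_sub_max_le_max _ _ _ _).trans ?_
  rw [sub_self, abs_zero, max_eq_right (abs_nonneg _)]
  refine (abs_min_sub_min_le_max _ _ _ _).trans ?_
  rw [sub_self, abs_zero, max_eq_right (abs_nonneg _),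
    show 2 - ‖y - x‖ / r - (2 - ‖z - x‖ / r) = -((‖y - x‖ - ‖z - x‖) / r) by ring, abs_neg,
    abs_div, abs_of_pos hr]
  gcongr
  refine (abs_norm_sub_norm_le _ _).trans_eq ?_
  congr 1
  abel

lemma continuous_plateau (r : ℝ) (x : Eucl N) : Continuous (plateau r x) := by
  unfold plateau; fun_prop

lemma exists_mul_mem_H1mu (hμ : IsCapacitary μ) {u : H1 N} (hu : u ∈ H1mu μ) {η : Eucl N → ℝ}
    (hη0 : ∀ y, 0 ≤ η y) (hη1 : ∀ y, η y ≤ 1) {L : ℝ} (hL : 0 ≤ L)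
    (hη : ∀ y z, |η y - η z| ≤ L * ‖y - z‖) (hc : Continuous η) :
    ∃ f ∈ H1mu μ, f.toFun = fun y => η y * u.toFun y := by
  obtain ⟨f, hf, hfm⟩ := exists_mem_H1mu_comp hμ hu hu (Φ := fun y a _ => η y * a) (L := 1 + L)
    ((hc.comp continuous_fst).mul continuous_snd.fst)
    (fun y a b => by
      rw [abs_mul, abs_of_nonneg (hη0 y)]
      nlinarith [mul_nonneg hL (abs_nonneg a), mul_nonneg hL (abs_nonneg b), abs_nonneg a,
        abs_nonneg b, mul_nonneg (sub_nonneg.2 (hη1 y)) (abs_nonneg a)])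
    (fun x y a b a' b' => by
      rw [show η y * a' - η x * a = η y * (a' - a) + (η y - η x) * a by ring]
      refine (abs_add_le _ _).trans ?_
      rw [abs_mul, abs_mul, abs_of_nonneg (hη0 y)]
      have h1 := mul_le_mul_of_nonneg_right (hη1 y) (abs_nonneg (a' - a))
      have h2 := mul_le_mul_of_nonneg_right (hη y x) (abs_nonneg a)
      have h3 := mul_nonneg (norm_nonneg (y - x)) (abs_nonneg a)
      have h4 := mul_nonneg (norm_nonneg (y - x)) (abs_nonneg b)
      nlinarith [mul_nonneg hL h4, mul_nonneg hL (abs_nonneg (a' - a)),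
        mul_nonneg hL (abs_nonneg (b' - b)), abs_nonneg (b' - b)])
  exact ⟨f, hfm, hf⟩

/-- With `η` the plateau, `|∇(ηu)|² = ∇u·∇(η²u) + u² |∇η|²`. Testing with `η²u` bounds the form by
`∫ η²u + ∫ u² |∇η|²`, and `0 ≤ u ≤ 1`. For increments the last term becomes `u u' (η' - η)²`, an
exact identity. -/
lemma IsWeakSolution.exists_localization (hμ : IsCapacitary μ) (hΩ : volume Ω ≠ ⊤) {u : H1 N}
    (hu : IsWeakSolution μ Ω (fun _ => 1) u) (x : Eucl N) {r : ℝ} (hr : 0 < r) :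
    ∃ f ∈ H1mu μ, (f.toFun = fun y => plateau r x y * u.toFun y) ∧
      f.form μ ≤ (1 + N * (r ^ 2)⁻¹) * (volume (Metric.closedBall x (3 * r))).toReal := by
  obtain ⟨hum, hu0⟩ := mem_H1muDirichlet_iff.1 hu.1
  have hp0 := plateau_nonneg r x
  have hp1 := plateau_le_one r x
  obtain ⟨f, hfm, hf⟩ := exists_mul_mem_H1mu hμ hum (η := plateau r x) hp0 hp1 (L := r⁻¹)
    (by positivity) (fun y z => (abs_plateau_sub_le hr x y z).trans_eq (div_eq_inv_mul _ _))
    (continuous_plateau r x)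
  obtain ⟨g, hgm, hg⟩ := exists_mul_mem_H1mu hμ hum (η := fun y => plateau r x y ^ 2)
    (fun y => sq_nonneg _) (fun y => pow_le_one₀ (hp0 y) (hp1 y)) (L := 2 * r⁻¹)
    (by positivity) (fun y z => by
      have h1 := abs_plateau_sub_le hr x y z
      rw [sq_sub_sq, abs_mul, abs_of_nonneg (add_nonneg (hp0 y) (hp0 z)), mul_assoc,
        ← div_eq_inv_mul]
      exact mul_le_mul (by linarith [hp1 y, hp1 z]) h1 (abs_nonneg _) zero_le_two)
    ((continuous_plateau r x).pow 2)
  have hgV : g ∈ H1muDirichlet μ Ω := by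
    refine mem_H1muDirichlet_iff.2 ⟨hgm, ?_⟩
    filter_upwards [hu0] with y hy hyΩ
    simp [hg, hy hyΩ]
  refine ⟨f, hfm, hf, ?_⟩
  have hB : MeasurableSet (Metric.closedBall x (3 * r)) := Metric.isClosed_closedBall.measurableSet
  have hi : ∀ c : ℝ, Integrable ((Metric.closedBall x (3 * r)).indicator fun _ => c) volume :=
    fun c => (integrable_indicator_iff hB).2 (integrableOn_const measure_closedBall_lt_top.ne)
  have hI : ∀ c : ℝ, ∫ y, (Metric.closedBall x (3 * r)).indicator (fun _ => c) y =
      c * (volume (Metric.closedBall x (3 * r))).toReal := fun c => by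
    rw [integral_indicator hB, setIntegral_const, measureReal_def, smul_eq_mul, mul_comm]
  have hnn := ae_of_qe (hu.qe_nonneg hμ)
  have hle := hu.ae_le_one hμ hΩ
  have h1 := H1.integral_grad_inner_le u g f f (hi (r ^ 2)⁻¹) fun j => by
    have ht : ∀ᶠ t : ℝ in 𝓝[≠] 0, |t| < r := by
      -- For `|t| < r`, a point outside the ball of radius `3r` and its translate both lie outside
      -- that of radius `2r`, where the plateau vanishes.
      refine nhdsWithin_le_nhds ?_
      filter_upwards [Metric.ball_mem_nhds (0 : ℝ) hr] with t ht
      simpa using ht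
    filter_upwards [ht] with t ht
    filter_upwards [hnn, hle, ae_comp_add hnn (t • stdVec j), ae_comp_add hle (t • stdVec j)]
      with y a0 a1 b0 b1
    simp only [hf, hg]
    set y' := y + t • stdVec j with hy'
    have hn : ‖y' - y‖ = |t| := by
      rw [hy', add_sub_cancel_left, norm_smul, norm_stdVec, mul_one, Real.norm_eq_abs]
    have key : u.toFun y * u.toFun y' * (plateau r x y' - plateau r x y) ^ 2 ≤
        t ^ 2 * (Metric.closedBall x (3 * r)).indicator (fun _ => (r ^ 2)⁻¹) y := by
      by_cases hyB : y ∈ Metric.closedBall x (3 * r)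
      · rw [Set.indicator_of_mem hyB]
        have h2 : (plateau r x y' - plateau r x y) ^ 2 ≤ t ^ 2 * (r ^ 2)⁻¹ := by
          have h3 := abs_plateau_sub_le hr x y' y
          rw [hn] at h3
          rw [← sq_abs, ← sq_abs t, ← div_eq_mul_inv, ← div_pow]
          exact pow_le_pow_left₀ (abs_nonneg _) h3 2
        have h4 : u.toFun y * u.toFun y' ≤ 1 := mul_le_one₀ a1 b0 b1
        calc _ ≤ 1 * (plateau r x y' - plateau r x y) ^ 2 := by gcongr
          _ ≤ _ := by rwa [one_mul]
      · rw [Set.indicator_of_notMem hyB]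
        rw [Metric.mem_closedBall, dist_eq_norm, not_le] at hyB
        have h5 : ‖y - x‖ ≤ ‖y' - x‖ + ‖y' - y‖ := by
          rw [norm_sub_rev y' y]
          calc ‖y - x‖ = ‖(y' - x) + (y - y')‖ := by congr 1; abel
            _ ≤ _ := norm_add_le _ _
        rw [plateau_eq_zero hr (by linarith : 2 * r ≤ ‖y - x‖),
          plateau_eq_zero hr (by linarith : 2 * r ≤ ‖y' - x‖)]
        simp
    nlinarith
  rw [hI] at h1
  have h2 := hu.eq hgV
  have e : ∀ y, f.toFun y * f.toFun y = u.toFun y * g.toFun y := fun y => by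
    simp only [hf, hg]; ring
  have h3 : ∫ y, g.toFun y ≤ 1 * (volume (Metric.closedBall x (3 * r))).toReal := by
    rw [← hI]
    refine integral_mono_of_nonneg ?_ (hi 1) ?_
    · filter_upwards [hnn] with y hy
      simp only [hg]
      exact mul_nonneg (sq_nonneg _) hy
    · filter_upwards [hnn, hle] with y hy hy1
      simp only [hg]
      by_cases hyB : y ∈ Metric.closedBall x (3 * r)
      · rw [Set.indicator_of_mem hyB]
        exact mul_le_one₀ (pow_le_one₀ (hp0 y) (hp1 y)) hy hy1
      · rw [Set.indicator_of_notMem hyB]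
        rw [Metric.mem_closedBall, dist_eq_norm, not_le] at hyB
        rw [plateau_eq_zero hr (by linarith)]
        simp
  simp only [H1.form, e]
  linarith

/-- The functions tend to zero pointwise, so every `L²` limit of a subsequence is zero, against the
lower bound on the norms. -/
lemma not_compactEmbedding {C δ : ℝ≥0} (hδ : 0 < δ) (h : ∀ n : ℕ, ∃ f ∈ H1mu μ,
    normSq μ f ≤ C ∧ (∀ x ∈ Metric.ball (0 : Eucl N) n, f.toFun x = 0) ∧
      δ ≤ eLpNorm f.toFun 2 volume) : ¬CompactEmbedding μ := by
  intro hc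
  choose f hfm hfC hf0 hfδ using h
  obtain ⟨a, -, φ, hφ, hlim⟩ := (hc C).tendsto_subseq
    (x := fun n => (f n).memLp_toFun.toLp (f n).toFun)
    (fun n => subset_closure ⟨f n, ⟨hfm n, hfC n⟩, rfl⟩)
  have ha : a = 0 := by
    obtain ⟨ψ, hψ, hae⟩ := (tendstoInMeasure_of_tendsto_Lp hlim).exists_seq_tendsto_ae
    refine (Lp.eq_zero_iff_ae_eq_zero).2 ?_
    have hco : ∀ᵐ x, ∀ n, (f n).memLp_toFun.toLp (f n).toFun x = (f n).toFun x :=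
      ae_all_iff.2 fun n => (f n).memLp_toFun.coeFn_toLp
    filter_upwards [hae, hco] with x hx hxc
    refine tendsto_nhds_unique hx (tendsto_const_nhds.congr' ?_)
    obtain ⟨m, hm⟩ := exists_nat_gt ‖x‖
    filter_upwards [eventually_ge_atTop m] with n hn
    have h1 : m ≤ φ (ψ n) := hn.trans ((hψ.id_le n).trans (hφ.id_le _))
    have h2 : x ∈ Metric.ball (0 : Eucl N) (φ (ψ n) : ℕ) := by
      rw [mem_ball_zero_iff]
      exact hm.trans_le (by exact_mod_cast h1)
    simp only [Function.comp_apply, hxc, hf0 _ x h2]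
    rfl
  rw [ha] at hlim
  have h1 := hlim.norm
  rw [norm_zero] at h1
  obtain ⟨n, hn⟩ := ((tendsto_order.1 h1).2 δ (by exact_mod_cast hδ)).exists
  simp only [Function.comp_apply, Lp.norm_toLp] at hn
  have h2 := ENNReal.toReal_mono (f (φ n)).memLp_toFun.2.ne (hfδ (φ n))
  rw [ENNReal.coe_toReal] at h2
  linarith

/-- Cauchy–Schwarz, obtained by integrating `(f - c / V)² ≥ 0`. -/
lemma sq_div_le_setIntegral_sq {s : Set (Eucl N)} (hs0 : 0 < volume s) (hs : volume s ≠ ⊤)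
    {f : Eucl N → ℝ} (hf : MemLp f 2 volume) {c : ℝ} (hc : 0 ≤ c) (h : c ≤ ∫ y in s, f y) :
    c ^ 2 / (volume s).toReal ≤ ∫ y in s, f y ^ 2 := by
  set V := (volume s).toReal with hV
  have hV0 : 0 < V := ENNReal.toReal_pos hs0.ne' hs
  have : IsFiniteMeasure (volume.restrict s) := ⟨by simpa using hs.lt_top⟩
  have hfi : IntegrableOn f s volume := (hf.restrict s).integrable one_le_two
  have h1 : ∫ y in s, (2 * (c / V) * f y - (c / V) ^ 2) ≤ ∫ y in s, f y ^ 2 :=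
    integral_mono ((hfi.const_mul _).sub (integrable_const _)) (hf.restrict s).integrable_sq
      fun y => by nlinarith [sq_nonneg (f y - c / V)]
  rw [integral_sub (hfi.const_mul _) (integrable_const _), integral_const_mul, setIntegral_const,
    measureReal_def, ← hV, smul_eq_mul] at h1
  have h2 : 2 * (c / V) * c ≤ 2 * (c / V) * ∫ y in s, f y := by gcongr
  have h3 : 2 * (c / V) * c - V * (c / V) ^ 2 = c ^ 2 / V := by field_simp; ring
  linarith

lemma IsTorsionLimit.tendsto_of_compactEmbedding (hN : 1 ≤ N) (hμ : IsCapacitary μ)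
    {w : Eucl N → ℝ} (hw : IsTorsionLimit μ w) (hc : CompactEmbedding μ) :
    Tendsto (fun R : ℝ => eLpNorm ((Metric.ball (0 : Eucl N) R)ᶜ.indicator w) ⊤ volume)
      atTop (𝓝 0) := by
  obtain ⟨u, hu, hle, hlim⟩ := hw.exists_seq hμ
  have hanti : Antitone fun R : ℝ =>
      eLpNorm ((Metric.ball (0 : Eucl N) R)ᶜ.indicator w) ⊤ volume := fun R S h =>
    eLpNorm_mono fun x => norm_indicator_le_of_subset
      (Set.compl_subset_compl.2 (Metric.ball_subset_ball h)) _ _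
  have ht := tendsto_atTop_iInf hanti
  by_contra hne
  have hpos : 0 < ⨅ R : ℝ, eLpNorm ((Metric.ball (0 : Eucl N) R)ᶜ.indicator w) ⊤ volume := by
    rw [pos_iff_ne_zero]
    intro h0
    rw [h0] at ht
    exact hne ht
  obtain ⟨ε, hε0, hε⟩ := ENNReal.lt_iff_exists_nnreal_btwn.1 hpos
  have hε0 : (0 : ℝ) < ε := by exact_mod_cast hε0
  -- Otherwise all `u n` would be at most `ε` outside the ball almost everywhere, and so would their
  -- limit `w`.
  have hlarge : ∀ R : ℝ, ∃ n, ∃ᶠ x in ae (volume : Measure (Eucl N)),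
      x ∉ Metric.ball (0 : Eucl N) R ∧ ε < (u n).toFun x := by
    intro R
    by_contra! hcon
    have h1 : ∀ᵐ x, ∀ n, x ∉ Metric.ball (0 : Eucl N) R → (u n).toFun x ≤ ε :=
      ae_all_iff.2 hcon
    refine absurd (hε.trans_le (iInf_le _ R)) (not_lt.2 ?_)
    rw [eLpNorm_exponent_top, ← ENNReal.ofReal_coe_nnreal]
    refine eLpNormEssSup_le_of_ae_bound ?_
    filter_upwards [h1, hle, hlim] with x y1 y2 y3
    by_cases hx : x ∈ Metric.ball (0 : Eucl N) R
    · rw [Set.indicator_of_notMem (by simpa using hx), norm_zero]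
      exact hε0.le
    · rw [Set.indicator_of_mem hx, Real.norm_of_nonneg ((y2 0).1.trans (y2 0).2)]
      exact le_of_tendsto y3 (Eventually.of_forall fun n => y1 n hx)
  obtain ⟨K, hK, hmean⟩ := IsBoundedSubsolution.mean_value N
  have hm := meanMass_pos hN
  -- The error `K r²` of the mean value inequality absorbs at most half of `meanMass N * ε`; the
  -- other half yields the lower bound `c` for the integral over the ball of radius `r`.
  obtain ⟨r, hr, hrK⟩ : ∃ r : ℝ, 0 < r ∧ K * r ^ 2 ≤ meanMass N * ε / 2 := by
    refine ⟨√(meanMass N * ε / 2 / K), by positivity, ?_⟩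
    rw [Real.sq_sqrt (by positivity)]
    field_simp
    rfl
  set c : ℝ := meanMass N * ε / 2 * r ^ N / K with hcdef
  have hc0 : 0 < c := by positivity
  set V : ℝ → ℝ := fun s => s ^ N * (volume (Metric.ball (0 : Eucl N) 1)).toReal with hVdef
  have hV : ∀ s, 0 < s → 0 < V s := fun s hs => mul_pos (by positivity)
    (ENNReal.toReal_pos (Metric.measure_ball_pos _ _ one_pos).ne' measure_ball_lt_top.ne)
  refine not_compactEmbedding (C := ((1 + N * (r ^ 2)⁻¹) * V (3 * r)).toNNReal)
    (δ := (√(c ^ 2 / V r)).toNNReal) (μ := μ) ?_ (fun k => ?_) hc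
  · have := hV r hr
    rw [Real.toNNReal_pos]
    positivity
  -- The plateau around `x` lives within distance `2r`, so this radius makes the localized function
  -- vanish on the ball of radius `k`.
  obtain ⟨n, hn⟩ := hlarge (k + 2 * r)
  have hb := (hu n).isBoundedSubsolution hμ measure_ball_lt_top.ne
  obtain ⟨x, ⟨hxR, hxε⟩, hxm⟩ := (hn.and_eventually (hmean _ hb r hr)).exists
  obtain ⟨f, hfm, hf, hfQ⟩ := (hu n).exists_localization hμ measure_ball_lt_top.ne x hr
  refine ⟨f, hfm, ?_, fun y hy => ?_, ?_⟩
  · rw [normSq_eq_ofReal hμ hfm]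
    refine ENNReal.ofReal_le_ofReal ?_
    rwa [volume_closedBall_toReal x (by positivity)] at hfQ
  · rw [mem_ball_zero_iff] at hy
    rw [mem_ball_zero_iff, not_lt] at hxR
    have h1 := norm_sub_norm_le x y
    rw [norm_sub_rev] at h1
    simp only [hf]
    rw [plateau_eq_zero hr (by linarith), zero_mul]
  · have hint : c ≤ ∫ y in Metric.closedBall x r, f.toFun y := by
      have h1 : ∫ y in Metric.closedBall x r, f.toFun y =
          ∫ y in Metric.closedBall x r, (u n).toFun y :=
        setIntegral_congr_fun Metric.isClosed_closedBall.measurableSet fun y hy => by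
          simp only [hf]
          rw [plateau_eq_one hr hy, one_mul]
      rw [h1, hcdef, div_le_iff₀ hK]
      have h2 : meanMass N * ε ≤ meanMass N * (u n).toFun x := by gcongr
      have h3 : meanMass N * ε / 2 ≤
          K * (r ^ N)⁻¹ * ∫ y in Metric.closedBall x r, (u n).toFun y := by linarith
      calc _ ≤ (K * (r ^ N)⁻¹ * ∫ y in Metric.closedBall x r, (u n).toFun y) * r ^ N := by gcongr
        _ = _ := by field_simp
    have h4 := sq_div_le_setIntegral_sq (Metric.measure_closedBall_pos _ _ hr)
      measure_closedBall_lt_top.ne f.memLp_toFun hc0.le hint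
    rw [volume_closedBall_toReal x hr.le] at h4
    have h5 : c ^ 2 / V r ≤ ∫ y, f.toFun y * f.toFun y := by
      refine h4.trans ?_
      simp only [← sq]
      exact setIntegral_le_integral f.memLp_toFun.integrable_sq
        (Eventually.of_forall fun y => sq_nonneg _)
    have h6 : ENNReal.ofReal (c ^ 2 / V r) ≤ eLpNorm f.toFun 2 volume ^ 2 := by
      rw [eLpNorm_two_sq, lintegral_enorm_sq_eq_ofReal f.memLp_toFun]
      exact ENNReal.ofReal_le_ofReal h5
    rw [← ENNReal.pow_le_pow_left_iff two_ne_zero]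
    refine le_trans (le_of_eq ?_) h6
    have := hV r hr
    change ENNReal.ofReal _ ^ 2 = _
    rw [← ENNReal.ofReal_pow (by positivity), Real.sq_sqrt (by positivity)]

end Main

end CapacitaryMeasure

end

theorem theorem3p1 {N : ℕ} (hN : 1 ≤ N) (μ : Measure (CapacitaryMeasure.Eucl N))
    (hμ : CapacitaryMeasure.IsCapacitary μ) :
    (∃ w : CapacitaryMeasure.Eucl N → ℝ, CapacitaryMeasure.IsTorsionLimit μ w) ∧
    ∀ w : CapacitaryMeasure.Eucl N → ℝ, CapacitaryMeasure.IsTorsionLimit μ w →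
      (CapacitaryMeasure.CompactEmbedding μ ↔
        Tendsto (fun R : ℝ =>
            eLpNorm ((Metric.ball (0 : CapacitaryMeasure.Eucl N) R)ᶜ.indicator w) ⊤ volume)
          atTop (𝓝 0)) :=
  ⟨CapacitaryMeasure.exists_isTorsionLimit hμ, fun _ hw =>
    ⟨hw.tendsto_of_compactEmbedding hN hμ, hw.compactEmbedding hμ⟩⟩
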